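/- Setting. A Boolean function on $n$ variables is a map $f:\{0,1\}^n\to\{0,1\}$. A variable $x_i$ is relevant for $f$ if changing the $i$-th coordinate alone can change the value of $f$, and $f$ is a $k$-junta if it has at most $k$ relevant variables. Let $C$ be a non-empty class of $k$-juntas on $n$ variables, $k\ge 1$, that is closed under zero projections (if $f\in C$ and $i\in[n]$, then substituting $0$ for $x_i$ in $f$ gives a function in $C$) and under variable projections (if $f\in C$ and $\pi:[n]\to[n]$ is any map, then $x\mapsto f(x_{\pi(1)},\dots,x_{\pi(n)})$ is in $C$). For $\Gamma\subseteq[n]$ let $C(\Gamma)$ be the set of functions in $C$ whose set of relevant variables is exactly $\Gamma$, and let $N=\max_{\Gamma\subseteq[n]}|C(\Gamma)|$. For a probability distribution $\mathcal D$ on $\{0,1\}^n$, $f$ is $\epsilon$-far from every function in $C$ with respect to $\mathcal D$ if $\Pr_{x\sim\mathcal D}[f(x)\ne g(x)]\ge\epsilon$ for every $g\in C$. Model. An algorithm is a randomized random access machine (natural-number cells, addition, truncated subtraction and indirect addressing at unit cost, fair coin flips). It gets $n$, $k$ and $\lceil 1/\epsilon\rceil$ as input. In one step each it can make a membership query (write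 down $x\in\{0,1\}^n$ and receive $f(x)$), make an example query (receive a random $x$ drawn from $\mathcal D$), or access the class (write down $\Gamma\subseteq[n]$, $x\in\{0,1\}^n$ and $j$, and receive $g(x)$ for the $j$-th function $g$ in some fixed, arbitrarily ordered listing of $C(\Gamma)$, or learn that the listing has no $j$-th function). The running time is the number of steps. The query complexity counts the membership and the example queries. Both are worst-case bounds over all $f$ and all random outcomes. $\tilde O(T)$ means at most $A\,T\,(\log(T+2))^{d}$. Theorem. 1. (Uniform model.) There are an algorithm and absolute constants $A,d$ such that for all $n\ge 0$, $k\ge1$, $0<\epsilon\le1$, all classes $C$ as above, all listings of the sets $C(\Gamma)$, and every Boolean function $f$ on $n$ variables, with $\mathcal D$ the uniform distribution, the algorithm gives a verdict within $A\,(N+n+1/\epsilon)^d$ steps and makes $\tilde O\big((k+\log_2 N)/\epsilon\big)$ queries; if $f\in C$ then it accepts with probability at least $2/3$; if $f$ is $\epsilon$-far from every function in $C$ with respect to the uniform distribution then it rejects with probability at least $2/3$. 2. (Distribution-free model.) There are an algorithm and absolute constants $A,d$ such that for all $n\ge 0$, $k\ge1$, $0<\epsilon\le1$, all classes $C$ as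 above, all listings of the sets $C(\Gamma)$, every probability distribution $\mathcal D$ on $\{0,1\}^n$ (unknown to the algorithm), and every Boolean function $f$ on $n$ variables, the algorithm gives a verdict within $A\,(N+n+1/\epsilon)^d$ steps and makes $\tilde O\big((k/\epsilon)\log_2(2N)\big)$ queries; if $f\in C$ then it accepts with probability at least $2/3$; if $f$ is $\epsilon$-far from every function in $C$ with respect to $\mathcal D$ then it rejects with probability at least $2/3$. (In both parts $A$ and $d$ are also the constants in the $\tilde O$.) -/

import Mathlib

/-! ## Boolean functions, relevant variables, closure properties, distance -/

/-- Boolean functions `{0,1}ⁿ → {0,1}`. -/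
abbrev BoolFn (n : ℕ) : Type := (Fin n → Bool) → Bool

/-- The relevant variables of `f`: those `i` for which changing the `i`-th coordinate alone can
change the value of `f`. -/
def relevantVars {n : ℕ} (f : BoolFn n) : Finset (Fin n) :=
  Finset.univ.filter fun i => ∃ (a : Fin n → Bool) (b : Bool), f a ≠ f (Function.update a i b)

/-- `f` is a `k`-junta: it depends on at most `k` coordinates. -/
def IsJunta {n : ℕ} (k : ℕ) (f : BoolFn n) : Prop :=
  (relevantVars f).card ≤ k

/-- Closure under variable projections: `f(x_{π(1)}, …, x_{π(n)})` is in `C` for all `f ∈ C` and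
all maps `π : [n] → [n]` (not only the bijective ones). -/
def ClosedUnderVariableProjection {n : ℕ} (C : Set (BoolFn n)) : Prop :=
  ∀ f ∈ C, ∀ π : Fin n → Fin n, (fun x => f (fun i => x (π i))) ∈ C

/-- Closure under zero projections: substituting `0` for a variable stays in `C`. -/
def ClosedUnderZeroProjection {n : ℕ} (C : Set (BoolFn n)) : Prop :=
  ∀ f ∈ C, ∀ i : Fin n, (fun x => f (Function.update x i false)) ∈ C

/-- `C(Γ)`: the functions in `C` whose set of relevant variables is exactly `Γ`. -/
def slice {n : ℕ} (C : Set (BoolFn n)) (Γ : Finset (Fin n)) : Set (BoolFn n) :=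
  {f | f ∈ C ∧ relevantVars f = Γ}

/-- `|C(Γ)|`, maximized over `Γ`. -/
noncomputable def maxSliceCard {n : ℕ} (C : Set (BoolFn n)) : ℕ :=
  Finset.univ.sup fun Γ : Finset (Fin n) => (slice C Γ).ncard

/-- The probability of the event `s` under the discrete distribution `p`. -/
noncomputable def prob {α : Type*} (p : PMF α) (s : Set α) : ℝ :=
  (p.toOuterMeasure s).toReal

/-- `f` is `ε`-far from every function in `C` with respect to `D`. -/
def IsFarFrom {n : ℕ} (D : PMF (Fin n → Bool)) (ε : ℝ) (f : BoolFn n) (C : Set (BoolFn n)) : Prop :=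
  ∀ g ∈ C, ε ≤ prob D {x | f x ≠ g x}

/-! ## The machine model

A randomized random access machine whose cells hold natural numbers, programmed in a structured
language.  Memory consists of arrays; array names are literals of the program text, so that a
program uses finitely many of them, while indices are computed.  Arithmetic is addition and
truncated subtraction at unit cost.  There is no multiplication, so the length of the numbers
grows only linearly with the running time and the step count is polynomially related to Turing
machine time. -/

/-- Arithmetic expressions. -/
inductive Expr : Type
  /-- a literal -/
  | lit (c : ℕ)
  /-- the content of the cell of array `a` at index `i` -/
  | cell (a : ℕ) (i : Expr)
  | plus (e₁ e₂ : Expr)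
  | minus (e₁ e₂ : Expr)

/-- Programs. -/
inductive Stmt : Type
  | skip
  /-- `a[i] := e` -/
  | assign (a : ℕ) (i e : Expr)
  | comp (s₁ s₂ : Stmt)
  /-- run `s₁` if `e ≠ 0`, else `s₂` -/
  | cond (e : Expr) (s₁ s₂ : Stmt)
  /-- as long as `e ≠ 0`, run `s` -/
  | loop (e : Expr) (s : Stmt)
  /-- `a[0] :=` a fair random bit -/
  | flip (a : ℕ)
  /-- membership query: `a[0] := f(x)` for the string `x` in `src[0], …, src[n-1]` -/
  | membership (src a : ℕ)
  /-- example query: a string is drawn from the distribution into `a[0], …, a[n-1]` -/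
  | drawExample (a : ℕ)
  /-- access to the class: `a[0] := g(x)`, where `g` is function number `j` in the listing of
  `C(Γ)`, `Γ` is the set with indicator string in `γ[0], …, γ[n-1]`, and `x` is the string in
  `src[0], …, src[n-1]`; if the listing has no function number `j` then `a[0] := 2` -/
  | classValue (γ : ℕ) (j : Expr) (src a : ℕ)
  /-- stop and accept (`true`) or reject (`false`) -/
  | halt (b : Bool)

/-- Memory: `μ a i` is the cell of array `a` at index `i`. -/
abbrev Memory : Type := ℕ → ℕ → ℕ

def Memory.store (μ : Memory) (a i v : ℕ) : Memory :=
  Function.update μ a (Function.update (μ a) i v)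

/-- The string in the first `n` cells of array `a`; a nonzero cell is read as `1`. -/
def Memory.string (μ : Memory) (n a : ℕ) : Fin n → Bool :=
  fun j => decide (μ a j ≠ 0)

/-- Write the string `x` into the first `n` cells of array `a`. -/
def Memory.storeString (μ : Memory) {n : ℕ} (a : ℕ) (x : Fin n → Bool) : Memory :=
  Function.update μ a fun i => if h : i < n then (x ⟨i, h⟩).toNat else μ a i

def Expr.val (μ : Memory) : Expr → ℕ
  | .lit c => c
  | .cell a i => μ a (i.val μ)
  | .plus e₁ e₂ => e₁.val μ + e₂.val μ
  | .minus e₁ e₂ => e₁.val μ - e₂.val μ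

/-- What a machine has access to: the function `f`, the distribution `D`, and, for every set `Γ` of
variables, a list of functions. -/
structure Oracles (n : ℕ) where
  f : BoolFn n
  D : PMF (Fin n → Bool)
  list : Finset (Fin n) → List (BoolFn n)

/-- `L` lists, for every `Γ`, the functions in `C(Γ)`, in some order and each once. -/
def IsListing {n : ℕ} (C : Set (BoolFn n)) (L : Finset (Fin n) → List (BoolFn n)) : Prop :=
  ∀ Γ, (L Γ).Nodup ∧ ∀ g, g ∈ L Γ ↔ g ∈ slice C Γ

/-- The answer to a `classValue` instruction. -/
def classAnswer {n : ℕ} (L : Finset (Fin n) → List (BoolFn n)) (γ : Fin n → Bool) (j : ℕ)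
    (x : Fin n → Bool) : ℕ :=
  match (L (Finset.univ.filter fun i => γ i = true))[j]? with
  | some g => (g x).toNat
  | none => 2

/-- Configurations: the statements still to be run, the memory, the number of membership and
example queries made so far, and the verdict. -/
structure Config where
  todo : List Stmt
  mem : Memory
  queries : ℕ
  verdict : Option Bool

/-- One step of the machine.  Configurations with nothing left to run stay as they are. -/
noncomputable def step {n : ℕ} (O : Oracles n) (c : Config) : PMF Config :=
  match c.todo with
  | [] => PMF.pure c
  | .skip :: r => PMF.pure { c with todo := r }
  | .assign a i e :: r =>
      PMF.pure { c with todo := r, mem := c.mem.store a (i.val c.mem) (e.val c.mem) }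
  | .comp s₁ s₂ :: r => PMF.pure { c with todo := s₁ :: s₂ :: r }
  | .cond e s₁ s₂ :: r =>
      PMF.pure { c with todo := (if e.val c.mem ≠ 0 then s₁ else s₂) :: r }
  | .loop e s :: r =>
      PMF.pure { c with todo := if e.val c.mem ≠ 0 then s :: .loop e s :: r else r }
  | .flip a :: r =>
      (PMF.uniformOfFintype Bool).map fun b =>
        { c with todo := r, mem := c.mem.store a 0 b.toNat }
  | .membership src a :: r =>
      PMF.pure { c with
        todo := r
        mem := c.mem.store a 0 (O.f (c.mem.string n src)).toNat
        queries := c.queries + 1 }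
  | .drawExample a :: r =>
      O.D.map fun x =>
        { c with todo := r, mem := c.mem.storeString a x, queries := c.queries + 1 }
  | .classValue γ j src a :: r =>
      PMF.pure { c with
        todo := r
        mem := c.mem.store a 0
          (classAnswer O.list (c.mem.string n γ) (j.val c.mem) (c.mem.string n src)) }
  | .halt b :: _ => PMF.pure { c with todo := [], verdict := some b }

/-- The distribution of the configuration after `t` steps. -/
noncomputable def runFor {n : ℕ} (O : Oracles n) : ℕ → Config → PMF Config
  | 0, c => PMF.pure c
  | t + 1, c => (step O c).bind (runFor O t)

/-- Start of the program `P` on input `n`, `k`, `m`, stored in the first cells of the arrays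
`0`, `1`, `2`; all other cells are `0`. -/
def startConfig (P : Stmt) (n k m : ℕ) : Config where
  todo := [P]
  mem := fun a i =>
    if i = 0 then (if a = 0 then n else if a = 1 then k else if a = 2 then m else 0) else 0
  queries := 0
  verdict := none

/-! ## Testers -/

/-- With distance parameter `ε`, given to the machine as the natural number `⌈1/ε⌉`, the program `P`
is an `ε`-tester for `C` with respect to `D`: whatever `f` and the outcomes of the random choices
are, it gives its verdict within `time` steps and after at most `queries` queries; it accepts every
`f ∈ C` and rejects every `f` that is `ε`-far from `C`, each with probability at least `2/3`. -/
def IsTester {n : ℕ} (P : Stmt) (k : ℕ) (ε : ℝ) (C : Set (BoolFn n))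
    (L : Finset (Fin n) → List (BoolFn n)) (D : PMF (Fin n → Bool)) (time queries : ℝ) : Prop :=
  ∀ f : BoolFn n, ∃ T : ℕ, (T : ℝ) ≤ time ∧
    (∀ c ∈ (runFor ⟨f, D, L⟩ T (startConfig P n k ⌈1 / ε⌉₊)).support,
      c.verdict ≠ none ∧ (c.queries : ℝ) ≤ queries) ∧
    (f ∈ C →
      2 / 3 ≤ prob (runFor ⟨f, D, L⟩ T (startConfig P n k ⌈1 / ε⌉₊)) {c | c.verdict = some true}) ∧
    (IsFarFrom D ε f C →
      2 / 3 ≤ prob (runFor ⟨f, D, L⟩ T (startConfig P n k ⌈1 / ε⌉₊)) {c | c.verdict = some false})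

/-- The bound `A · t · (log (t + 2))ᵈ`; a quantity is `Õ(t)` if it is at most this for some
constants `A`, `d`. -/
noncomputable def softO (A d : ℕ) (t : ℝ) : ℝ :=
  A * (t * Real.log (t + 2) ^ d)

/-! Let K = min(k, n), E = ⌈1/ε⌉ and u = 1/(8E). The variables are thrown at random into more than
4K² blocks. If `f` is a K-junta, its relevant variables fall into distinct blocks with probability
at least 3/4 (`cost_partition_collision`), and this is the only source of error for `f ∈ C`: once
they are separated, the tester never rejects (`always_uniformTester`,
`always_distributionFreeTester`).

Blocks containing relevant variables are found by drawing examples x with f(x) ≠ f(x restricted to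
the found blocks) and bisecting between the two strings (`State.Sound.add_search`). Each found block
comes with a witness in which clearing the block changes `f`. Witnesses are also forced to vanish
outside the found blocks, and a failure to achieve this exposes a further block
(`State.Sound.always_validate`). When the search stops, `f` is likely to be 2u-close to its
restriction to the found blocks (`cost_searchAll_le`). With separated variables, identifying the
variables of each block then gives a function that lies in `C` by the closure properties and whose
relevant variables are exactly the first q, where q is the number of blocks
(`State.Sound.projected_mem`, `State.Sound.relevantVars_projected`). So a single slice `C(Γ)` has to
be searched.

On each found block `f` should act as one variable or its negation. Differences g(z + x) + g(z) at
random z are tested for additivity, multiplicativity and the value at the all-ones string. If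
violations are rare, their majority value is a ring homomorphism from the Boolean cube to a bit,
hence a coordinate (`majority_xorStr`, `majority_andStr`, `exists_majority_eq`). The same
differences then read the hidden relevant variable of a block at any given string, with an error
that decreases exponentially under repetition (`cost_readBit_ne_le`).

Finally the candidates in the slice are compared with labelled examples, and the tester rejects if
none survives. Every candidate, with its variables renamed, is again in `C`, so it differs from a
far `f` with probability at least 8u; the earlier tests lose only part of this, so each candidate is
refuted by an example with probability at least u, and a union bound over the candidates applies
(`cost_elimination_le`). In the uniform model labelled examples are cheap: a uniform string is
expanded constantly on blocks, at one membership query each, which is justified by a consistency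
test whose cost does not depend on N. In the distribution-free model the relevant variables of every
example must be read, which multiplies k by log N.

The tests are written twice, as abstract randomized computations (`Run`) and as programs. `Impl`
relates the two by weakest preconditions on expected costs and also accounts for steps and queries.
The probabilistic analysis concerns the abstract version only. -/

open scoped ENNReal

/-! ## Runs that may reject -/

/-- Randomized computations with result in `α`; the outcome `none` means rejection. -/
abbrev Run (α : Type) : Type := PMF (Option α)

namespace Run

variable {α β γ : Type}

noncomputable def ret (a : α) : Run α := PMF.pure (some a)

noncomputable def fail : Run α := PMF.pure none

noncomputable def andThen (p : Run α) (g : α → Run β) : Run β :=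
  PMF.bind p fun o => o.elim (PMF.pure none) g

noncomputable def lift (p : PMF α) : Run α := p.map some

/-- Expected cost of the outcome, where a rejection costs `c` and a result `a` costs `w a`. -/
noncomputable def cost (c : ℝ≥0∞) (p : Run α) (w : α → ℝ≥0∞) : ℝ≥0∞ :=
  ∑' o, p o * o.elim c w

/-- `iter F i m a` is the result of `m` rounds `F i`, `F (i+1)`, … from state `a`. -/
noncomputable def iter (F : ℕ → α → Run α) : ℕ → ℕ → α → Run α
  | _, 0, a => ret a
  | i, m + 1, a => andThen (F i a) (iter F (i + 1) m)

end Run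

/-! ### Expectations under discrete distributions. -/

theorem PMF.tsum_pure_mul {α : Type*} (a : α) (w : α → ℝ≥0∞) :
    ∑' x, PMF.pure a x * w x = w a := by
  classical
  rw [tsum_eq_single a]
  · simp
  · intro b hb
    simp [PMF.pure_apply, hb]

theorem PMF.tsum_bind_mul {α β : Type*} (p : PMF α) (g : α → PMF β) (w : β → ℝ≥0∞) :
    ∑' y, (p.bind g) y * w y = ∑' x, p x * ∑' y, g x y * w y := by
  simp_rw [PMF.bind_apply, ← ENNReal.tsum_mul_right, ← ENNReal.tsum_mul_left]
  rw [ENNReal.tsum_comm]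
  simp_rw [mul_assoc]

theorem PMF.tsum_map_mul {α β : Type*} (p : PMF α) (g : α → β) (w : β → ℝ≥0∞) :
    ∑' y, (p.map g) y * w y = ∑' x, p x * w (g x) := by
  rw [PMF.map, PMF.tsum_bind_mul]
  simp only [Function.comp, PMF.tsum_pure_mul]

namespace Run

variable {α β γ : Type}

theorem cost_ret (c : ℝ≥0∞) (a : α) (w : α → ℝ≥0∞) : cost c (ret a) w = w a := by
  exact PMF.tsum_pure_mul _ _

theorem cost_fail (c : ℝ≥0∞) (w : α → ℝ≥0∞) : cost c fail w = c := by
  exact PMF.tsum_pure_mul _ _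

/-- Conditioning on the result of the first stage, with rejection absorbing. The cost of what
follows becomes the weight of what precedes, so costs behave like weakest preconditions. -/
theorem cost_andThen (c : ℝ≥0∞) (p : Run α) (g : α → Run β) (w : β → ℝ≥0∞) :
    cost c (andThen p g) w = cost c p fun a => cost c (g a) w := by
  unfold cost andThen
  rw [PMF.tsum_bind_mul]
  congr 1
  funext o
  cases o
  · exact congrArg _ (PMF.tsum_pure_mul _ _)
  · rfl

theorem cost_lift (c : ℝ≥0∞) (p : PMF α) (w : α → ℝ≥0∞) :
    cost c (lift p) w = ∑' a, p a * w a := by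
  unfold cost lift
  rw [PMF.tsum_map_mul]
  rfl

theorem cost_mono {c : ℝ≥0∞} {p : Run α} {w w' : α → ℝ≥0∞} (h : ∀ a, w a ≤ w' a) :
    cost c p w ≤ cost c p w' := by
  refine ENNReal.tsum_le_tsum fun o => ?_
  cases o
  · simp
  · exact mul_le_mul_right (h _) _

theorem andThen_ret (p : Run α) : andThen p ret = p := by
  have : (fun o : Option α => o.elim (PMF.pure none) ret) = PMF.pure := by
    funext o; cases o <;> rfl
  rw [andThen, this, PMF.bind_pure]

theorem ret_andThen (a : α) (g : α → Run β) : andThen (ret a) g = g a := by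
  simp [andThen, ret, PMF.pure_bind]

theorem andThen_assoc (p : Run α) (g : α → Run β) (h : β → Run γ) :
    (p.andThen g).andThen h = p.andThen fun a => (g a).andThen h := by
  unfold andThen
  rw [PMF.bind_bind]
  congr 1
  funext o
  cases o
  · simp [PMF.pure_bind]
  · rfl

end Run

/-! ## Running configurations -/

section Bounds

variable {n : ℕ} {O : Oracles n}

theorem step_nil {c : Config} (h : c.todo = []) : step O c = PMF.pure c := by
  unfold step; rw [h]

theorem runFor_nil {c : Config} (h : c.todo = []) (t : ℕ) : runFor O t c = PMF.pure c := by
  induction t with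
  | zero => rfl
  | succ t ih => rw [runFor, step_nil h, PMF.pure_bind, ih]

theorem runFor_add (s t : ℕ) (c : Config) :
    runFor O (s + t) c = (runFor O s c).bind (runFor O t) := by
  induction s generalizing c with
  | zero => simp [runFor, PMF.pure_bind]
  | succ s ih =>
    rw [Nat.succ_add, runFor, runFor, PMF.bind_bind]
    congr 1
    funext c'
    exact ih c'

theorem PMF.bind_eq_self {α : Type*} (p : PMF α) (g : α → PMF α)
    (h : ∀ a ∈ p.support, g a = PMF.pure a) : p.bind g = p := by
  conv_rhs => rw [← PMF.bind_pure p]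
  ext b
  rw [PMF.bind_apply, PMF.bind_apply]
  congr 1
  funext a
  by_cases ha : a ∈ p.support
  · rw [h a ha]
  · rw [PMF.mem_support_iff, not_not] at ha
    simp [ha]

/-- Started in `c`, the machine gives its verdict within `T` steps and after at most `q` further
queries, whatever the random outcomes are, and the expected cost of the verdict is at most `v`. -/
def Bound (O : Oracles n) (κ : Bool → ℝ≥0∞) (T q : ℕ) (v : ℝ≥0∞) (c : Config) : Prop :=
  (∀ c' ∈ (runFor O T c).support,
    c'.todo = [] ∧ c'.verdict ≠ none ∧ c'.queries ≤ c.queries + q) ∧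
  ∑' c', runFor O T c c' * c'.verdict.elim 0 κ ≤ v

/-- A configuration with nothing left to run is a fixed point of `step`, so running longer does not
change the distribution. -/
theorem Bound.mono {κ : Bool → ℝ≥0∞} {T T' q q' : ℕ} {v v' : ℝ≥0∞} {c : Config}
    (h : Bound O κ T q v c) (hT : T ≤ T') (hq : q ≤ q') (hv : v ≤ v') :
    Bound O κ T' q' v' c := by
  obtain ⟨d, rfl⟩ := Nat.exists_eq_add_of_le hT
  have : runFor O (T + d) c = runFor O T c := by
    rw [runFor_add]
    exact PMF.bind_eq_self _ _ fun a ha => runFor_nil (h.1 a ha).1 d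
  refine ⟨fun c' hc' => ?_, ?_⟩
  · rw [this] at hc'
    obtain ⟨h1, h2, h3⟩ := h.1 c' hc'
    exact ⟨h1, h2, by omega⟩
  · rw [this]
    exact h.2.trans hv

/-- A step is an average over its random outcomes: the resource bounds must hold for each outcome,
while the verdict costs are averaged. -/
theorem Bound.step {ι : Type} {κ : Bool → ℝ≥0∞} {T q q' : ℕ} {c : Config} {p : PMF ι}
    {k : ι → Config} {w : ι → ℝ≥0∞} (hs : step O c = p.map k)
    (hk : ∀ i, (k i).queries ≤ c.queries + q') (h : ∀ i, Bound O κ T q (w i) (k i)) :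
    Bound O κ (1 + T) (q' + q) (∑' i, p i * w i) c := by
  have hr : runFor O (1 + T) c = p.bind fun i => runFor O T (k i) := by
    rw [Nat.add_comm, runFor, hs, PMF.map, PMF.bind_bind]
    simp [PMF.pure_bind, Function.comp]
  refine ⟨fun c' hc' => ?_, ?_⟩
  · rw [hr, PMF.mem_support_bind_iff] at hc'
    obtain ⟨i, -, hi⟩ := hc'
    obtain ⟨h1, h2, h3⟩ := (h i).1 c' hi
    have := hk i
    exact ⟨h1, h2, by omega⟩
  · rw [hr, PMF.tsum_bind_mul]
    exact ENNReal.tsum_le_tsum fun i => mul_le_mul_right (h i).2 _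

theorem Bound.step_pure {κ : Bool → ℝ≥0∞} {T q q' : ℕ} {c c' : Config} {v : ℝ≥0∞}
    (hs : _root_.step O c = PMF.pure c') (hk : c'.queries ≤ c.queries + q')
    (h : Bound O κ T q v c') : Bound O κ (1 + T) (q' + q) v c := by
  have := Bound.step (p := PMF.pure ()) (k := fun _ => c') (w := fun _ => v) (κ := κ) (T := T)
    (q := q) (q' := q') (c := c) (O := O) (by rw [hs, PMF.pure_map]) (fun _ => hk) (fun _ => h)
  simpa [PMF.tsum_pure_mul] using this

/-! ## Program logic -/

/-- Started in memory `μ`, the statement `s` performs the randomized computation `p`: it takes at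
most `T` steps and `q` queries, and either rejects or goes on with a memory that represents the
result in the sense of `R`. -/
def Impl {α : Type} (O : Oracles n) (s : Stmt) (μ : Memory) (T q : ℕ) (p : Run α)
    (R : α → Memory → Prop) : Prop :=
  ∀ (κ : Bool → ℝ≥0∞) (r : List Stmt) (T' q' : ℕ) (w : α → ℝ≥0∞),
    (∀ a μ', R a μ' → ∀ Q, Bound O κ T' q' (w a) ⟨r, μ', Q, none⟩) →
    ∀ Q, Bound O κ (T + T') (q + q') (p.cost (κ false) w) ⟨s :: r, μ, Q, none⟩

/-- The statement `s` does not reject, and leaves a memory with property `R`. -/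
def Det (O : Oracles n) (s : Stmt) (μ : Memory) (T q : ℕ) (R : Memory → Prop) : Prop :=
  Impl O s μ T q (Run.ret ()) fun _ => R

/-! ### Sequencing rules. -/

variable {α β : Type} {μ : Memory}

theorem Impl.mono {s : Stmt} {T T' q q' : ℕ} {p : Run α} {R R' : α → Memory → Prop}
    (h : Impl O s μ T q p R) (hT : T ≤ T') (hq : q ≤ q') (hR : ∀ a μ', R a μ' → R' a μ') :
    Impl O s μ T' q' p R' := fun κ r T₁ q₁ w hc Q =>
  (h κ r T₁ q₁ w (fun a μ' ha => hc a μ' (hR a μ' ha)) Q).mono (by omega) (by omega) le_rfl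

theorem Det.mono {s : Stmt} {T T' q q' : ℕ} {R R' : Memory → Prop}
    (h : Det O s μ T q R) (hT : T ≤ T') (hq : q ≤ q') (hR : ∀ μ', R μ' → R' μ') :
    Det O s μ T' q' R' :=
  Impl.mono h hT hq fun _ => hR

/-- `Impl` quantifies over the remaining statements and over the bounds that they satisfy, so the
second statement together with everything after it can be taken as the continuation of the first.
The extra step unfolds the composition. -/
theorem Impl.comp {s₁ s₂ : Stmt} {T₁ T₂ q₁ q₂ : ℕ} {p : Run α} {g : α → Run β}
    {R : α → Memory → Prop} {R' : β → Memory → Prop} (h₁ : Impl O s₁ μ T₁ q₁ p R)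
    (h₂ : ∀ a μ', R a μ' → Impl O s₂ μ' T₂ q₂ (g a) R') :
    Impl O (.comp s₁ s₂) μ (1 + T₁ + T₂) (q₁ + q₂) (p.andThen g) R' := by
  intro κ r T' q' w hc Q
  have h := h₁ κ (s₂ :: r) (T₂ + T') (q₂ + q') (fun a => (g a).cost (κ false) w)
    (fun a μ' ha Q' => h₂ a μ' ha κ r T' q' w hc Q') Q
  rw [Run.cost_andThen]
  refine (Bound.step_pure (q' := 0) (by rfl) (by simp) h).mono (by omega) (by omega) le_rfl

theorem Impl.det_comp {s₁ s₂ : Stmt} {T₁ T₂ q₁ q₂ : ℕ} {p : Run β}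
    {R : Memory → Prop} {R' : β → Memory → Prop} (h₁ : Det O s₁ μ T₁ q₁ R)
    (h₂ : ∀ μ', R μ' → Impl O s₂ μ' T₂ q₂ p R') :
    Impl O (.comp s₁ s₂) μ (1 + T₁ + T₂) (q₁ + q₂) p R' := by
  have := Impl.comp (g := fun _ => p) h₁ fun _ μ' => h₂ μ'
  rwa [Run.ret_andThen] at this

theorem Det.comp {s₁ s₂ : Stmt} {T₁ T₂ q₁ q₂ : ℕ} {R R' : Memory → Prop}
    (h₁ : Det O s₁ μ T₁ q₁ R) (h₂ : ∀ μ', R μ' → Det O s₂ μ' T₂ q₂ R') :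
    Det O (.comp s₁ s₂) μ (1 + T₁ + T₂) (q₁ + q₂) R' :=
  Impl.det_comp h₁ h₂

/-- A computation followed by a deterministic statement that completes the representation. -/
theorem Impl.comp_det {s₁ s₂ : Stmt} {T₁ T₂ q₁ q₂ : ℕ} {p : Run α}
    {R R' : α → Memory → Prop} (h₁ : Impl O s₁ μ T₁ q₁ p R)
    (h₂ : ∀ a μ', R a μ' → Det O s₂ μ' T₂ q₂ (R' a)) :
    Impl O (.comp s₁ s₂) μ (1 + T₁ + T₂) (q₁ + q₂) p R' := by
  have := Impl.comp (g := Run.ret) (R' := R') h₁ fun a μ' ha =>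
    (show Impl O s₂ μ' T₂ q₂ (Run.ret a) R' from fun κ r T' q' w hc Q => by
      have := h₂ a μ' ha κ r T' q' (fun _ => w a) (fun _ μ'' h => hc a μ'' h) Q
      rwa [Run.cost_ret] at this ⊢)
  rwa [Run.andThen_ret] at this

theorem Impl.ret_of_det {s : Stmt} {T q : ℕ} {R : α → Memory → Prop} {a : α}
    (h : Det O s μ T q (R a)) : Impl O s μ T q (Run.ret a) R := fun κ r T' q' w hc Q => by
  have := h κ r T' q' (fun _ => w a) (fun _ μ'' h => hc a μ'' h) Q
  rwa [Run.cost_ret] at this ⊢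

/-! ### Primitive statements. -/

theorem Det.skip : Det O .skip μ 1 0 fun μ' => μ' = μ := by
  intro κ r T' q' w hc Q
  rw [Run.cost_ret]
  exact Bound.step_pure (q' := 0) (by rfl) (by simp) (hc () μ rfl Q)

theorem Det.assign (a : ℕ) (i e : Expr) :
    Det O (.assign a i e) μ 1 0 fun μ' => μ' = μ.store a (i.val μ) (e.val μ) := by
  intro κ r T' q' w hc Q
  rw [Run.cost_ret]
  exact Bound.step_pure (q' := 0) (by rfl) (by simp) (hc () _ rfl Q)

theorem Det.membership (src a : ℕ) :
    Det O (.membership src a) μ 1 1 fun μ' =>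
      μ' = μ.store a 0 (O.f (μ.string n src)).toNat := by
  intro κ r T' q' w hc Q
  rw [Run.cost_ret]
  exact Bound.step_pure (q' := 1) (by rfl) (by simp) (hc () _ rfl _)

theorem Det.classValue (γ : ℕ) (j : Expr) (src a : ℕ) :
    Det O (.classValue γ j src a) μ 1 0 fun μ' =>
      μ' = μ.store a 0 (classAnswer O.list (μ.string n γ) (j.val μ) (μ.string n src)) := by
  intro κ r T' q' w hc Q
  rw [Run.cost_ret]
  exact Bound.step_pure (q' := 0) (by rfl) (by simp) (hc () _ rfl _)

theorem Impl.flip (a : ℕ) :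
    Impl O (.flip a) μ 1 0 (Run.lift (PMF.uniformOfFintype Bool)) fun b μ' =>
      μ' = μ.store a 0 b.toNat := by
  intro κ r T' q' w hc Q
  rw [Run.cost_lift]
  exact Bound.step (q' := 0) (by rfl) (by simp) (fun b => hc b _ rfl _)

theorem Impl.drawExample (a : ℕ) :
    Impl O (.drawExample a) μ 1 1 (Run.lift O.D) fun x μ' => μ' = μ.storeString a x := by
  intro κ r T' q' w hc Q
  rw [Run.cost_lift]
  exact Bound.step (q' := 1) (by rfl) (by simp) (fun b => hc b _ rfl _)

/-- Halting discards the continuation, so the cost of rejection is paid at once and the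
postcondition is never used. -/
theorem Impl.reject {R : α → Memory → Prop} :
    Impl O (.halt false) μ 1 0 Run.fail R := by
  intro κ r T' q' w hc Q
  rw [Run.cost_fail]
  have h : Bound O κ 0 0 (κ false) ⟨[], μ, Q, some false⟩ := by
    refine ⟨fun c' hc' => ?_, ?_⟩
    · rw [runFor, PMF.mem_support_pure_iff] at hc'
      subst hc'
      simp
    · rw [runFor, PMF.tsum_pure_mul]
      simp
  exact (Bound.step_pure (q' := 0) (by rfl) (by simp) h).mono (by omega) (by omega) le_rfl

/-! ### Conditionals and loops. -/

theorem Impl.cond {e : Expr} {s₁ s₂ : Stmt} {T q : ℕ} {p : Run α} {R : α → Memory → Prop}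
    (h₁ : e.val μ ≠ 0 → Impl O s₁ μ T q p R) (h₂ : e.val μ = 0 → Impl O s₂ μ T q p R) :
    Impl O (.cond e s₁ s₂) μ (1 + T) q p R := by
  intro κ r T' q' w hc Q
  rw [Nat.add_assoc, ← Nat.zero_add (q + q')]
  by_cases he : e.val μ = 0
  · exact Bound.step_pure (c' := ⟨s₂ :: r, μ, Q, none⟩) (by simp [_root_.step, he])
      (by simp) (h₂ he κ r T' q' w hc Q)
  · exact Bound.step_pure (c' := ⟨s₁ :: r, μ, Q, none⟩) (by simp [_root_.step, he])
      (by simp) (h₁ he κ r T' q' w hc Q)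

theorem Det.cond {e : Expr} {s₁ s₂ : Stmt} {T q : ℕ} {R : Memory → Prop}
    (h₁ : e.val μ ≠ 0 → Det O s₁ μ T q R) (h₂ : e.val μ = 0 → Det O s₂ μ T q R) :
    Det O (.cond e s₁ s₂) μ (1 + T) q R :=
  Impl.cond h₁ h₂

/-- Induction on the number `l` of rounds still to come, with the index `i` counting those done.
Each round pays one step for the test of the guard, and the last, failing test pays one more. -/
theorem Impl.loop {e : Expr} {s : Stmt} {T q : ℕ} {F : ℕ → α → Run α}
    (Inv : ℕ → α → Memory → Prop) (m : ℕ)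
    (hc : ∀ i a μ, Inv i a μ → i ≤ m → (e.val μ ≠ 0 ↔ i < m))
    (hb : ∀ i a μ, Inv i a μ → i < m → Impl O s μ T q (F i a) (Inv (i + 1)))
    (l : ℕ) {i : ℕ} {a : α} (hi : i + l = m) (h0 : Inv i a μ) :
    Impl O (.loop e s) μ (l * (T + 1) + 1) (l * q) (Run.iter F i l a) (Inv m) := by
  induction l generalizing i a μ with
  | zero =>
    intro κ r T' q' w hc' Q
    have he : e.val μ = 0 := by
      by_contra he
      exact absurd ((hc i a μ h0 (by omega)).1 he) (by omega)
    rw [Run.iter, Run.cost_ret]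
    have := hc' a μ (by rw [← hi]; exact h0) Q
    exact (Bound.step_pure (O := O) (q' := 0) (c := ⟨.loop e s :: r, μ, Q, none⟩)
      (by simp [_root_.step, he]) (by simp) this).mono (by omega) (by omega) le_rfl
  | succ l ih =>
    intro κ r T' q' w hc' Q
    have he : e.val μ ≠ 0 := (hc i a μ h0 (by omega)).2 (by omega)
    rw [Run.iter, Run.cost_andThen]
    have := hb i a μ h0 (by omega) κ (.loop e s :: r) (l * (T + 1) + 1 + T') (l * q + q')
      (fun a' => (Run.iter F (i + 1) l a').cost (κ false) w)
      (fun a' μ' h' Q' => ih (i := i + 1) (by omega) h' κ r T' q' w hc' Q') Q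
    exact (Bound.step_pure (O := O) (q' := 0) (c := ⟨.loop e s :: r, μ, Q, none⟩)
      (by simp [_root_.step, he]) (by simp) this).mono (by rw [Nat.succ_mul]; omega)
      (by rw [Nat.succ_mul]; omega) le_rfl

theorem Run.iter_ret (i m : ℕ) (a : α) : Run.iter (fun _ => Run.ret) i m a = Run.ret a := by
  induction m generalizing i with
  | zero => rfl
  | succ m ih => rw [Run.iter, Run.ret_andThen, ih]

theorem Det.loop {e : Expr} {s : Stmt} {T q : ℕ} (Inv : ℕ → Memory → Prop) (m : ℕ)
    (hc : ∀ i μ, Inv i μ → i ≤ m → (e.val μ ≠ 0 ↔ i < m))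
    (hb : ∀ i μ, Inv i μ → i < m → Det O s μ T q (Inv (i + 1))) (h0 : Inv 0 μ) :
    Det O (.loop e s) μ (m * (T + 1) + 1) (m * q) (Inv m) := by
  have := Impl.loop (F := fun _ => Run.ret) (fun i (_ : Unit) => Inv i) m (fun i _ => hc i)
    (fun i _ => hb i) m (Nat.zero_add m) h0 (a := ())
  rwa [Run.iter_ret] at this

end Bounds

/-! ### Updates of single cells. -/

theorem Memory.store_apply (μ : Memory) (a i v b j : ℕ) :
    μ.store a i v b j = if b = a then (if j = i then v else μ a j) else μ b j := by
  unfold Memory.store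
  by_cases hb : b = a
  · subst hb
    by_cases hj : j = i <;> simp [hj]
  · simp [hb]

theorem Memory.store_of_ne (μ : Memory) {a b : ℕ} (i v : ℕ) (h : b ≠ a) :
    μ.store a i v b = μ b := by
  simp [Memory.store, h]

/-! ## Expressions on bits -/

namespace Expr

abbrev var (a : ℕ) : Expr := .cell a (.lit 0)

/-- Boolean operations must be expressed by addition and truncated subtraction; on bits, a + b - 1
is the conjunction. -/
def and (e₁ e₂ : Expr) : Expr := .minus (.plus e₁ e₂) (.lit 1)

/-- Exclusive or on bits; in general, the distance of two numbers. -/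
def dist (e₁ e₂ : Expr) : Expr := .plus (.minus e₁ e₂) (.minus e₂ e₁)

def isZero (e : Expr) : Expr := .minus (.lit 1) e

/-- For bits and c = 1 the first summand is `e₁` and the second truncates to 0; for c = 0 the first
truncates to 0 and the second is `e₂`. -/
def ite (c e₁ e₂ : Expr) : Expr := .plus (.minus (.plus c e₁) (.lit 1)) (.minus e₂ c)

variable {μ : Memory} {e e₁ e₂ c : Expr}

theorem val_and {a b : Bool} (h₁ : e₁.val μ = a.toNat) (h₂ : e₂.val μ = b.toNat) :
    (e₁.and e₂).val μ = (a && b).toNat := by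
  cases a <;> cases b <;> simp [and, val, h₁, h₂]

theorem val_xor {a b : Bool} (h₁ : e₁.val μ = a.toNat) (h₂ : e₂.val μ = b.toNat) :
    (e₁.dist e₂).val μ = (a ^^ b).toNat := by
  cases a <;> cases b <;> simp [dist, val, h₁, h₂]

theorem val_dist_eq_zero : (e₁.dist e₂).val μ = 0 ↔ e₁.val μ = e₂.val μ := by
  simp [dist, val]; omega

theorem val_isZero {k : ℕ} (h : e.val μ = k) : e.isZero.val μ = (decide (k = 0)).toNat := by
  rcases k with _ | k <;> simp [isZero, val, h]

theorem val_nonzero {k : ℕ} (h : e.val μ = k) :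
    e.isZero.isZero.val μ = (decide (k ≠ 0)).toNat := by
  rcases k with _ | k <;> simp [isZero, val, h]

theorem val_eq {k l : ℕ} (h₁ : e₁.val μ = k) (h₂ : e₂.val μ = l) :
    (e₁.dist e₂).isZero.val μ = (decide (k = l)).toNat := by
  rw [val_isZero rfl]
  congr 1
  rw [decide_eq_decide, val_dist_eq_zero, h₁, h₂]

theorem val_ite {a b d : Bool} (h : c.val μ = d.toNat) (h₁ : e₁.val μ = a.toNat)
    (h₂ : e₂.val μ = b.toNat) : (ite c e₁ e₂).val μ = (if d then a else b).toNat := by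
  cases a <;> cases b <;> cases d <;> simp [ite, val, h, h₁, h₂]

end Expr

/-! ## Strings in memory -/

/-- The first `n` cells of array `a` hold the bits of `x`. -/
def Memory.IsStr {n : ℕ} (μ : Memory) (a : ℕ) (x : Fin n → Bool) : Prop :=
  ∀ i : Fin n, μ a i = (x i).toNat

theorem Memory.IsStr.string {n : ℕ} {μ : Memory} {a : ℕ} {x : Fin n → Bool}
    (h : μ.IsStr a x) : μ.string n a = x := by
  funext i
  simp only [Memory.string]
  rw [h i]
  cases x i <;> simp

theorem Memory.IsStr.congr {n : ℕ} {μ μ' : Memory} {a : ℕ} {x : Fin n → Bool}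
    (h : μ.IsStr a x) (h' : μ' a = μ a) : μ'.IsStr a x := fun i => by rw [h', h i]

theorem Memory.isStr_storeString {n : ℕ} (μ : Memory) (a : ℕ) (x : Fin n → Bool) :
    (μ.storeString a x).IsStr a x := fun i => by
  simp [Memory.storeString]

theorem Memory.storeString_of_ne {n : ℕ} (μ : Memory) {a b : ℕ} (x : Fin n → Bool)
    (h : b ≠ a) : μ.storeString a x b = μ b := by
  simp [Memory.storeString, h]

/-- With the index `i` in cell `0` of array `101`, the expression `e` has the value `x i`, as long
as the arrays below `100` are as in `μ`. -/
def Denotes {n : ℕ} (μ : Memory) (e : Expr) (x : Fin n → Bool) : Prop :=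
  ∀ μ' : Memory, (∀ b < 100, μ' b = μ b) → ∀ i : Fin n, μ' 101 0 = i → e.val μ' = (x i).toNat

namespace Denotes

variable {n : ℕ} {μ : Memory} {e e₁ e₂ c : Expr} {x y z : Fin n → Bool}

theorem and (h₁ : Denotes μ e₁ x) (h₂ : Denotes μ e₂ y) :
    Denotes μ (e₁.and e₂) (fun i => x i && y i) := fun μ' h i hi =>
  Expr.val_and (h₁ μ' h i hi) (h₂ μ' h i hi)

theorem xor (h₁ : Denotes μ e₁ x) (h₂ : Denotes μ e₂ y) :
    Denotes μ (e₁.dist e₂) (fun i => x i ^^ y i) := fun μ' h i hi =>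
  Expr.val_xor (h₁ μ' h i hi) (h₂ μ' h i hi)

theorem ite (h : Denotes μ c z) (h₁ : Denotes μ e₁ x) (h₂ : Denotes μ e₂ y) :
    Denotes μ (.ite c e₁ e₂) (fun i => if z i then x i else y i) := fun μ' h' i hi =>
  Expr.val_ite (h μ' h' i hi) (h₁ μ' h' i hi) (h₂ μ' h' i hi)

theorem zero : Denotes μ (.lit 0) (fun _ : Fin n => false) := fun _ _ _ _ => rfl

theorem one : Denotes μ (.lit 1) (fun _ : Fin n => true) := fun _ _ _ _ => rfl

theorem read {a : ℕ} (ha : a < 100) (h : μ.IsStr a x) :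
    Denotes μ (.cell a (.var 101)) x := fun μ' h' i hi => by
  simp only [Expr.val]
  rw [hi, h' a ha, h i]

end Denotes

/-! ## Basic procedures -/

namespace Stmt

/-- A sequence of three statements. -/
abbrev comp₃ (s₁ s₂ s₃ : Stmt) : Stmt := .comp s₁ (.comp s₂ s₃)

/-- `a[0] := e` -/
abbrev set (a : ℕ) (e : Expr) : Stmt := .assign a (.lit 0) e

/-- `a[0] := a[0] + 1` -/
abbrev incr (a : ℕ) : Stmt := .set a (.plus (.var a) (.lit 1))

/-- Run `s` with `a[0]` counting from `0` to `lim`. -/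
def count (a : ℕ) (lim : Expr) (s : Stmt) : Stmt :=
  .comp (.set a (.lit 0)) (.loop (.minus lim (.var a)) (.comp s (.incr a)))

/-- Write a string into array `100`, bit by bit. -/
def fill (e : Expr) : Stmt := .count 101 (.var 0) (.assign 100 (.var 101) e)

/-- `out[0] := f(x)` for the string `x` denoted by `e` -/
def query (e : Expr) (out : ℕ) : Stmt := .comp (.fill e) (.membership 100 out)

/-- Write the string denoted by `e` into array `a` from index `off` on. -/
def write (a : ℕ) (off e : Expr) : Stmt :=
  .comp (.fill e)
    (.count 101 (.var 0) (.assign a (.plus off (.var 101)) (.cell 100 (.var 101))))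

/-- Write a uniformly random string into array `a`. -/
def randomString (a : ℕ) : Stmt :=
  .count 101 (.var 0) (.comp (.flip 102) (.assign a (.var 101) (.var 102)))

/-- `a[0] := lim * e` -/
def mul (a : ℕ) (lim e : Expr) : Stmt :=
  .comp (.set a (.lit 0)) (.count 101 lim (.set a (.plus (.var a) e)))

/-- `a[0] :=` the length of the binary representation of `e` -/
def size (a : ℕ) (e : Expr) : Stmt :=
  .comp₃ (.set a (.lit 0)) (.set 102 (.lit 1))
    (.loop (.minus (.plus e (.lit 1)) (.var 102))
      (.comp (.set 102 (.plus (.var 102) (.var 102))) (.incr a)))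

end Stmt

section Procedures

variable {n : ℕ} {O : Oracles n} {μ : Memory} {α : Type}

/-- The rule for counting loops. -/
theorem Impl.count {a : ℕ} {lim : Expr} {s : Stmt} {T q : ℕ} {F : ℕ → α → Run α}
    (Inv : ℕ → α → Memory → Prop) (m : ℕ) {x : α}
    (h0 : ∀ μ', (∀ b, b ≠ a → μ' b = μ b) → μ' a 0 = 0 → Inv 0 x μ')
    (hc : ∀ i x μ', Inv i x μ' → i ≤ m → lim.val μ' = m ∧ μ' a 0 = i)
    (hb : ∀ i x μ', Inv i x μ' → i < m → Impl O s μ' T q (F i x) fun y μ'' =>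
      μ'' a 0 = i ∧ ∀ μ₃ : Memory, (∀ b, b ≠ a → μ₃ b = μ'' b) → μ₃ a 0 = i + 1 →
        Inv (i + 1) y μ₃) :
    Impl O (.count a lim s) μ (m * (T + 3) + 3) (m * q) (Run.iter F 0 m x) (Inv m) := by
  unfold Stmt.count
  refine (Impl.det_comp (Det.assign _ _ _) fun μ₁ h₁ => ?_ : Impl O _ μ (1 + 1 + (m * (T + 3) + 1))
    (0 + m * q) _ _).mono (by omega) (by omega) fun _ _ h => h
  -- Besides its body, a round pays for the composition, the increment and the test of the guard.
  refine (Impl.loop (T := 1 + T + 1) (q := q + 0) Inv m ?_ ?_ m (Nat.zero_add m) ?_).mono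
    (by rw [show 1 + T + 1 + 1 = T + 3 by omega]) (by simp) fun _ _ h => h
  · intro i x μ' h hi
    obtain ⟨h1, h2⟩ := hc i x μ' h hi
    simp only [Expr.val, h1, h2]
    omega
  · intro i x μ' h hi
    refine Impl.comp_det (hb i x μ' h hi) fun y μ'' hy => ?_
    refine (Det.assign _ _ _).mono le_rfl le_rfl fun μ₃ h₃ => ?_
    refine hy.2 μ₃ (fun b hb => ?_) ?_
    · rw [h₃, Memory.store_of_ne _ _ _ hb]
    · rw [h₃, Memory.store_apply]
      simp [Expr.val, hy.1]
  · refine h0 μ₁ (fun b hb => ?_) ?_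
    · rw [h₁, Memory.store_of_ne _ _ _ hb]
    · rw [h₁, Memory.store_apply]
      simp [Expr.val]

theorem Det.count {a : ℕ} {lim : Expr} {s : Stmt} {T q : ℕ}
    (Inv : ℕ → Memory → Prop) (m : ℕ)
    (h0 : ∀ μ', (∀ b, b ≠ a → μ' b = μ b) → μ' a 0 = 0 → Inv 0 μ')
    (hc : ∀ i μ', Inv i μ' → i ≤ m → lim.val μ' = m ∧ μ' a 0 = i)
    (hb : ∀ i μ', Inv i μ' → i < m → Det O s μ' T q fun μ'' =>
      μ'' a 0 = i ∧ ∀ μ₃ : Memory, (∀ b, b ≠ a → μ₃ b = μ'' b) → μ₃ a 0 = i + 1 →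
        Inv (i + 1) μ₃) :
    Det O (.count a lim s) μ (m * (T + 3) + 3) (m * q) (Inv m) := by
  have := Impl.count (F := fun _ => Run.ret) (fun i (_ : Unit) => Inv i) m h0 (fun i _ => hc i)
    (fun i _ => hb i) (x := ())
  rwa [Run.iter_ret] at this

/-- The loop writes only to arrays 100 and 101, while `Denotes` requires only the arrays below 100
to be unchanged. So each bit is evaluated as if nothing had been written before it. -/
theorem Det.fill {e : Expr} {x : Fin n → Bool} (hn : μ 0 0 = n) (he : Denotes μ e x) :
    Det O (.fill e) μ (4 * n + 3) 0 fun μ' =>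
      μ'.IsStr 100 x ∧ ∀ b, b < 100 → μ' b = μ b := by
  refine (Det.count (T := 1) (q := 0) (fun i μ' => μ' 101 0 = i ∧ (∀ b < 100, μ' b = μ b) ∧
    ∀ j : Fin n, (j : ℕ) < i → μ' 100 j = (x j).toNat) n ?_ ?_ ?_).mono (by omega) (by omega) ?_
  · intro μ' h h0
    exact ⟨h0, fun b hb => h b (by omega), fun j hj => by omega⟩
  · rintro i μ' ⟨h1, h2, -⟩ hi
    simp [Expr.val, h2, hn, h1]
  · rintro i μ' ⟨h1, h2, h3⟩ hi
    refine (Det.assign _ _ _).mono le_rfl le_rfl fun μ'' h => ?_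
    have hv := he μ' h2 ⟨i, hi⟩ h1
    simp only [Expr.val, h1, hv] at h
    refine ⟨by rw [h, Memory.store_of_ne _ _ _ (by decide), h1], fun μ₃ h₃ h4 =>
      ⟨h4, fun b hb => ?_, fun j hj => ?_⟩⟩
    · rw [h₃ b (by omega), h, Memory.store_of_ne _ _ _ (by omega), h2 b hb]
    · rw [h₃ _ (by decide), h, Memory.store_apply]
      by_cases hji : (j : ℕ) = i
      · have : j = ⟨i, hi⟩ := Fin.ext hji
        subst this
        simp
      · simp only [hji, if_true, if_false]
        exact h3 j (by omega)
  · rintro μ' ⟨-, h2, h3⟩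
    exact ⟨fun j => h3 j j.2, h2⟩

theorem Det.query {e : Expr} {x : Fin n → Bool} {out : ℕ} (hn : μ 0 0 = n)
    (he : Denotes μ e x) :
    Det O (.query e out) μ (4 * n + 5) 1 fun μ' =>
      μ' out 0 = (O.f x).toNat ∧ ∀ b < 100, b ≠ out → μ' b = μ b := by
  refine (Det.comp (T₂ := 1) (q₂ := 1) (Det.fill hn he) fun μ₁ h₁ => ?_).mono (by omega)
    (by omega) fun _ h => h
  refine (Det.membership _ _).mono le_rfl le_rfl ?_
  rintro μ' rfl
  rw [h₁.1.string]
  refine ⟨by simp [Memory.store_apply], fun b hb hne => ?_⟩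
  rw [Memory.store_of_ne _ _ _ hne, h₁.2 b hb]

/-- The string is completed in scratch memory before it is copied, so `e` may read the target array
itself. Only the offset has to be stable under the writes. -/
theorem Det.write {a : ℕ} {off e : Expr} {x : Fin n → Bool} {k : ℕ} (hn : μ 0 0 = n) (ha0 : a ≠ 0)
    (ha : a < 100) (he : Denotes μ e x)
    (hoff : ∀ μ' : Memory, (∀ b < 100, b ≠ a → μ' b = μ b) → off.val μ' = k) :
    Det O (.write a off e) μ (8 * n + 7) 0 fun μ' =>
      (∀ i : Fin n, μ' a (k + i) = (x i).toNat) ∧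
      (∀ j, (j < k ∨ k + n ≤ j) → μ' a j = μ a j) ∧ ∀ b < 100, b ≠ a → μ' b = μ b := by
  refine (Det.comp (T₂ := 4 * n + 3) (q₂ := 0) (Det.fill hn he) fun μ₁ h₁ => ?_).mono (by omega)
    (by omega) fun _ h => h
  refine (Det.count (T := 1) (q := 0) (fun i μ' => μ' 101 0 = i ∧ μ'.IsStr 100 x ∧
    (∀ b < 100, b ≠ a → μ' b = μ b) ∧ (∀ j : Fin n, (j : ℕ) < i → μ' a (k + j) = (x j).toNat) ∧
    (∀ j, (j < k ∨ k + n ≤ j) → μ' a j = μ a j)) n ?_ ?_ ?_).mono (by omega) (by omega) ?_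
  · intro μ' h h0
    refine ⟨h0, h₁.1.congr (h _ (by decide)), fun b hb _ => ?_, fun j hj => by omega,
      fun j hj => ?_⟩
    · rw [h b (by omega), h₁.2 b hb]
    · rw [h a (by omega), h₁.2 a ha]
  · rintro i μ' ⟨h1, -, h2, -⟩ hi
    simp [Expr.val, h2 0 (by decide) ha0.symm, hn, h1]
  · rintro i μ' ⟨h1, h2, h3, h4, h5⟩ hi
    refine (Det.assign _ _ _).mono le_rfl le_rfl fun μ'' h => ?_
    have hx := h2 ⟨i, hi⟩
    simp only [Expr.val, h1, hx, hoff μ' h3] at h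
    refine ⟨by rw [h, Memory.store_of_ne _ _ _ (by omega), h1], fun μ₃ h₆ h₇ =>
      ⟨h₇, h2.congr ?_, fun b hb hne => ?_, fun j hj => ?_, fun j hj => ?_⟩⟩
    · rw [h₆ _ (by decide), h, Memory.store_of_ne _ _ _ (by omega)]
    · rw [h₆ _ (by omega), h, Memory.store_of_ne _ _ _ hne, h3 b hb hne]
    · rw [h₆ _ (by omega), h, Memory.store_apply]
      by_cases hji : (j : ℕ) = i
      · have : j = ⟨i, hi⟩ := Fin.ext hji
        subst this
        simp
      · rw [if_pos rfl, if_neg (by omega)]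
        exact h4 j (by omega)
    · rw [h₆ _ (by omega), h, Memory.store_apply, if_pos rfl, if_neg (by omega)]
      exact h5 j hj
  · rintro μ' ⟨-, -, h3, h4, h5⟩
    exact ⟨fun j => h4 j j.2, h5, h3⟩

theorem Det.mul {a : ℕ} {lim e : Expr} {l k : ℕ} (ha : a < 100)
    (h : ∀ μ' : Memory, (∀ b < 100, b ≠ a → μ' b = μ b) → lim.val μ' = l ∧ e.val μ' = k) :
    Det O (.mul a lim e) μ (4 * l + 5) 0 fun μ' =>
      μ' a 0 = l * k ∧ ∀ b < 100, b ≠ a → μ' b = μ b := by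
  refine (Det.comp (T₂ := 4 * l + 3) (q₂ := 0) (Det.assign _ _ _) fun μ₁ h₁ => ?_).mono (by omega)
    (by omega) fun _ h => h
  refine (Det.count (T := 1) (q := 0) (fun i μ' => μ' 101 0 = i ∧ μ' a 0 = i * k ∧
    (∀ b < 100, b ≠ a → μ' b = μ b)) l ?_ ?_ ?_).mono (by omega) (by omega) ?_
  · intro μ' h h0
    refine ⟨h0, ?_, fun b hb hne => ?_⟩
    · rw [h a (by omega), h₁, Memory.store_apply]
      simp [Expr.val]
    · rw [h b (by omega), h₁, Memory.store_of_ne _ _ _ hne]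
  · rintro i μ' ⟨h1, -, h3⟩ hi
    exact ⟨(h μ' h3).1, h1⟩
  · rintro i μ' ⟨h1, h2, h3⟩ hi
    refine (Det.assign _ _ _).mono le_rfl le_rfl fun μ'' h' => ?_
    simp only [Expr.val, (h μ' h3).2, h2] at h'
    refine ⟨by rw [h', Memory.store_of_ne _ _ _ (by omega), h1], fun μ₃ h₆ h₇ =>
      ⟨h₇, ?_, fun b hb hne => ?_⟩⟩
    · rw [h₆ _ (by omega), h', Memory.store_apply]
      simp [Nat.succ_mul]
    · rw [h₆ _ (by omega), h', Memory.store_of_ne _ _ _ hne, h3 b hb hne]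
  · rintro μ' ⟨-, h⟩
    exact h

theorem Det.size {a : ℕ} {e : Expr} {k : ℕ} (ha : a < 100)
    (h : ∀ μ' : Memory, (∀ b < 100, b ≠ a → μ' b = μ b) → e.val μ' = k) :
    Det O (.size a e) μ (4 * k.size + 5) 0 fun μ' =>
      μ' a 0 = k.size ∧ ∀ b < 100, b ≠ a → μ' b = μ b := by
  refine (Det.comp (T₂ := 4 * k.size + 3) (q₂ := 0) (Det.assign _ _ _) fun μ₁ h₁ => ?_).mono
    (by omega) (by omega) fun _ h => h
  refine (Det.comp (T₂ := 4 * k.size + 1) (q₂ := 0) (Det.assign _ _ _) fun μ₂ h₂ => ?_).mono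
    (by omega) (by omega) fun _ h => h
  refine (Det.loop (T := 3) (q := 0) (fun i μ' => μ' 102 0 = 2 ^ i ∧ μ' a 0 = i ∧
    (∀ b < 100, b ≠ a → μ' b = μ b)) k.size ?_ ?_ ?_).mono (by omega) (by omega) ?_
  · rintro i μ' ⟨h1, -, h3⟩ hi
    simp only [Expr.val, h1, h μ' h3]
    -- The guard k + 1 - 2 ^ i is nonzero exactly when 2 ^ i ≤ k.
    rw [Nat.lt_size]
    omega
  · rintro i μ' ⟨h1, h2, h3⟩ hi
    refine (Det.comp (T₂ := 1) (q₂ := 0) (Det.assign _ _ _) fun μ₃ h₃ => ?_).mono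
      (by omega) (by omega) fun _ h => h
    refine (Det.assign _ _ _).mono le_rfl le_rfl fun μ'' h' => ?_
    simp only [Expr.val, h1] at h₃
    simp only [Expr.val] at h'
    refine ⟨?_, ?_, fun b hb hne => ?_⟩
    · rw [h', Memory.store_of_ne _ _ _ (by omega), h₃, Memory.store_apply]
      simp [pow_succ, mul_two]
    · rw [h', Memory.store_apply, h₃, Memory.store_of_ne _ _ _ (by omega), h2]
      simp
    · rw [h', Memory.store_of_ne _ _ _ (by omega), h₃, Memory.store_of_ne _ _ _ (by omega),
        h3 b hb hne]
  · refine ⟨?_, ?_, fun b hb hne => ?_⟩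
    · rw [h₂, Memory.store_apply]
      simp [Expr.val]
    · rw [h₂, Memory.store_of_ne _ _ _ (by omega), h₁, Memory.store_apply]
      simp [Expr.val]
    · rw [h₂, Memory.store_of_ne _ _ _ (by omega), h₁, Memory.store_of_ne _ _ _ (by omega)]
  · rintro μ' ⟨-, h⟩
    exact h

/-! ## Random strings -/

theorem PMF.tsum_uniformOfFintype_mul {ι : Type*} [Fintype ι] [Nonempty ι] (w : ι → ℝ≥0∞) :
    ∑' x, PMF.uniformOfFintype ι x * w x = (Fintype.card ι : ℝ≥0∞)⁻¹ * ∑ x, w x := by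
  rw [tsum_fintype, Finset.mul_sum]
  simp

/-- The two updates of `x` at `i` are `x` itself and `x` with bit `i` flipped, and flipping is a
bijection of the cube. -/
theorem sum_update_bool (i : Fin n) (w : (Fin n → Bool) → ℝ≥0∞) :
    ∑ b : Bool, ∑ x, w (Function.update x i b) = 2 * ∑ x, w x := by
  have h : ∀ x : Fin n → Bool, ∑ b : Bool, w (Function.update x i b) =
      w x + w (Function.update x i (!x i)) := by
    intro x
    rw [Fintype.sum_bool]
    cases hx : x i
    · rw [add_comm]
      congr 2
      rw [← hx, Function.update_eq_self]
    · congr 2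
      rw [← hx, Function.update_eq_self]
  rw [Finset.sum_comm, Finset.sum_congr rfl fun x _ => h x, Finset.sum_add_distrib, two_mul]
  congr 1
  refine Equiv.sum_comp (Function.Involutive.toPerm
    (fun x : Fin n → Bool => Function.update x i (!x i)) fun x => ?_) w
  funext j
  by_cases hj : j = i
  · subst hj; simp
  · simp [hj]

/-- One coin flip of a random string. -/
noncomputable def flipAt (n : ℕ) (i : ℕ) (a : Fin n → Bool) : Run (Fin n → Bool) :=
  (Run.lift (PMF.uniformOfFintype Bool)).andThen fun b =>
    Run.ret (fun j => if (j : ℕ) = i then b else a j)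

/-- After `i` flips the first `i` coordinates are settled and the others are still to be averaged.
Each flip averages one more coordinate, by `sum_update_bool`. -/
theorem cost_iter_flipAt (c : ℝ≥0∞) (w : (Fin n → Bool) → ℝ≥0∞) (l i : ℕ) (hi : i + l = n)
    (a : Fin n → Bool) : (Run.iter (flipAt n) i l a).cost c w =
      (Fintype.card (Fin n → Bool) : ℝ≥0∞)⁻¹ *
        ∑ x : Fin n → Bool, w fun j => if (j : ℕ) < i then a j else x j := by
  induction l generalizing i a with
  | zero =>
    have : ∀ x : Fin n → Bool, (fun j : Fin n => if (j : ℕ) < i then a j else x j) = a := by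
      intro x; funext j; simp [show (j : ℕ) < i by omega]
    rw [Run.iter, Run.cost_ret]
    simp only [this, Finset.sum_const, Finset.card_univ, nsmul_eq_mul]
    rw [← mul_assoc, ENNReal.inv_mul_cancel, one_mul]
    · simp
    · exact ENNReal.natCast_ne_top _
  | succ l ih =>
    have hlt : i < n := by omega
    rw [Run.iter, Run.cost_andThen, flipAt, Run.cost_andThen, Run.cost_lift,
      PMF.tsum_uniformOfFintype_mul]
    simp only [Run.cost_ret]
    simp only [ih (i + 1) (by omega)]
    rw [← Finset.mul_sum, mul_left_comm]
    congr 1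
    have key := sum_update_bool ⟨i, hlt⟩
      fun x => w fun j : Fin n => if (j : ℕ) < i then a j else x j
    have h2 : ∀ (b : Bool) (x : Fin n → Bool), (fun j : Fin n => if (j : ℕ) < i + 1 then
        (if (j : ℕ) = i then b else a j) else x j) = fun j : Fin n => if (j : ℕ) < i then a j else
          Function.update x ⟨i, hlt⟩ b j := by
      intro b x
      funext j
      rcases lt_trichotomy (j : ℕ) i with h | h | h
      · simp [h, h.ne, Nat.lt_succ_of_lt h]
      · have : j = ⟨i, hlt⟩ := Fin.ext h
        subst this
        simp
      · have : j ≠ ⟨i, hlt⟩ := fun hj => by simp [hj] at h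
        simp [this, not_lt.2 h.le, show ¬ (j : ℕ) < i + 1 by omega]
    simp only [h2, key]
    rw [← mul_assoc, Fintype.card_bool, Nat.cast_ofNat, ENNReal.inv_mul_cancel (by simp) (by simp),
      one_mul]

/-- `Impl` sees a computation only through its costs, so `n` coin flips may be replaced by one
uniform string without identifying the two distributions. -/
theorem Impl.congr_cost {s : Stmt} {T q : ℕ} {p p' : Run α} {R : α → Memory → Prop}
    (h : Impl O s μ T q p R) (hp : ∀ c w, p'.cost c w = p.cost c w) : Impl O s μ T q p' R := by
  intro κ r T' q' w hc Q
  rw [hp]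
  exact h κ r T' q' w hc Q

/-- A uniformly random string. -/
noncomputable def Run.uniform (n : ℕ) : Run (Fin n → Bool) :=
  Run.lift (PMF.uniformOfFintype (Fin n → Bool))

theorem Impl.randomString {a : ℕ} (hn : μ 0 0 = n) (ha0 : a ≠ 0) (ha : a < 100) :
    Impl O (.randomString a) μ (6 * n + 3) 0 (Run.uniform n) fun x μ' =>
      μ'.IsStr a x ∧ ∀ b < 100, b ≠ a → μ' b = μ b := by
  have := Impl.count (O := O) (μ := μ) (a := 101) (lim := .var 0)
    (s := .comp (.flip 102) (.assign a (.var 101) (.var 102))) (T := 3) (q := 0) (F := flipAt n)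
    (fun i x μ' => μ' 101 0 = i ∧ (∀ b < 100, b ≠ a → μ' b = μ b) ∧
      ∀ j : Fin n, (j : ℕ) < i → μ' a j = (x j).toNat) n (x := fun _ => false) ?_ ?_ ?_
  · refine (this.congr_cost fun c w => ?_).mono (by omega) (by omega) ?_
    · rw [cost_iter_flipAt c w n 0 (Nat.zero_add n), Run.uniform, Run.cost_lift,
        PMF.tsum_uniformOfFintype_mul]
      simp
    · rintro x μ' ⟨-, h2, h3⟩
      exact ⟨fun j => h3 j j.2, h2⟩
  · intro μ' h h0
    exact ⟨h0, fun b hb _ => h b (by omega), fun j hj => by omega⟩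
  · rintro i x μ' ⟨h1, h2, -⟩ hi
    simp [Expr.val, h2 0 (by decide) ha0.symm, hn, h1]
  · rintro i x μ' ⟨h1, h2, h3⟩ hi
    refine Impl.comp (T₁ := 1) (T₂ := 1) (q₁ := 0) (q₂ := 0) (Impl.flip 102) fun b μ₁ h₁ => ?_
    refine Impl.ret_of_det ((Det.assign _ _ _).mono le_rfl le_rfl fun μ'' h => ?_)
    simp only [Expr.val, h₁, Memory.store_apply] at h
    simp only [Nat.reduceEqDiff, if_true, if_false, h1] at h
    refine ⟨by rw [h, Memory.store_of_ne _ _ _ (by omega), Memory.store_of_ne _ _ _ (by omega), h1],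
      fun μ₃ h₆ h₇ => ⟨h₇, fun b hb hne => ?_, fun j hj => ?_⟩⟩
    · rw [h₆ _ (by omega), h, Memory.store_of_ne _ _ _ hne, Memory.store_of_ne _ _ _ (by omega),
        h2 b hb hne]
    · rw [h₆ _ (by omega), h, Memory.store_apply, if_pos rfl]
      by_cases hji : (j : ℕ) = i
      · simp [hji]
      · rw [if_neg hji, Memory.store_of_ne _ _ _ (by omega), h3 j (by omega)]
        simp only [hji, if_false]

end Procedures

/-! ## The search for relevant blocks -/

/-- The variables are divided into blocks with labels in `ℕ`.  `num` blocks have been found; the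
block with label `ℓ` is found if `pos ℓ ≠ 0`, and is then number `pos ℓ - 1`.  Clearing block number
`p` in the string `wit p` changes the value of the function.  For `p < val` this string vanishes
outside of the found blocks. -/
structure State (n : ℕ) where
  num : ℕ
  pos : ℕ → ℕ
  wit : ℕ → Fin n → Bool
  val : ℕ

section Strings

variable {n : ℕ}

/-- `u` restricted to the coordinates with `c i ≠ 0`. -/
def restr (c : Fin n → ℕ) (u : Fin n → Bool) : Fin n → Bool :=
  fun i => u i && decide (c i ≠ 0)

/-- `u` restricted to the coordinates with `c i ≠ 0` and the blocks with label less than `j`. -/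
def hybrid (blk c : Fin n → ℕ) (u : Fin n → Bool) (j : ℕ) : Fin n → Bool :=
  fun i => u i && decide (c i + (j - blk i) ≠ 0)

/-- `w` with the coordinates in block number `p` replaced by those of `z`. -/
def substBlock (c : Fin n → ℕ) (p : ℕ) (w z : Fin n → Bool) : Fin n → Bool :=
  fun i => if c i = p + 1 then z i else w i

end Strings

/-- Bisection of `[0, 2 ^ b]` for a place where `P` changes from `false` to `true`. -/
def bisect (P : ℕ → Bool) (b : ℕ) : ℕ → ℕ
  | 0 => 0
  | i + 1 => if P (bisect P b i + 2 ^ (b - 1 - i)) then bisect P b i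
      else bisect P b i + 2 ^ (b - 1 - i)

/-- The number of bits of a label. -/
def labelBits (K : ℕ) : ℕ := K.size + K.size + 2

/-- The number of examples drawn until a set of blocks is considered complete. -/
def searchSamples (K E : ℕ) : ℕ := (K.size + 8) * (E + E + E + E)

/-- The number of times that a reading is repeated. -/
def readReps (K E : ℕ) : ℕ := K.size + E.size + 8

namespace State

variable {n : ℕ}

def init (n : ℕ) : State n := ⟨0, fun _ => 0, fun _ _ => false, 0⟩

/-- The number of the block of a variable, plus one, or zero if this block has not been found. -/
def coord (S : State n) (blk : Fin n → ℕ) : Fin n → ℕ := fun i => S.pos (blk i)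

/-- Since `val` is unchanged, the new witness stays among those still to be restricted to the found
blocks. -/
def add (S : State n) (l : ℕ) (w : Fin n → Bool) : State n :=
  ⟨S.num + 1, Function.update S.pos l (S.num + 1), Function.update S.wit S.num w, S.val⟩

/-- A label at which the restrictions of `u` change the value of `f`. -/
def search (f : BoolFn n) (blk : Fin n → ℕ) (K : ℕ) (S : State n) (u : Fin n → Bool) : ℕ :=
  bisect (fun j => f (hybrid blk (S.coord blk) u j) ^^ f (restr (S.coord blk) u))
    (labelBits K) (labelBits K)

/-- The stored witness is the first hybrid past the change of value; clearing the new block in it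
gives back the hybrid before the change. A block beyond the first `K` leads to rejection, since in
each found block some relevant variable would lie. -/
noncomputable def extend (f : BoolFn n) (blk : Fin n → ℕ) (K : ℕ) (S : State n)
    (u : Fin n → Bool) : Run (State n) :=
  if S.num < K then
    Run.ret (S.add (S.search f blk K u)
      (hybrid blk (S.coord blk) u (S.search f blk K u + 1)))
  else Run.fail

/-- Draw an example unless an example `u` with `f(u) ≠ f(restr u)` is already known. -/
noncomputable def sample (f : BoolFn n) (D : PMF (Fin n → Bool)) (c : Fin n → ℕ) :
    Option (Fin n → Bool) → Run (Option (Fin n → Bool))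
  | some u => Run.ret (some u)
  | none => (Run.lift D).andThen fun u => Run.ret (if f u ^^ f (restr c u) then some u else none)

/-- Rounds after a success are idle rather than cut off, which keeps the number of rounds fixed. -/
noncomputable def findBad (f : BoolFn n) (D : PMF (Fin n → Bool)) (c : Fin n → ℕ) (M : ℕ) :
    Run (Option (Fin n → Bool)) :=
  Run.iter (fun _ => sample f D c) 0 M none

/-- A round of the search if there is a witness to be restricted. -/
noncomputable def validate (f : BoolFn n) (blk : Fin n → ℕ) (K : ℕ) (S : State n) :
    Run (State n) :=
  let c := S.coord blk
  let w := S.wit S.val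
  let w₀ := substBlock c S.val w fun _ => false
  if f (restr c w) ^^ f (restr c w₀) then
    Run.ret { S with wit := Function.update S.wit S.val (restr c w), val := S.val + 1 }
  else S.extend f blk K (if f w ^^ f (restr c w) then w else w₀)

/-- A round of the search; the bit is set when the search is complete. -/
noncomputable def round (f : BoolFn n) (D : PMF (Fin n → Bool)) (blk : Fin n → ℕ) (K E : ℕ) :
    State n × Bool → Run (State n × Bool)
  | (S, true) => Run.ret (S, true)
  | (S, false) =>
    if S.val < S.num then (S.validate f blk K).andThen fun S' => Run.ret (S', false)
    else (findBad f D (S.coord blk) (searchSamples K E)).andThen fun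
      | none => Run.ret (S, true)
      | some u => (S.extend f blk K u).andThen fun S' => Run.ret (S', false)

/-- The search for relevant blocks. -/
noncomputable def searchAll (f : BoolFn n) (D : PMF (Fin n → Bool)) (blk : Fin n → ℕ) (K E : ℕ) :
    Run (State n) :=
  (Run.iter (fun _ => round f D blk K E) 0 (K + K + 2) (init n, false)).andThen fun s =>
    if s.2 then Run.ret s.1 else Run.fail

end State

/-! ## The search as a program -/

/-- The constants that are computed first. -/
structure Consts (n K E : ℕ) (μ : Memory) : Prop where
  dim : μ 0 0 = n
  inv : μ 2 0 = E
  size : μ 3 0 = K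
  bits : μ 4 0 = labelBits K
  pow : ∀ j < labelBits K, μ 5 j = 2 ^ j
  samples : μ 6 0 = searchSamples K E
  reps : μ 7 0 = readReps K E

theorem Consts.congr {n K E : ℕ} {μ μ' : Memory} (h : Consts n K E μ)
    (hμ : ∀ b < 10, μ' b = μ b) : Consts n K E μ' := by
  constructor <;> simp (disch := decide) only [hμ]
  exacts [h.dim, h.inv, h.size, h.bits, h.pow, h.samples, h.reps]

/-- The state of the search in memory. -/
structure State.Rep {n : ℕ} (blk : Fin n → ℕ) (K E : ℕ) (S : State n) (μ : Memory) : Prop where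
  consts : Consts n K E μ
  blk : ∀ i : Fin n, μ 10 i = blk i
  num : μ 11 0 = S.num
  pos : ∀ l, μ 12 l = S.pos l
  base : ∀ p ≤ S.num, μ 13 p = p * n
  wit : ∀ p < S.num, ∀ i : Fin n, μ 14 (p * n + i) = (S.wit p i).toNat
  val : μ 15 0 = S.val
  num_le : S.num ≤ K
  val_le : S.val ≤ S.num
  pos_le : ∀ l, S.pos l ≤ S.num

theorem State.Rep.congr {n : ℕ} {blk : Fin n → ℕ} {K E : ℕ} {S : State n} {μ μ' : Memory}
    (h : S.Rep blk K E μ) (hμ : ∀ b < 16, μ' b = μ b) : S.Rep blk K E μ' := by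
  constructor <;> try simp (disch := decide) only [hμ]
  exacts [h.consts.congr fun b hb => hμ b (by omega), h.blk, h.num, h.pos, h.base, h.wit, h.val,
    h.num_le, h.val_le, h.pos_le]

namespace Expr

/-- The number, plus one, of the block of the current variable. -/
def coord : Expr := .cell 12 (.cell 10 (.var 101))

def restr (e : Expr) : Expr := e.and coord.isZero.isZero

/-- A sum is nonzero iff a summand is, and j - blk i is nonzero iff blk i < j; this expresses the
disjunction of "found" and "label below j". -/
def hybrid (e j : Expr) : Expr :=
  e.and (Expr.plus coord (.minus j (.cell 10 (.var 101)))).isZero.isZero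

/-- Witnesses are stored one after another in array 14. Their offsets p * n are tabulated in array
13, because addresses cannot be formed by multiplication. -/
def wit (p : Expr) : Expr := .cell 14 (.plus (.cell 13 p) (.var 101))

def subst (p z : Expr) : Expr := .ite (dist coord (.plus p (.lit 1))).isZero z (wit p)

end Expr

namespace State.Rep

variable {n : ℕ} {blk : Fin n → ℕ} {K E : ℕ} {S : State n} {μ : Memory} {e p j : Expr}
  {u : Fin n → Bool}

theorem val_coord (h : S.Rep blk K E μ) {μ' : Memory} (hμ : ∀ b < 100, μ' b = μ b) {i : Fin n}
    (hi : μ' 101 0 = i) : Expr.coord.val μ' = S.coord blk i := by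
  simp only [Expr.coord, Expr.val, hi, hμ 10 (by decide), hμ 12 (by decide), h.blk, h.pos, State.coord]

theorem denotes_restr (h : S.Rep blk K E μ) (he : Denotes μ e u) :
    Denotes μ e.restr (_root_.restr (S.coord blk) u) :=
  he.and fun _ hμ _ hi => Expr.val_nonzero (h.val_coord hμ hi)

theorem denotes_hybrid (h : S.Rep blk K E μ) (he : Denotes μ e u) {k : ℕ}
    (hj : ∀ μ' : Memory, (∀ b < 100, μ' b = μ b) → j.val μ' = k) :
    Denotes μ (e.hybrid j) (_root_.hybrid blk (S.coord blk) u k) :=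
  he.and fun μ' hμ i hi => Expr.val_nonzero (by
    simp only [Expr.val, h.val_coord hμ hi, hj μ' hμ, hi, hμ 10 (by decide), h.blk])

theorem denotes_wit (h : S.Rep blk K E μ) {k : ℕ} (hk : k < S.num)
    (hp : ∀ μ' : Memory, (∀ b < 100, μ' b = μ b) → p.val μ' = k) :
    Denotes μ p.wit (S.wit k) := fun μ' hμ i hi => by
  simp only [Expr.wit, Expr.val, hp μ' hμ, hμ 13 (by decide), hμ 14 (by decide), hi, h.base k hk.le,
    h.wit k hk]

theorem denotes_subst (h : S.Rep blk K E μ) {k : ℕ} (hk : k < S.num)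
    (hp : ∀ μ' : Memory, (∀ b < 100, μ' b = μ b) → p.val μ' = k) (he : Denotes μ e u) :
    Denotes μ (.subst p e) (substBlock (S.coord blk) k (S.wit k) u) := by
  have hc : Denotes μ (Expr.dist .coord (.plus p (.lit 1))).isZero
      (fun i => decide (S.coord blk i = k + 1)) := fun μ' hμ i hi =>
    Expr.val_eq (h.val_coord hμ hi) (by simp only [Expr.val, hp μ' hμ])
  have := hc.ite he (h.denotes_wit hk hp)
  simp only [decide_eq_true_eq] at this
  exact this

end State.Rep

namespace Stmt

/-- Bisection for the bad string in array `30`; the label is found in `35[0]`. -/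
def search : Stmt :=
  .comp₃ (.query (.restr (.cell 30 (.var 101))) 36) (.set 35 (.lit 0))
    (.count 34 (.var 4)
      (.comp₃
        (.set 39 (.plus (.var 35) (.cell 5 (.minus (.minus (.var 4) (.lit 1)) (.var 34)))))
        (.query (.hybrid (.cell 30 (.var 101)) (.var 39)) 37)
        (.cond (.dist (.var 37) (.var 36)) .skip (.set 35 (.var 39)))))

/-- Add the block found by `search` to the state. -/
def addBlock : Stmt :=
  .comp₃ (.write 14 (.cell 13 (.var 11)) (.hybrid (.cell 30 (.var 101)) (.plus (.var 35) (.lit 1))))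
    (.assign 12 (.var 35) (.plus (.var 11) (.lit 1)))
    (.comp (.assign 13 (.plus (.var 11) (.lit 1)) (.plus (.cell 13 (.var 11)) (.var 0))) (.incr 11))

def extend : Stmt := .cond (.minus (.var 3) (.var 11)) (.comp .search .addBlock) (.halt false)

/-- The witness with number `15[0]`, with its block cleared. -/
abbrev clearedWit : Expr := .subst (.var 15) (.lit 0)

def validate : Stmt :=
  .comp₃ (.query (Expr.wit (.var 15)).restr 37) (.query clearedWit.restr 38)
    (.cond (.dist (.var 37) (.var 38))
      (.comp (.write 14 (.cell 13 (.var 15)) (Expr.wit (.var 15)).restr) (.incr 15))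
      (.comp₃ (.query (.wit (.var 15)) 38)
        (.cond (.dist (.var 38) (.var 37)) (.write 30 (.lit 0) (.wit (.var 15)))
          (.write 30 (.lit 0) clearedWit))
        .extend))

def findBad : Stmt :=
  .comp (.set 31 (.lit 0))
    (.count 33 (.var 6)
      (.cond (.var 31) .skip
        (.comp₃ (.drawExample 30)
          (.comp (.query (.cell 30 (.var 101)) 37)
            (.query (.restr (.cell 30 (.var 101))) 38))
          (.set 31 (.dist (.var 37) (.var 38))))))

def round : Stmt :=
  .cond (.var 16) .skip
    (.cond (.minus (.var 11) (.var 15)) .validate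
      (.comp .findBad (.cond (.var 31) .extend (.set 16 (.lit 1)))))

def searchAll : Stmt :=
  .comp₃ (.set 16 (.lit 0)) (.count 32 (.plus (.plus (.var 3) (.var 3)) (.lit 2)) .round)
    (.cond (.var 16) .skip (.halt false))

end Stmt

theorem Bool.toNat_ne_zero_iff (b : Bool) : b.toNat ≠ 0 ↔ b = true := by cases b <;> simp

section SearchProgram

variable {n : ℕ} {O : Oracles n} {blk : Fin n → ℕ} {K E : ℕ} {S : State n} {μ : Memory}
  {u : Fin n → Bool}

/-- One query fixes the reference value at the restriction of `u`, and each halving costs one more.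
The number of halvings is logarithmic in `K`. -/
theorem Det.search (h : S.Rep blk K E μ) (hu : μ.IsStr 30 u) :
    Det O .search μ (labelBits K * (4 * n + 13) + 4 * n + 11) (labelBits K + 1) fun μ' =>
      μ' 35 0 = S.search O.f blk K u ∧ ∀ b < 34, μ' b = μ b := by
  refine (Det.comp (T₂ := labelBits K * (4 * n + 13) + 5) (q₂ := labelBits K)
    (Det.query h.consts.dim (h.denotes_restr (.read (by decide) hu))) fun μ₁ h₁ => ?_).mono
    (by omega) (by omega) fun _ h => h
  refine (Det.comp (T₂ := labelBits K * (4 * n + 13) + 3) (q₂ := labelBits K)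
    (Det.assign _ _ _) fun μ₂ h₂ => ?_).mono (by omega) (by omega) fun _ h => h
  refine (Det.count (T := 4 * n + 10) (q := 1) (fun i μ' => μ' 34 0 = i ∧
    (∀ b < 34, μ' b = μ b) ∧ μ' 36 0 = (O.f (restr (S.coord blk) u)).toNat ∧
    μ' 35 0 = bisect (fun j => O.f (hybrid blk (S.coord blk) u j) ^^ O.f (restr (S.coord blk) u))
      (labelBits K) i) (labelBits K) ?_ ?_ ?_).mono le_rfl (by omega) ?_
  · intro μ' h' h0
    refine ⟨h0, fun b hb => ?_, ?_, ?_⟩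
    · rw [h' b (by omega), h₂, Memory.store_of_ne _ _ _ (by omega), h₁.2 b (by omega) (by omega)]
    · rw [h' _ (by decide), h₂, Memory.store_of_ne _ _ _ (by decide), h₁.1]
    · rw [h' _ (by decide), h₂, Memory.store_apply]
      simp [Expr.val, bisect]
  · rintro i μ' ⟨h1, h2, -⟩ hi
    simp [Expr.val, h2, h.consts.bits, h1]
  · rintro i μ' ⟨h1, h2, h3, h4⟩ hi
    have hr : S.Rep blk K E μ' := h.congr fun b hb => h2 b (by omega)
    refine (Det.comp (T₂ := 4 * n + 8) (q₂ := 1) (Det.assign _ _ _) fun μ₃ h₅ => ?_).mono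
      (by omega) (by omega) fun _ h => h
    simp only [Expr.val, h1, h4, hr.consts.bits, hr.consts.pow _ (show labelBits K - 1 - i < labelBits K
      by omega)] at h₅
    have hm : ∀ b, b ≠ 39 → μ₃ b = μ' b := fun b hb => by rw [h₅, Memory.store_of_ne _ _ _ hb]
    have hr₃ : S.Rep blk K E μ₃ := hr.congr fun b hb => hm b (by omega)
    have hu₃ : μ₃.IsStr 30 u := hu.congr (by rw [hm _ (by decide), h2 _ (by decide)])
    have h39 := congrFun (congrFun h₅ 39) 0
    rw [Memory.store_apply, if_pos rfl, if_pos rfl] at h39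
    refine (Det.comp (T₂ := 2) (q₂ := 0)
      (Det.query hr₃.consts.dim (hr₃.denotes_hybrid (.read (by decide) hu₃)
        (k := μ₃ 39 0) fun μ₅ h₅ => by simp only [Expr.val, h₅ 39 (by decide)]))
      fun μ₄ h₆ => ?_).mono (by omega) (by omega) fun _ h => h
    have hval : (Expr.dist (.var 37) (.var 36)).val μ₄ = _ :=
      Expr.val_xor (a := O.f (hybrid blk (S.coord blk) u (μ₃ 39 0)))
        (b := O.f (restr (S.coord blk) u)) (by simp only [Expr.val, h₆.1])
        (by simp only [Expr.val, h₆.2 36 (by decide) (by decide), hm 36 (by decide), h3])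
    have h4₄ : ∀ b < 37, μ₄ b = μ' b := fun b hb => by
      rw [h₆.2 b (by omega) (by omega), hm b (by omega)]
    refine (Det.cond (T := 1) (q := 0) (fun hv => ?_) fun hv => ?_).mono le_rfl le_rfl fun _ h => h
    · rw [hval, Bool.toNat_ne_zero_iff, h39] at hv
      refine Det.skip.mono le_rfl le_rfl ?_
      rintro μ₅ rfl
      refine ⟨by rw [h4₄ _ (by decide), h1], fun μ₆ h₇ h₈ => ⟨h₈, fun b hb => ?_, ?_, ?_⟩⟩
      · rw [h₇ b (by omega), h4₄ b (by omega), h2 b hb]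
      · rw [h₇ _ (by decide), h4₄ _ (by decide), h3]
      · rw [h₇ _ (by decide), h4₄ _ (by decide), h4, bisect, if_pos hv]
    · rw [hval, Bool.toNat_eq_zero, h39] at hv
      refine (Det.assign _ _ _).mono le_rfl le_rfl fun μ₅ h₇ => ?_
      simp only [Expr.val, h₆.2 39 (by decide) (by decide), h39] at h₇
      refine ⟨by rw [h₇, Memory.store_of_ne _ _ _ (by decide), h4₄ _ (by decide), h1],
        fun μ₆ h₈ h₉ => ⟨h₉, fun b hb => ?_, ?_, ?_⟩⟩
      · rw [h₈ b (by omega), h₇, Memory.store_of_ne _ _ _ (by omega), h4₄ b (by omega), h2 b hb]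
      · rw [h₈ _ (by decide), h₇, Memory.store_of_ne _ _ _ (by decide), h4₄ _ (by decide), h3]
      · rw [h₈ _ (by decide), h₇, Memory.store_apply, if_pos rfl, if_pos rfl, bisect, if_neg]
        rw [hv]
        decide
  · rintro μ' ⟨-, h2, -, h4⟩
    exact ⟨h4, h2⟩

theorem Det.addBlock (h : S.Rep blk K E μ) (hu : μ.IsStr 30 u) (hK : S.num < K) :
    Det O .addBlock μ (8 * n + 13) 0 fun μ' =>
      (S.add (μ 35 0) (hybrid blk (S.coord blk) u (μ 35 0 + 1))).Rep blk K E μ' ∧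
      ∀ b, 16 ≤ b → b < 100 → μ' b = μ b := by
  have hbase : μ 13 (μ 11 0) = S.num * n := by rw [h.num, h.base _ le_rfl]
  refine (Det.comp (T₂ := 5) (q₂ := 0) (Det.write (k := S.num * n) h.consts.dim (by decide)
    (by decide) (h.denotes_hybrid (k := μ 35 0 + 1) (.read (by decide) hu) fun μ' hμ => ?_)
    fun μ' hμ => ?_) fun μ₁ h₁ => ?_).mono (by omega) (by omega) fun _ h => h
  · simp only [Expr.val, hμ 35 (by decide)]
  · simp only [Expr.val, hμ 13 (by decide) (by decide), hμ 11 (by decide) (by decide), hbase]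
  obtain ⟨h1, h2, h3⟩ := h₁
  refine (Det.comp (T₂ := 3) (q₂ := 0) (Det.assign _ _ _) fun μ₂ h₂ => ?_).mono
    (by omega) (by omega) fun _ h => h
  refine (Det.comp (T₂ := 1) (q₂ := 0) (Det.assign _ _ _) fun μ₃ h₃ => ?_).mono
    (by omega) (by omega) fun _ h => h
  refine (Det.assign _ _ _).mono le_rfl le_rfl fun μ₄ h₄ => ?_
  simp only [Expr.val, h3 _ (show 35 < 100 by decide) (by decide),
    h3 _ (show 11 < 100 by decide) (by decide), h.num] at h₂
  have e₂ : ∀ b, b ≠ 12 → μ₂ b = μ₁ b := fun b hb => by rw [h₂, Memory.store_of_ne _ _ _ hb]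
  simp only [Expr.val, e₂ 11 (by decide), e₂ 13 (by decide), e₂ 0 (by decide),
    h3 _ (show 13 < 100 by decide) (by decide), h3 _ (show 0 < 100 by decide) (by decide),
    h3 _ (show 11 < 100 by decide) (by decide), h.num, h.base _ le_rfl,
    h.consts.dim] at h₃
  have e₃ : ∀ b, b ≠ 13 → μ₃ b = μ₂ b := fun b hb => by rw [h₃, Memory.store_of_ne _ _ _ hb]
  simp only [Expr.val, e₃ 11 (by decide), e₂ 11 (by decide),
    h3 _ (show 11 < 100 by decide) (by decide), h.num] at h₄
  have e₄ : ∀ b, b ≠ 11 → μ₄ b = μ₃ b := fun b hb => by rw [h₄, Memory.store_of_ne _ _ _ hb]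
  have e : ∀ b < 100, b ≠ 11 → b ≠ 12 → b ≠ 13 → b ≠ 14 → μ₄ b = μ b := fun b h0 h1 h2 h3' h4 => by
    rw [e₄ b h1, e₃ b h3', e₂ b h2, h3 b h0 h4]
  refine ⟨⟨h.consts.congr fun b hb => e b (by omega) (by omega) (by omega) (by omega) (by omega),
    fun i => ?_, ?_, fun l => ?_, fun p hp => ?_, fun p hp i => ?_, ?_, hK,
    h.val_le.trans (Nat.le_succ _), fun l => ?_⟩,
    fun b h0 h1 => e b h1 (by omega) (by omega) (by omega) (by omega)⟩
  · rw [e _ (by decide) (by decide) (by decide) (by decide) (by decide), h.blk]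
  · rw [h₄, Memory.store_apply]
    simp [State.add]
  · rw [e₄ _ (by decide), e₃ _ (by decide), h₂, Memory.store_apply, if_pos rfl,
      h3 _ (by decide) (by decide), h.pos]
    simp [State.add, Function.update_apply]
  · simp only [State.add] at hp
    rw [e₄ _ (by decide), h₃, Memory.store_apply, if_pos rfl]
    split_ifs with hpn
    · rw [hpn, Nat.succ_mul]
    · rw [e₂ _ (by decide), h3 _ (by decide) (by decide), h.base _ (by omega)]
  · simp only [State.add] at hp ⊢
    rw [e₄ _ (by decide), e₃ _ (by decide), e₂ _ (by decide)]
    by_cases hpn : p = S.num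
    · subst hpn
      rw [h1, Function.update_self]
    · rw [Function.update_of_ne hpn, h2, h.wit p (by omega)]
      left
      -- Witness number p ends before the offset S.num * n at which the new one is written.
      have : (p + 1) * n ≤ S.num * n := Nat.mul_le_mul_right _ (by omega)
      rw [Nat.succ_mul] at this
      have := i.2
      omega
  · rw [e _ (by decide) (by decide) (by decide) (by decide) (by decide), h.val, State.add]
  · simp only [State.add, Function.update_apply]
    split_ifs
    · exact le_rfl
    · exact (h.pos_le l).trans (Nat.le_succ _)

theorem Impl.extend (h : S.Rep blk K E μ) (hu : μ.IsStr 30 u) :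
    Impl O .extend μ (labelBits K * (4 * n + 13) + 12 * n + 26) (labelBits K + 1)
      (S.extend O.f blk K u) fun S' μ' =>
        S'.Rep blk K E μ' ∧ ∀ b, 16 ≤ b → b < 34 → μ' b = μ b := by
  have hv : (Expr.minus (.var 3) (.var 11)).val μ = K - S.num := by
    simp only [Expr.val, h.consts.size, h.num]
  unfold State.extend
  refine (Impl.cond (T := labelBits K * (4 * n + 13) + 12 * n + 25) (fun he => ?_)
    fun he => ?_).mono (by omega) le_rfl fun _ _ h => h
  · rw [hv] at he
    have hK : S.num < K := by omega
    rw [if_pos hK]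
    refine Impl.ret_of_det ?_
    refine (Det.comp (Det.search h hu) fun μ₁ h₁ => ?_).mono (T := 1 +
      (labelBits K * (4 * n + 13) + 4 * n + 11) + (8 * n + 13)) (q := labelBits K + 1 + 0)
      (by omega) (by omega) fun _ h => h
    have hr := h.congr fun b hb => h₁.2 b (by omega)
    refine (Det.addBlock hr (hu.congr (h₁.2 _ (by decide))) hK).mono le_rfl le_rfl ?_
    rintro μ' ⟨h2, h3⟩
    rw [h₁.1] at h2
    exact ⟨h2, fun b hb hb' => by rw [h3 b hb (by omega), h₁.2 b (by omega)]⟩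
  · rw [hv] at he
    have hK : ¬ S.num < K := by omega
    rw [if_neg hK]
    exact Impl.reject.mono (by omega) (by omega) fun _ _ h => h

/-- A sample costs three queries: the example itself and the values of `f` at it and at its
restriction. -/
theorem Impl.findBad (h : S.Rep blk K E μ) :
    Impl O .findBad μ (searchSamples K E * (8 * n + 19) + 5) (searchSamples K E * 3)
      (State.findBad O.f O.D (S.coord blk) (searchSamples K E)) fun o μ' =>
        (∀ b < 30, μ' b = μ b) ∧ μ' 32 = μ 32 ∧ (o = none → μ' 31 0 = 0) ∧
        ∀ u, o = some u → μ' 31 0 ≠ 0 ∧ μ'.IsStr 30 u := by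
  refine (Impl.det_comp (T₂ := searchSamples K E * (8 * n + 19) + 3) (q₂ := searchSamples K E * 3)
    (Det.assign _ _ _) fun μ₁ h₁ => ?_).mono (by omega) (by omega) fun _ _ h => h
  refine (Impl.count (T := 8 * n + 16) (q := 3) (fun i o μ' => μ' 33 0 = i ∧
    (∀ b < 30, μ' b = μ b) ∧ μ' 32 = μ 32 ∧ (o = none → μ' 31 0 = 0) ∧
        ∀ u, o = some u → μ' 31 0 ≠ 0 ∧ μ'.IsStr 30 u) (searchSamples K E) ?_ ?_ ?_).mono
        le_rfl le_rfl ?_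
  · intro μ' h' h0
    refine ⟨h0, fun b hb => ?_, ?_, fun _ => ?_, fun u hu => by simp at hu⟩
    · rw [h' b (by omega), h₁, Memory.store_of_ne _ _ _ (by omega)]
    · rw [h' _ (by decide), h₁, Memory.store_of_ne _ _ _ (by decide)]
    · rw [h' _ (by decide), h₁, Memory.store_apply]
      simp [Expr.val]
  · rintro i o μ' ⟨h1, h2, -⟩ hi
    simp [Expr.val, h2, h.consts.samples, h1]
  · rintro i o μ' ⟨h1, h2, h3, h4, h5⟩ hi
    refine (Impl.cond (T := 8 * n + 15) (q := 3) (fun he => ?_) fun he => ?_).mono (by omega)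
      le_rfl fun _ _ h => h
    · simp only [Expr.val] at he
      rcases o with _ | u
      · exact absurd (h4 rfl) he
      · refine Impl.ret_of_det (Det.skip.mono (by omega) (by omega) ?_)
        rintro μ₂ rfl
        refine ⟨h1, fun μ₃ h₃ h₄ => ⟨h₄, fun b hb => ?_, ?_, fun ho => by simp at ho, fun u' hu => ?_⟩⟩
        · rw [h₃ b (by omega), h2 b hb]
        · rw [h₃ _ (by decide), h3]
        · rw [h₃ _ (by decide)]
          exact ⟨(h5 u' hu).1, (h5 u' hu).2.congr (h₃ _ (by decide))⟩
    · simp only [Expr.val] at he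
      rcases o with _ | u
      swap
      · exact absurd he (h5 u rfl).1
      refine (Impl.comp (T₂ := 8 * n + 13) (q₂ := 2) (Impl.drawExample _) fun u μ₂ h₂ =>
        Impl.ret_of_det ?_).mono (by omega) (by omega) fun _ _ h => h
      have hu : μ₂.IsStr 30 u := by
        rw [h₂]
        exact μ'.isStr_storeString 30 u
      have e₂ : ∀ b, b ≠ 30 → μ₂ b = μ' b := fun b hb => by
        rw [h₂, Memory.storeString_of_ne _ _ hb]
      have hr : S.Rep blk K E μ₂ := h.congr fun b hb => by rw [e₂ b (by omega), h2 b (by omega)]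
      refine (Det.comp (T₁ := 8 * n + 11) (T₂ := 1) (q₁ := 2) (q₂ := 0)
        (R := fun μ₃ => (∀ b < 34, μ₃ b = μ₂ b) ∧ μ₃ 37 0 = (O.f u).toNat ∧
        μ₃ 38 0 = (O.f (restr (S.coord blk) u)).toNat) ?_ fun μ₃ h₃ => ?_).mono
        (by omega) (by omega) fun _ h => h
      · refine (Det.comp (T₂ := 4 * n + 5) (q₂ := 1)
          (Det.query hr.consts.dim (.read (by decide) hu)) fun μ₃ h₃ => ?_).mono
          (by omega) (by omega) fun _ h => h
        have hr₃ : S.Rep blk K E μ₃ := hr.congr fun b hb => by rw [h₃.2 b (by omega) (by omega)]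
        refine (Det.query hr₃.consts.dim (hr₃.denotes_restr (.read (by decide)
          (hu.congr (h₃.2 _ (by decide) (by decide)))))).mono le_rfl le_rfl ?_
        rintro μ₄ ⟨h₄, h₅⟩
        exact ⟨fun b hb => by rw [h₅ b (by omega) (by omega), h₃.2 b (by omega) (by omega)],
          by rw [h₅ _ (by decide) (by decide), h₃.1], h₄⟩
      · obtain ⟨h6, h7, h8⟩ := h₃
        refine (Det.assign _ _ _).mono le_rfl le_rfl fun μ₄ h₄ => ?_
        have hval : (Expr.dist (.var 37) (.var 38)).val μ₃ = _ := Expr.val_xor h7 h8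
        rw [hval] at h₄
        have e₄ : ∀ b < 34, b ≠ 31 → b ≠ 30 → μ₄ b = μ' b := fun b hb hb1 hb2 => by
          rw [h₄, Memory.store_of_ne _ _ _ hb1, h6 b hb, e₂ b hb2]
        refine ⟨by rw [e₄ _ (by decide) (by decide) (by decide), h1], fun μ₅ h₅ h₆ => ⟨h₆,
          fun b hb => ?_, ?_, ?_⟩⟩
        · rw [h₅ b (by omega), e₄ b (by omega) (by omega) (by omega), h2 b hb]
        · rw [h₅ _ (by decide), e₄ _ (by decide) (by decide) (by decide), h3]
        · have h31 : μ₅ 31 0 = (O.f u ^^ O.f (restr (S.coord blk) u)).toNat := by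
            rw [h₅ _ (by decide), h₄, Memory.store_apply]
            simp [Expr.val]
          have h30 : μ₅.IsStr 30 u := hu.congr (by
            rw [h₅ _ (by decide), h₄, Memory.store_of_ne _ _ _ (by decide), h6 _ (by decide)])
          rw [h31]
          cases O.f u ^^ O.f (restr (S.coord blk) u)
          · simp
          · simp [h30]
  · rintro o μ' ⟨-, h2⟩
    exact h2

theorem Impl.validate (h : S.Rep blk K E μ) (hval : S.val < S.num) :
    Impl O .validate μ (labelBits K * (4 * n + 13) + 32 * n + 60) (labelBits K + 4)
      (S.validate O.f blk K) fun S' μ' =>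
        S'.Rep blk K E μ' ∧ ∀ b, 16 ≤ b → b < 34 → b ≠ 30 → μ' b = μ b := by
  have hv15 : ∀ μ₁ : Memory, (∀ b < 16, μ₁ b = μ b) → ∀ μ' : Memory, (∀ b < 100, μ' b = μ₁ b) →
      (Expr.var 15).val μ' = S.val := fun μ₁ h₁ μ' hμ => by
    simp only [Expr.val, hμ 15 (by decide), h₁ 15 (by decide), h.val]
  have hw : ∀ μ₁ : Memory, (∀ b < 16, μ₁ b = μ b) →
      Denotes μ₁ (.wit (.var 15)) (S.wit S.val) := fun μ₁ h₁ =>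
    (h.congr h₁).denotes_wit hval (hv15 μ₁ h₁)
  have hc : ∀ μ₁ : Memory, (∀ b < 16, μ₁ b = μ b) → Denotes μ₁ Stmt.clearedWit
      (substBlock (S.coord blk) S.val (S.wit S.val) fun _ => false) := fun μ₁ h₁ =>
    (h.congr h₁).denotes_subst hval (hv15 μ₁ h₁) .zero
  refine (Impl.det_comp (T₂ := labelBits K * (4 * n + 13) + 28 * n + 54) (q₂ := labelBits K + 3)
    (Det.query h.consts.dim (h.denotes_restr (hw μ fun _ _ => rfl))) fun μ₁ h₁ => ?_).mono
    (by omega) (by omega) fun _ _ h => h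
  have e₁ : ∀ b < 36, μ₁ b = μ b := fun b hb => h₁.2 b (by omega) (by omega)
  have hr₁ : S.Rep blk K E μ₁ := h.congr fun b hb => e₁ b (by omega)
  refine (Impl.det_comp (T₂ := labelBits K * (4 * n + 13) + 24 * n + 48) (q₂ := labelBits K + 2)
    (Det.query hr₁.consts.dim (hr₁.denotes_restr (hc μ₁ fun b hb => e₁ b (by omega))))
    fun μ₂ h₂ => ?_).mono (by omega) (by omega) fun _ _ h => h
  have e₂ : ∀ b < 36, μ₂ b = μ b := fun b hb => by rw [h₂.2 b (by omega) (by omega), e₁ b hb]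
  have hr₂ : S.Rep blk K E μ₂ := h.congr fun b hb => e₂ b (by omega)
  have h37 : μ₂ 37 0 = (O.f (restr (S.coord blk) (S.wit S.val))).toNat := by rw [h₂.2 _ (by decide) (by decide), h₁.1]
  have hv : (Expr.dist (.var 37) (.var 38)).val μ₂ = _ := Expr.val_xor h37 h₂.1
  unfold State.validate
  refine (Impl.cond (T := labelBits K * (4 * n + 13) + 24 * n + 47) (q := labelBits K + 2)
    (fun he => ?_) fun he => ?_).mono (by omega) le_rfl fun _ _ h => h
  · rw [hv, Bool.toNat_ne_zero_iff] at he
    simp only [he, if_true]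
    refine Impl.ret_of_det ?_
    refine (Det.comp (T₂ := 1) (q₂ := 0) (Det.write (k := S.val * n) hr₂.consts.dim (by decide)
      (by decide) (hr₂.denotes_restr (hw μ₂ fun b hb => e₂ b (by omega)))
      fun μ' hμ => ?_) fun μ₃ h₃ => ?_).mono (by omega) (by omega) fun _ h => h
    · simp only [Expr.val, hμ 13 (by decide) (by decide), hμ 15 (by decide) (by decide),
        hr₂.val, hr₂.base _ hval.le]
    obtain ⟨h1, h2, h3⟩ := h₃
    refine (Det.assign _ _ _).mono le_rfl le_rfl fun μ₄ h₄ => ?_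
    have e₄ : ∀ b < 36, b ≠ 14 → b ≠ 15 → μ₄ b = μ b := fun b hb hb1 hb2 => by
      rw [h₄, Memory.store_of_ne _ _ _ hb2, h3 b (by omega) hb1, e₂ b hb]
    refine ⟨⟨h.consts.congr fun b hb => e₄ b (by omega) (by omega) (by omega), fun i => ?_, ?_,
      fun l => ?_, fun p hp => ?_, fun p hp i => ?_, ?_, h.num_le, hval, h.pos_le⟩,
      fun b hb hb' hne => e₄ b (by omega) (by omega) (by omega)⟩
    · rw [e₄ _ (by decide) (by decide) (by decide), h.blk]
    · rw [e₄ _ (by decide) (by decide) (by decide), h.num]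
    · rw [e₄ _ (by decide) (by decide) (by decide), h.pos]
    · rw [e₄ _ (by decide) (by decide) (by decide), h.base _ hp]
    · rw [h₄, Memory.store_of_ne _ _ _ (by decide)]
      by_cases hpv : p = S.val
      · subst hpv
        rw [h1]
        simp only [Function.update_self]
      · simp only [Function.update_of_ne hpv]
        rw [h2, e₂ _ (by decide), h.wit p hp]
        have := i.2
        rcases Nat.lt_or_gt_of_ne hpv with hlt | hlt
        · have : (p + 1) * n ≤ S.val * n := Nat.mul_le_mul_right _ (by omega)
          rw [Nat.succ_mul] at this
          omega
        · have : (S.val + 1) * n ≤ p * n := Nat.mul_le_mul_right _ (by omega)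
          rw [Nat.succ_mul] at this
          omega
    · rw [h₄, Memory.store_apply]
      simp [Expr.val, h3 15 (by decide) (by decide), e₂ 15 (by decide), h.val]
  · rw [hv, Bool.toNat_eq_zero] at he
    simp only [he, Bool.false_eq_true, if_false]
    refine (Impl.det_comp (T₂ := labelBits K * (4 * n + 13) + 20 * n + 37) (q₂ := labelBits K + 1)
      (Det.query hr₂.consts.dim (hw μ₂ fun b hb => e₂ b (by omega))) fun μ₃ h₃ => ?_).mono
      (by omega) (by omega) fun _ _ h => h
    have e₃ : ∀ b < 36, μ₃ b = μ b := fun b hb => by rw [h₃.2 b (by omega) (by omega), e₂ b hb]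
    have hr₃ : S.Rep blk K E μ₃ := h.congr fun b hb => e₃ b (by omega)
    have hv₃ : (Expr.dist (.var 38) (.var 37)).val μ₃ = _ :=
      Expr.val_xor h₃.1 (by simpa only [Expr.val, h₃.2 37 (by decide) (by decide)] using h37)
    have off : ∀ μ' : Memory, (∀ b < 100, b ≠ 30 → μ' b = μ₃ b) → (Expr.lit 0).val μ' = 0 :=
      fun _ _ => rfl
    refine (Impl.det_comp (T₁ := 8 * n + 8)
      (T₂ := labelBits K * (4 * n + 13) + 12 * n + 26) (q₁ := 0) (q₂ := labelBits K + 1)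
      (R := fun μ₄ => (∀ b < 36, b ≠ 30 → μ₄ b = μ b) ∧ μ₄.IsStr 30
        (if O.f (S.wit S.val) ^^ O.f (restr (S.coord blk) (S.wit S.val)) then S.wit S.val else
          substBlock (S.coord blk) S.val (S.wit S.val) fun _ => false))
      ((Det.cond (T := 8 * n + 7) (q := 0) (fun hb => ?_) fun hb => ?_).mono (by omega) le_rfl
        fun _ h => h) fun μ₄ h₄ => ?_).mono (by omega) (by omega) fun _ _ h => h
    · rw [hv₃, Bool.toNat_ne_zero_iff] at hb
      refine (Det.write hr₃.consts.dim (by decide) (by decide)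
        (hw μ₃ fun b hb => e₃ b (by omega)) off).mono le_rfl le_rfl ?_
      rintro μ₄ ⟨h1, -, h3⟩
      refine ⟨fun b hb hne => by rw [h3 b (by omega) hne, e₃ b hb], ?_⟩
      rw [if_pos hb]
      intro i
      rw [← h1 i, Nat.zero_add]
    · rw [hv₃, Bool.toNat_eq_zero] at hb
      refine (Det.write hr₃.consts.dim (by decide) (by decide)
        (hc μ₃ fun b hb => e₃ b (by omega)) off).mono le_rfl le_rfl ?_
      rintro μ₄ ⟨h1, -, h3⟩
      refine ⟨fun b hb hne => by rw [h3 b (by omega) hne, e₃ b hb], ?_⟩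
      simp only [hb, Bool.false_eq_true, if_false]
      intro i
      rw [← h1 i, Nat.zero_add]
    · refine (Impl.extend (h.congr fun b hb => h₄.1 b (by omega) (by omega)) h₄.2).mono le_rfl
        le_rfl ?_
      rintro S' μ₅ ⟨h5, h6⟩
      exact ⟨h5, fun b hb hb' hne => by rw [h6 b hb hb', h₄.1 b (by omega) hne]⟩

/-- Time bound for a round of the search. -/
def roundTime (n K E : ℕ) : ℕ :=
  searchSamples K E * (8 * n + 19) + labelBits K * (4 * n + 13) + 32 * n + 70

theorem Impl.round {done : Bool} (h : S.Rep blk K E μ) (hd : μ 16 0 = done.toNat) :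
    Impl O .round μ (roundTime n K E) (searchSamples K E * 3 + labelBits K + 4)
      (State.round O.f O.D blk K E (S, done)) fun s μ' =>
        s.1.Rep blk K E μ' ∧ μ' 16 0 = s.2.toNat ∧ μ' 32 = μ 32 := by
  refine (Impl.cond (T := searchSamples K E * (8 * n + 19) + labelBits K * (4 * n + 13) + 32 * n +
    68) (fun he => ?_) fun he => ?_).mono (by unfold roundTime; omega) le_rfl fun _ _ h => h
  · cases done
    · exact absurd hd he
    · refine Impl.ret_of_det (Det.skip.mono (by omega) (by omega) ?_)
      rintro μ₁ rfl
      exact ⟨h, hd, rfl⟩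
  · cases done
    swap
    · simp only [Expr.val, hd] at he
      simp at he
    have hv : (Expr.minus (.var 11) (.var 15)).val μ = S.num - S.val := by
      simp only [Expr.val, h.num, h.val]
    simp only [State.round]
    refine (Impl.cond (T := searchSamples K E * (8 * n + 19) + labelBits K * (4 * n + 13) +
      32 * n + 60) (fun he => ?_) fun he => ?_).mono (by omega) le_rfl fun _ _ h => h
    · rw [hv] at he
      rw [if_pos (by omega)]
      -- Attaching the flag `false` corresponds to no instruction, as cell 0 of array 16 already
      -- holds 0. The pairing is therefore absorbed into the weights.
      intro κ r T' q' w hc Q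
      have := ((Impl.validate h (by omega)).mono (T' := searchSamples K E * (8 * n + 19) +
        labelBits K * (4 * n + 13) + 32 * n + 60) (q' := searchSamples K E * 3 + labelBits K + 4)
        (by omega) (by omega) fun _ _ h => h) κ r T' q' (fun S' => w (S', false))
        (fun S' μ' h' => hc _ _ ⟨h'.1, ?_, ?_⟩) Q
      · rw [Run.cost_andThen]
        simpa only [Run.cost_ret] using this
      · rw [h'.2 _ (by decide) (by decide) (by decide), hd]
      · rw [h'.2 _ (by decide) (by decide) (by decide)]
    · rw [hv] at he
      rw [if_neg (by have := h.val_le; omega)]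
      refine (Impl.comp (T₂ := labelBits K * (4 * n + 13) + 12 * n + 27) (q₂ := labelBits K + 1)
        (Impl.findBad h) fun o μ₁ h₁ => ?_).mono (by omega) (by omega) fun _ _ h => h
      obtain ⟨h1, h2, h3, h4⟩ := h₁
      have hr : S.Rep blk K E μ₁ := h.congr fun b hb => h1 b (by omega)
      refine (Impl.cond (T := labelBits K * (4 * n + 13) + 12 * n + 26) (fun he => ?_)
        fun he => ?_).mono (by omega) le_rfl fun _ _ h => h
      · rcases o with _ | u
        · exact absurd (h3 rfl) he
        · intro κ r T' q' w hc Q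
          have := (Impl.extend hr (h4 u rfl).2) κ r T' q' (fun S' => w (S', false))
            (fun S' μ' h' => hc _ _ ⟨h'.1, ?_, ?_⟩) Q
          · rw [Run.cost_andThen]
            simpa only [Run.cost_ret] using this
          · rw [h'.2 _ (by decide) (by decide), h1 _ (by decide), hd]
          · rw [h'.2 _ (by decide) (by decide), h2]
      · rcases o with _ | u
        swap
        · exact absurd he (h4 u rfl).1
        refine Impl.ret_of_det ((Det.assign _ _ _).mono (by omega) (by omega) fun μ₂ h₂ => ?_)
        refine ⟨hr.congr fun b hb => ?_, ?_, ?_⟩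
        · rw [h₂, Memory.store_of_ne _ _ _ (by omega)]
        · rw [h₂, Memory.store_apply]
          simp [Expr.val]
        · rw [h₂, Memory.store_of_ne _ _ _ (by decide), h2]

theorem Impl.searchAll (h : (State.init n).Rep blk K E μ) :
    Impl O .searchAll μ ((K + K + 2) * (roundTime n K E + 3) + 10)
      ((K + K + 2) * (searchSamples K E * 3 + labelBits K + 4))
      (State.searchAll O.f O.D blk K E) fun S μ' => S.Rep blk K E μ' := by
  refine (Impl.det_comp (T₂ := (K + K + 2) * (roundTime n K E + 3) + 7)
    (q₂ := (K + K + 2) * (searchSamples K E * 3 + labelBits K + 4))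
    (Det.assign _ _ _) fun μ₁ h₁ => ?_).mono (by omega) (by omega) fun _ _ h => h
  refine (Impl.comp (T₁ := (K + K + 2) * (roundTime n K E + 3) + 3) (T₂ := 2)
    (q₁ := (K + K + 2) * (searchSamples K E * 3 + labelBits K + 4)) (q₂ := 0)
    (Impl.count (fun i s μ' => μ' 32 0 = i ∧ s.1.Rep blk K E μ' ∧ μ' 16 0 = s.2.toNat)
    (K + K + 2) ?_ ?_ ?_) fun s μ₂ h₂ => ?_).mono (by omega) (by omega) fun _ _ h => h
  · intro μ' h' h0
    refine ⟨h0, h.congr fun b hb => ?_, ?_⟩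
    · rw [h' b (by omega), h₁, Memory.store_of_ne _ _ _ (by omega)]
    · rw [h' _ (by decide), h₁, Memory.store_apply]
      simp [Expr.val]
  · rintro i s μ' ⟨h1, h2, -⟩ hi
    simp [Expr.val, h2.consts.size, h1]
  · rintro i ⟨S, done⟩ μ' ⟨h1, h2, h3⟩ hi
    refine (Impl.round h2 h3).mono le_rfl le_rfl ?_
    rintro s μ₃ ⟨h4, h5, h6⟩
    refine ⟨by rw [h6, h1], fun μ₄ h₇ h₈ => ⟨h₈, h4.congr fun b hb => h₇ b (by omega), ?_⟩⟩
    rw [h₇ _ (by decide), h5]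
  · obtain ⟨-, h2, h3⟩ := h₂
    refine (Impl.cond (T := 1) (q := 0) (fun he => ?_) fun he => ?_).mono (by omega) le_rfl
      fun _ _ h => h
    · simp only [Expr.val, h3, Bool.toNat_ne_zero_iff] at he
      rw [if_pos he]
      refine Impl.ret_of_det (Det.skip.mono (by omega) (by omega) ?_)
      rintro μ₄ rfl
      exact h2
    · simp only [Expr.val, h3, Bool.toNat_eq_zero] at he
      rw [he]
      exact Impl.reject

end SearchProgram

/-! ## Reading the relevant variable of a block -/

section Tests

variable {n : ℕ}

/-- `f` as a function of the coordinates in block number `p`; the others are as in `w`. -/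
def blockFn (f : BoolFn n) (c : Fin n → ℕ) (p : ℕ) (w : Fin n → Bool) : BoolFn n :=
  fun z => f (substBlock c p w z)

/-- The change of `g` when `x` is added to `z`. -/
def shiftDiff (g : BoolFn n) (z x : Fin n → Bool) : Bool :=
  g (fun i => z i ^^ x i) ^^ g z

/-- Violation of one of the identities of the functions `z ↦ z_τ` and `z ↦ ¬ z_τ`. -/
def violation (g : BoolFn n) (x y z : Fin n → Bool) : Bool :=
  (shiftDiff g z x ^^ (g x ^^ g fun _ => false)) ||
  ((shiftDiff g z (fun i => x i && y i) ^^ (shiftDiff g z x && shiftDiff g z y)) ||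
    !shiftDiff g z fun _ => true)

noncomputable def dictatorRound (g : BoolFn n) : Run Unit :=
  (Run.uniform n).andThen fun x => (Run.uniform n).andThen fun y =>
    (Run.uniform n).andThen fun z => if violation g x y z then Run.fail else Run.ret ()

/-- Here 384 = 48 * 8: against a violation probability of at least 1/48, every 48 rounds halve the
chance of passing. -/
noncomputable def dictatorTest (f : BoolFn n) (c : Fin n → ℕ) (S : State n) : Run Unit :=
  Run.iter (fun p _ => Run.iter (fun _ _ => dictatorRound (blockFn f c p (S.wit p))) 0 384 ())
    0 S.num ()

/-- For g(z) = z_τ + b the result is x_τ, whatever `z` and `b` are. The random shift makes the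
reading reliable at every `x` even if `g` is only close to such a function. -/
noncomputable def readOnce (g : BoolFn n) (x : Fin n → Bool) : Run Bool :=
  (Run.uniform n).andThen fun z => Run.ret (shiftDiff g z x)

/-- Any disagreement among the readings leads to rejection, so a wrong bit is returned only if all r
+ 1 readings are wrong. -/
noncomputable def readBit (g : BoolFn n) (r : ℕ) (x : Fin n → Bool) : Run Bool :=
  (readOnce g x).andThen fun v =>
    (Run.iter (fun _ _ => (readOnce g x).andThen fun v' => if v' ^^ v then Run.fail else Run.ret ())
      0 r ()).andThen fun _ => Run.ret v

/-- The values at `x` of the relevant variables of the blocks that have been found. -/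
noncomputable def readAll (f : BoolFn n) (c : Fin n → ℕ) (S : State n) (r : ℕ)
    (x : Fin n → Bool) : Run (Fin n → Bool) :=
  Run.iter (fun p y => (readBit (blockFn f c p (S.wit p)) r x).andThen fun v =>
    Run.ret fun i => if (i : ℕ) = p then v else y i) 0 S.num fun _ => false

/-- The string that is constant on blocks, with value `y p` on block number `p`, and vanishes
outside of the found blocks. -/
def expand (c : Fin n → ℕ) (y : Fin n → Bool) : Fin n → Bool :=
  fun i => (if h : c i - 1 < n then y ⟨c i - 1, h⟩ else false) && decide (c i ≠ 0)

/-- Test that `f` restricted to the found blocks depends on the relevant variables only. -/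
noncomputable def consistencyRound (f : BoolFn n) (D : PMF (Fin n → Bool)) (c : Fin n → ℕ)
    (S : State n) (r : ℕ) : Run Unit :=
  (Run.lift D).andThen fun x => (readAll f c S r x).andThen fun y =>
    if f (restr c x) ^^ f (expand c y) then Run.fail else Run.ret ()

/-- A labelled example: a random string, labelled by `f` on its expansion. -/
noncomputable def uniformExample (f : BoolFn n) (c : Fin n → ℕ) : Run ((Fin n → Bool) × Bool) :=
  (Run.uniform n).andThen fun y => Run.ret (y, f (expand c y))

/-- A labelled example: the relevant variables of an example, labelled by the restriction of `f`. -/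
noncomputable def readExample (f : BoolFn n) (D : PMF (Fin n → Bool)) (c : Fin n → ℕ)
    (S : State n) (r : ℕ) : Run ((Fin n → Bool) × Bool) :=
  (Run.lift D).andThen fun x => (readAll f c S r x).andThen fun y => Run.ret (y, f (restr c x))

/-- The set of the first `q` variables. -/
def firstVars (n q : ℕ) : Fin n → Bool := fun i => decide ((i : ℕ) < q)

def candidates (L : Finset (Fin n) → List (BoolFn n)) (q : ℕ) : List (BoolFn n) :=
  L (Finset.univ.filter fun i => firstVars n q i = true)

/-- The number of examples on which the candidates are tested. -/
def learnSamples (N E : ℕ) : ℕ := (N.size + 4) * (E + E + E + E + (E + E + E + E))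

noncomputable def eliminationRound (L : Finset (Fin n) → List (BoolFn n)) (q : ℕ)
    (src : Run ((Fin n → Bool) × Bool)) (dead : ℕ → Bool) : Run (ℕ → Bool) :=
  src.andThen fun s => Run.ret fun j =>
    dead j || decide (classAnswer L (firstVars n q) j s.1 ≠ s.2.toNat)

/-- Test that some candidate agrees with all labelled examples. -/
noncomputable def elimination (L : Finset (Fin n) → List (BoolFn n)) (q E : ℕ)
    (src : Run ((Fin n → Bool) × Bool)) : Run Unit :=
  (Run.iter (fun _ => eliminationRound L q src) 0
    (learnSamples (candidates L q).length E) fun _ => false).andThen fun dead =>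
    if ∃ j < (candidates L q).length, dead j = false then Run.ret () else Run.fail

/-- The random partition into blocks. -/
noncomputable def partition (n b : ℕ) : Run (Fin n → ℕ) :=
  Run.iter (fun _ blk => (Run.uniform n).andThen fun z =>
    Run.ret fun i => blk i + blk i + (z i).toNat) 0 b fun _ => 0

/-- Reading variables is confined to the consistency rounds, whose number does not depend on the
candidates. Each example of the elimination costs one query, and thus k and log N contribute
additively. -/
noncomputable def uniformTester (f : BoolFn n) (D : PMF (Fin n → Bool))
    (L : Finset (Fin n) → List (BoolFn n)) (K E : ℕ) : Run Unit :=
  (partition n (labelBits K)).andThen fun blk =>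
    (State.searchAll f D blk K E).andThen fun S =>
      (dictatorTest f (S.coord blk) S).andThen fun _ =>
        (Run.iter (fun _ _ => consistencyRound f D (S.coord blk) S (readReps K E)) 0
          (32 * E) ()).andThen fun _ =>
            elimination L S.num E (uniformExample f (S.coord blk))

/-- Expanded uniform strings say nothing about an unknown distribution, so the relevant variables of
each example have to be read. -/
noncomputable def distributionFreeTester (f : BoolFn n) (D : PMF (Fin n → Bool))
    (L : Finset (Fin n) → List (BoolFn n)) (K E : ℕ) : Run Unit :=
  (partition n (labelBits K)).andThen fun blk =>
    (State.searchAll f D blk K E).andThen fun S =>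
      (dictatorTest f (S.coord blk) S).andThen fun _ =>
        elimination L S.num E (readExample f D (S.coord blk) S (readReps K E))

end Tests

/-! ## The tests as programs -/

namespace Stmt

/-- `out[0] := g(z)` for the string `z` denoted by `e`, where `g` is the function on block number
`50[0]` -/
abbrev queryBlock (e : Expr) (out : ℕ) : Stmt := .query (.subst (.var 50) e) out

/-- Bit `101[0]` of the string in array `a`. -/
abbrev bit (a : ℕ) : Expr := .cell a (.var 101)

def dictatorQueries : Stmt :=
  .comp₃ (.queryBlock (bit 42) 43) (.queryBlock ((bit 42).dist (bit 40)) 44)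
    (.comp₃ (.queryBlock ((bit 42).dist (bit 41)) 45)
      (.queryBlock ((bit 42).dist ((bit 40).and (bit 41))) 46)
      (.comp₃ (.queryBlock ((bit 42).dist (.lit 1)) 47) (.queryBlock (bit 40) 48)
        (.queryBlock (.lit 0) 49)))

def violation : Expr :=
  .plus (((Expr.var 44).dist (.var 43)).dist ((Expr.var 48).dist (.var 49)))
    (.plus (((Expr.var 46).dist (.var 43)).dist
      (((Expr.var 44).dist (.var 43)).and ((Expr.var 45).dist (.var 43))))
      ((Expr.var 47).dist (.var 43)).isZero)

def dictatorRound : Stmt :=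
  .comp₃ (.randomString 40) (.randomString 41)
    (.comp₃ (.randomString 42) .dictatorQueries (.cond violation (.halt false) .skip))

def dictatorTest : Stmt := .count 50 (.var 11) (.count 51 (.lit 384) .dictatorRound)

def readOnce : Stmt :=
  .comp₃ (.randomString 42) (.queryBlock ((bit 42).dist (bit 53)) 43)
    (.comp (.queryBlock (bit 42) 44) (.set 45 ((Expr.var 43).dist (.var 44))))

def readBit : Stmt :=
  .comp₃ .readOnce (.set 46 (.var 45))
    (.count 51 (.var 7) (.comp .readOnce
      (.cond ((Expr.var 45).dist (.var 46)) (.halt false) .skip)))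

def readAll : Stmt :=
  .comp (.write 20 (.lit 0) (.lit 0))
    (.count 50 (.var 11) (.comp .readBit (.assign 20 (.var 50) (.var 46))))

def expand : Expr := Expr.and (.cell 20 (.minus .coord (.lit 1))) Expr.coord.isZero.isZero

def readExample : Stmt :=
  .comp₃ (.drawExample 53) .readAll (.query (bit 53).restr 21)

def consistencyRound : Stmt :=
  .comp₃ .readExample (.query expand 22) (.cond ((Expr.var 21).dist (.var 22)) (.halt false) .skip)

def uniformExample : Stmt := .comp (.randomString 20) (.query expand 21)

/-- Store the first variables, the number of candidates and the number of examples. -/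
def prepare : Stmt :=
  .comp₃ (.write 19 (.lit 0) (Expr.minus (.var 11) (.var 101)).isZero.isZero)
    (.comp₃ (.set 18 (.lit 0)) (.classValue 19 (.var 18) 20 22)
      (.loop (.minus (.lit 2) (.var 22))
        (.comp₃ (.assign 24 (.var 18) (.lit 0)) (.incr 18) (.classValue 19 (.var 18) 20 22))))
    (.comp (.size 23 (.var 18))
      (.mul 17 (.plus (.var 23) (.lit 4))
        (.plus (.plus (.plus (.plus (.var 2) (.var 2)) (.var 2)) (.var 2))
          (.plus (.plus (.plus (.var 2) (.var 2)) (.var 2)) (.var 2)))))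

def eliminationRound (src : Stmt) : Stmt :=
  .comp src (.count 55 (.var 18) (.comp (.classValue 19 (.var 55) 20 22)
    (.assign 24 (.var 55) (.plus (.cell 24 (.var 55)) ((Expr.var 22).dist (.var 21))))))

def elimination (src : Stmt) : Stmt :=
  .comp₃ .prepare (.count 54 (.var 17) (.eliminationRound src))
    (.comp₃ (.set 26 (.lit 0))
      (.count 55 (.var 18) (.set 26 (.plus (.var 26) (Expr.cell 24 (.var 55)).isZero)))
      (.cond (.var 26) .skip (.halt false)))

/-- Compute the constants. -/
def constants : Stmt :=
  .comp₃ (.set 3 (.minus (.var 1) (.minus (.var 1) (.var 0)))) (.size 8 (.var 3))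
    (.comp₃ (.set 4 (.plus (.plus (.var 8) (.var 8)) (.lit 2)))
      (.comp (.assign 5 (.lit 0) (.lit 1))
        (.count 34 (.var 4) (.assign 5 (.plus (.var 34) (.lit 1))
          (.plus (.cell 5 (.var 34)) (.cell 5 (.var 34))))))
      (.comp₃ (.mul 6 (.plus (.var 8) (.lit 8))
          (.plus (.plus (.plus (.var 2) (.var 2)) (.var 2)) (.var 2)))
        (.size 40 (.var 2)) (.set 7 (.plus (.plus (.var 8) (.var 40)) (.lit 8)))))

def partition : Stmt :=
  .count 50 (.var 4) (.comp (.randomString 42)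
    (.count 101 (.var 0)
      (.assign 10 (.var 101) (.plus (.plus (bit 10) (bit 10)) (bit 42)))))

def consistency : Stmt := .comp (.mul 25 (.lit 32) (.var 2)) (.count 54 (.var 25) .consistencyRound)

/-- Accept unless `s` rejects. -/
def accept (s : Stmt) : Stmt := .comp s (.halt true)

def uniformTester : Stmt :=
  .comp₃ .constants .partition (.comp₃ .searchAll .dictatorTest
    (.comp .consistency (.elimination .uniformExample)))

def distributionFreeTester : Stmt :=
  .comp₃ .constants .partition (.comp₃ .searchAll .dictatorTest (.elimination .readExample))

end Stmt

section TestPrograms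

variable {n : ℕ} {O : Oracles n} {blk : Fin n → ℕ} {K E : ℕ} {S : State n} {μ : Memory}
  {x y z u : Fin n → Bool} {p : ℕ}

theorem Det.queryBlock {e : Expr} {out : ℕ} (h : S.Rep blk K E μ) (hp : p < S.num)
    (h50 : μ 50 0 = p) (he : Denotes μ e u) :
    Det O (Stmt.queryBlock e out) μ (4 * n + 5) 1 fun μ' =>
      μ' out 0 = (blockFn O.f (S.coord blk) p (S.wit p) u).toNat ∧
      ∀ b < 100, b ≠ out → μ' b = μ b :=
  Det.query h.consts.dim (h.denotes_subst hp (fun μ' hμ => by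
    simp only [Expr.val, hμ 50 (by decide), h50]) he)

theorem Det.dictatorQueries (h : S.Rep blk K E μ) (hp : p < S.num) (h50 : μ 50 0 = p)
    (hx : μ.IsStr 40 x) (hy : μ.IsStr 41 y) (hz : μ.IsStr 42 z) :
    Det O .dictatorQueries μ (28 * n + 41) 7 fun μ' =>
      (Stmt.violation.val μ' ≠ 0 ↔
        violation (blockFn O.f (S.coord blk) p (S.wit p)) x y z = true) ∧
      ∀ b < 100, (b < 43 ∨ 50 ≤ b) → μ' b = μ b := by
  set g := blockFn O.f (S.coord blk) p (S.wit p) with hg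
  have step : ∀ μ₁ : Memory, (∀ b < 100, (b < 43 ∨ 50 ≤ b) → μ₁ b = μ b) →
      ∀ (e : Expr) (u : Fin n → Bool) (out : ℕ), (Denotes μ₁ (Stmt.bit 40) x →
        Denotes μ₁ (Stmt.bit 41) y → Denotes μ₁ (Stmt.bit 42) z → Denotes μ₁ e u) →
      43 ≤ out → out < 50 → Det O (Stmt.queryBlock e out) μ₁ (4 * n + 5) 1 fun μ' =>
        (μ' out 0 = (g u).toNat ∧ ∀ b < 100, b ≠ out → μ' b = μ₁ b) ∧
        ∀ b < 100, (b < 43 ∨ 50 ≤ b) → μ' b = μ b := by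
    intro μ₁ h₁ e u out he ho ho'
    refine (Det.queryBlock (h.congr fun b hb => h₁ b (by omega) (by omega)) hp
      (by rw [h₁ _ (by decide) (by decide), h50])
      (he (.read (by decide) (hx.congr (h₁ _ (by decide) (by decide))))
        (.read (by decide) (hy.congr (h₁ _ (by decide) (by decide))))
        (.read (by decide) (hz.congr (h₁ _ (by decide) (by decide)))))).mono le_rfl le_rfl ?_
    rintro μ' ⟨h2, h3⟩
    exact ⟨⟨h2, h3⟩, fun b hb hb' => by rw [h3 b hb (by omega), h₁ b hb hb']⟩
  refine (Det.comp (T₂ := 24 * n + 35) (q₂ := 6) (step μ (fun _ _ _ => rfl) _ z 43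
    (fun _ _ hz => hz) (by decide) (by decide)) fun μ₁ h₁ => ?_).mono (by omega) (by omega)
    fun _ h => h
  refine (Det.comp (T₂ := 20 * n + 29) (q₂ := 5) (step μ₁ h₁.2 _ _ 44
    (fun hx _ hz => hz.xor hx) (by decide) (by decide)) fun μ₂ h₂ => ?_).mono (by omega) (by omega)
    fun _ h => h
  refine (Det.comp (T₂ := 16 * n + 23) (q₂ := 4) (step μ₂ h₂.2 _ _ 45
    (fun _ hy hz => hz.xor hy) (by decide) (by decide)) fun μ₃ h₃ => ?_).mono (by omega) (by omega)
    fun _ h => h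
  refine (Det.comp (T₂ := 12 * n + 17) (q₂ := 3) (step μ₃ h₃.2 _ _ 46
    (fun hx hy hz => hz.xor (hx.and hy)) (by decide) (by decide)) fun μ₄ h₄ => ?_).mono (by omega)
    (by omega) fun _ h => h
  refine (Det.comp (T₂ := 8 * n + 11) (q₂ := 2) (step μ₄ h₄.2 _ _ 47
    (fun _ _ hz => hz.xor .one) (by decide) (by decide)) fun μ₅ h₅ => ?_).mono (by omega)
    (by omega) fun _ h => h
  refine (Det.comp (T₂ := 4 * n + 5) (q₂ := 1) (step μ₅ h₅.2 _ x 48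
    (fun hx _ _ => hx) (by decide) (by decide)) fun μ₆ h₆ => ?_).mono (by omega)
    (by omega) fun _ h => h
  refine (step μ₆ h₆.2 _ _ 49 (fun _ _ _ => .zero) (by decide) (by decide)).mono le_rfl le_rfl
    fun μ₇ h₇ => ⟨?_, h₇.2⟩
  have e1 := h₁.1.1
  rw [← h₂.1.2 43 (by decide) (by decide), ← h₃.1.2 43 (by decide) (by decide),
    ← h₄.1.2 43 (by decide) (by decide), ← h₅.1.2 43 (by decide) (by decide),
    ← h₆.1.2 43 (by decide) (by decide), ← h₇.1.2 43 (by decide) (by decide)] at e1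
  have e2 := h₂.1.1
  rw [← h₃.1.2 44 (by decide) (by decide),
    ← h₄.1.2 44 (by decide) (by decide), ← h₅.1.2 44 (by decide) (by decide),
    ← h₆.1.2 44 (by decide) (by decide), ← h₇.1.2 44 (by decide) (by decide)] at e2
  have e3 := h₃.1.1
  rw [← h₄.1.2 45 (by decide) (by decide), ← h₅.1.2 45 (by decide) (by decide),
    ← h₆.1.2 45 (by decide) (by decide), ← h₇.1.2 45 (by decide) (by decide)] at e3
  have e4 := h₄.1.1
  rw [← h₅.1.2 46 (by decide) (by decide),
    ← h₆.1.2 46 (by decide) (by decide), ← h₇.1.2 46 (by decide) (by decide)] at e4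
  have e5 := h₅.1.1
  rw [← h₆.1.2 47 (by decide) (by decide), ← h₇.1.2 47 (by decide) (by decide)] at e5
  have e6 := h₆.1.1
  rw [← h₇.1.2 48 (by decide) (by decide)] at e6
  have e7 := h₇.1.1
  have d1 := Expr.val_xor (Expr.val_xor (e₁ := .var 44) (e₂ := .var 43) (μ := μ₇) e2 e1)
    (Expr.val_xor (e₁ := .var 48) (e₂ := .var 49) (μ := μ₇) e6 e7)
  have d2 := Expr.val_xor (Expr.val_xor (e₁ := .var 46) (e₂ := .var 43) (μ := μ₇) e4 e1)
    (Expr.val_and (Expr.val_xor (e₁ := .var 44) (e₂ := .var 43) (μ := μ₇) e2 e1)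
      (Expr.val_xor (e₁ := .var 45) (e₂ := .var 43) (μ := μ₇) e3 e1))
  have d3 := Expr.val_isZero (Expr.val_xor (e₁ := .var 47) (e₂ := .var 43) (μ := μ₇) e5 e1)
  unfold Stmt.violation violation
  simp only [Expr.val] at d1 d2 d3 ⊢
  rw [d1, d2, d3]
  simp only [shiftDiff]
  -- The seven answers become arbitrary bits, and the arithmetic and the Boolean form of a violation
  -- are compared on all their values.
  generalize g _ = b1
  generalize g _ = b2
  generalize g _ = b3
  generalize g _ = b4
  generalize g _ = b5
  generalize g _ = b6
  generalize g _ = b7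
  revert b1 b2 b3 b4 b5 b6 b7
  decide

theorem Impl.dictatorRound (h : S.Rep blk K E μ) (hp : p < S.num) (h50 : μ 50 0 = p) :
    Impl O .dictatorRound μ (46 * n + 56) 7
      (dictatorRound (blockFn O.f (S.coord blk) p (S.wit p))) fun _ μ' =>
        ∀ b < 100, (b < 40 ∨ 50 ≤ b) → μ' b = μ b := by
  refine (Impl.comp (T₂ := 40 * n + 52) (q₂ := 7) (Impl.randomString h.consts.dim (by decide)
    (by decide)) fun x μ₁ h₁ => ?_).mono (by omega) (by omega) fun _ _ h => h
  have hr₁ : S.Rep blk K E μ₁ := h.congr fun b hb => h₁.2 b (by omega) (by omega)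
  refine (Impl.comp (T₂ := 34 * n + 48) (q₂ := 7) (Impl.randomString hr₁.consts.dim (by decide)
    (by decide)) fun y μ₂ h₂ => ?_).mono (by omega) (by omega) fun _ _ h => h
  have hr₂ : S.Rep blk K E μ₂ := hr₁.congr fun b hb => h₂.2 b (by omega) (by omega)
  refine (Impl.comp (T₂ := 28 * n + 44) (q₂ := 7) (Impl.randomString hr₂.consts.dim (by decide)
    (by decide)) fun z μ₃ h₃ => ?_).mono (by omega) (by omega) fun _ _ h => h
  have hr₃ : S.Rep blk K E μ₃ := hr₂.congr fun b hb => h₃.2 b (by omega) (by omega)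
  refine (Impl.det_comp (T₂ := 2) (q₂ := 0) (Det.dictatorQueries (x := x) (y := y) hr₃ hp ?_ ?_ ?_ h₃.1)
    fun μ₄ h₄ => ?_).mono (by omega) (by omega) fun _ _ h => h
  · rw [h₃.2 _ (by decide) (by decide), h₂.2 _ (by decide) (by decide),
      h₁.2 _ (by decide) (by decide), h50]
  · exact h₁.1.congr (by rw [h₃.2 _ (by decide) (by decide), h₂.2 _ (by decide) (by decide)])
  · exact h₂.1.congr (by rw [h₃.2 _ (by decide) (by decide)])
  · refine (Impl.cond (T := 1) (q := 0) (fun he => ?_) fun he => ?_).mono le_rfl le_rfl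
      fun _ _ h => h
    · rw [if_pos (h₄.1.1 he)]
      exact Impl.reject
    · rw [if_neg fun hv => h₄.1.2 hv he]
      refine Impl.ret_of_det (Det.skip.mono le_rfl le_rfl ?_)
      rintro μ₅ rfl b hb hb'
      rw [h₄.2 b hb (by omega), h₃.2 b hb (by omega), h₂.2 b hb (by omega), h₁.2 b hb (by omega)]

theorem Impl.dictatorTest (h : S.Rep blk K E μ) :
    Impl O .dictatorTest μ (K * (384 * (46 * n + 59) + 6) + 3) (K * (384 * 7))
      (dictatorTest O.f (S.coord blk) S) fun _ μ' => S.Rep blk K E μ' := by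
  refine (Impl.count (T := 384 * (46 * n + 59) + 3) (q := 384 * 7)
    (fun i _ μ' => μ' 50 0 = i ∧ S.Rep blk K E μ') S.num ?_ ?_ ?_).mono
    (Nat.add_le_add_right (Nat.mul_le_mul_right _ h.num_le) _) (Nat.mul_le_mul_right _ h.num_le)
    fun _ _ h => h.2
  · intro μ' h' h0
    exact ⟨h0, h.congr fun b hb => h' b (by omega)⟩
  · rintro i s μ' ⟨h1, h2⟩ hi
    simp [Expr.val, h2.num, h1]
  · rintro i s μ' ⟨h1, h2⟩ hi
    refine (Impl.count (fun j _ μ₁ => μ₁ 51 0 = j ∧ μ₁ 50 0 = i ∧ S.Rep blk K E μ₁) 384 ?_ ?_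
      ?_).mono le_rfl le_rfl ?_
    · intro μ₁ h' h0
      exact ⟨h0, by rw [h' _ (by decide), h1], h2.congr fun b hb => h' b (by omega)⟩
    · rintro j s μ₁ ⟨h1, -⟩ hj
      simp [Expr.val, h1]
    · rintro j s μ₁ ⟨h3, h4, h5⟩ hj
      refine (Impl.dictatorRound h5 hi h4).mono le_rfl le_rfl fun _ μ₂ h6 => ?_
      refine ⟨by rw [h6 _ (by decide) (by decide), h3], fun μ₃ h7 h8 => ⟨h8, ?_,
        h5.congr fun b hb => ?_⟩⟩
      · rw [h7 _ (by decide), h6 _ (by decide) (by decide), h4]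
      · rw [h7 b (by omega), h6 b (by omega) (by omega)]
    · rintro _ μ₁ ⟨-, h3, h4⟩
      exact ⟨h3, fun μ₂ h5 h6 => ⟨h6, h4.congr fun b hb => h5 b (by omega)⟩⟩

theorem Impl.readOnce (h : S.Rep blk K E μ) (hp : p < S.num) (h50 : μ 50 0 = p)
    (hx : μ.IsStr 53 x) :
    Impl O .readOnce μ (14 * n + 17) 2 (readOnce (blockFn O.f (S.coord blk) p (S.wit p)) x)
      fun v μ' => μ' 45 0 = v.toNat ∧ ∀ b < 100, (b < 42 ∨ 46 ≤ b) → μ' b = μ b := by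
  refine (Impl.comp (T₂ := 8 * n + 13) (q₂ := 2) (Impl.randomString h.consts.dim (by decide)
    (by decide)) fun z μ₁ h₁ => Impl.ret_of_det ?_).mono (by omega) (by omega) fun _ _ h => h
  have hr₁ : S.Rep blk K E μ₁ := h.congr fun b hb => h₁.2 b (by omega) (by omega)
  refine (Det.comp (T₂ := 4 * n + 7) (q₂ := 1) (Det.queryBlock hr₁ hp
    (by rw [h₁.2 _ (by decide) (by decide), h50]) (Denotes.xor (.read (by decide) h₁.1)
    (.read (by decide) (hx.congr (h₁.2 _ (by decide) (by decide)))))) fun μ₂ h₂ => ?_).mono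
    (by omega) (by omega) fun _ h => h
  have hr₂ : S.Rep blk K E μ₂ := hr₁.congr fun b hb => h₂.2 b (by omega) (by omega)
  refine (Det.comp (T₂ := 1) (q₂ := 0) (Det.queryBlock hr₂ hp
    (by rw [h₂.2 _ (by decide) (by decide), h₁.2 _ (by decide) (by decide), h50])
    (.read (by decide) (h₁.1.congr (h₂.2 _ (by decide) (by decide))))) fun μ₃ h₃ => ?_).mono
    (by omega) (by omega) fun _ h => h
  refine (Det.assign _ _ _).mono le_rfl le_rfl ?_
  rintro μ₄ rfl
  rw [Expr.val_xor (e₁ := .var 43) (e₂ := .var 44) (μ := μ₃)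
    (by simpa only [Expr.val, h₃.2 43 (by decide) (by decide)] using h₂.1) h₃.1]
  refine ⟨?_, fun b hb hb' => ?_⟩
  · simp [Memory.store_apply, Expr.val, shiftDiff]
  · rw [Memory.store_of_ne _ _ _ (by omega), h₃.2 b hb (by omega), h₂.2 b hb (by omega),
      h₁.2 b hb (by omega)]

theorem Impl.readBit (h : S.Rep blk K E μ) (hp : p < S.num) (h50 : μ 50 0 = p)
    (hx : μ.IsStr 53 x) :
    Impl O .readBit μ (readReps K E * (14 * n + 23) + 14 * n + 23) (readReps K E * 2 + 2)
      (readBit (blockFn O.f (S.coord blk) p (S.wit p)) (readReps K E) x)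
      fun v μ' => μ' 46 0 = v.toNat ∧
        ∀ b < 100, (b < 42 ∨ 47 ≤ b) → b ≠ 51 → μ' b = μ b := by
  refine (Impl.comp (T₂ := readReps K E * (14 * n + 23) + 5) (q₂ := readReps K E * 2)
    (Impl.readOnce h hp h50 hx) fun v μ₁ h₁ => ?_).mono (by omega) (by omega) fun _ _ h => h
  refine (Impl.det_comp (T₂ := readReps K E * (14 * n + 23) + 3) (q₂ := readReps K E * 2)
    (Det.assign _ _ _) fun μ₂ h₂ => ?_).mono (by omega) (by omega) fun _ _ h => h
  have hret : ∀ q : Run Unit, (q.andThen fun _ => Run.ret v) =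
      q.andThen fun u => Run.ret ((fun _ : Unit => v) u) := fun _ => rfl
  have main := Impl.count (O := O) (μ := μ₂) (a := 51) (lim := .var 7)
    (s := .comp .readOnce (.cond ((Expr.var 45).dist (.var 46)) (.halt false) .skip))
    (T := 14 * n + 20) (q := 2)
    (F := fun _ _ => (_root_.readOnce (blockFn O.f (S.coord blk) p (S.wit p)) x).andThen fun v' =>
      if v' ^^ v then Run.fail else Run.ret ())
    (fun i _ μ' => μ' 51 0 = i ∧ μ' 46 0 = v.toNat ∧
      ∀ b < 100, (b < 42 ∨ 47 ≤ b) → b ≠ 51 → μ' b = μ b) (readReps K E) (x := ()) ?_ ?_ ?_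
  -- Returning `v` needs no instruction, since the bit is kept in cell 0 of array 46 throughout the
  -- loop.
  · intro κ r T' q' w hc Q
    have := main κ r T' q' (fun _ => w v) (fun _ μ' h' Q => hc v μ' h'.2 Q) Q
    rw [Run.cost_andThen]
    simpa only [Run.cost_ret] using this
  · intro μ' h' h0
    refine ⟨h0, ?_, fun b hb hb' hne => ?_⟩
    · rw [h' _ (by decide), h₂, Memory.store_apply]
      simp [Expr.val, h₁.1]
    · rw [h' _ hne, h₂, Memory.store_of_ne _ _ _ (by omega), h₁.2 b hb (by omega)]
  · rintro i _ μ' ⟨h1, -, h2⟩ hi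
    simp [Expr.val, h2, h.consts.reps, h1]
  · rintro i _ μ' ⟨h1, h2, h3⟩ hi
    have hr : S.Rep blk K E μ' := h.congr fun b hb => h3 b (by omega) (by omega) (by omega)
    refine (Impl.comp (T₂ := 2) (q₂ := 0) (Impl.readOnce hr hp
      (by rw [h3 _ (by decide) (by decide) (by decide), h50])
      (hx.congr (h3 _ (by decide) (by decide) (by decide)))) fun v' μ₃ h₃ => ?_).mono (by omega)
      (by omega) fun _ _ h => h
    have hv : (Expr.dist (.var 45) (.var 46)).val μ₃ = _ := Expr.val_xor (b := v) h₃.1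
      (by simpa only [Expr.val, h₃.2 46 (by decide) (by decide)] using h2)
    refine (Impl.cond (T := 1) (q := 0) (fun he => ?_) fun he => ?_).mono le_rfl le_rfl
      fun _ _ h => h
    · rw [hv, Bool.toNat_ne_zero_iff] at he
      rw [if_pos he]
      exact Impl.reject
    · rw [hv, Bool.toNat_eq_zero] at he
      rw [he]
      refine Impl.ret_of_det (Det.skip.mono le_rfl le_rfl ?_)
      rintro μ₄ rfl
      refine ⟨by rw [h₃.2 _ (by decide) (by decide), h1], fun μ₅ h₅ h₆ => ⟨h₆, ?_,
        fun b hb hb' hne => ?_⟩⟩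
      · rw [h₅ _ (by decide), h₃.2 _ (by decide) (by decide), h2]
      · rw [h₅ _ hne, h₃.2 b hb (by omega), h3 b hb hb' hne]

/-- Time bound for reading the relevant variables. -/
def readTime (n K E : ℕ) : ℕ :=
  K * (readReps K E * (14 * n + 23) + 14 * n + 28) + 8 * n + 11

theorem Impl.readAll (h : S.Rep blk K E μ) (hx : μ.IsStr 53 x) :
    Impl O .readAll μ (readTime n K E) (K * (readReps K E * 2 + 2))
      (readAll O.f (S.coord blk) S (readReps K E) x)
      fun y μ' => μ'.IsStr 20 y ∧
        ∀ b < 100, (b < 20 ∨ 21 ≤ b ∧ b < 42 ∨ 52 ≤ b) → μ' b = μ b := by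
  refine (Impl.det_comp (T₂ := K * (readReps K E * (14 * n + 23) + 14 * n + 28) + 3)
    (q₂ := K * (readReps K E * 2 + 2))
    (Det.write (k := 0) h.consts.dim (by decide) (by decide) .zero fun _ _ => rfl)
    fun μ₁ h₁ => ?_).mono (by unfold readTime; omega) (by omega) fun _ _ h => h
  obtain ⟨h0, -, h1⟩ := h₁
  refine (Impl.count (T := readReps K E * (14 * n + 23) + 14 * n + 25)
    (q := readReps K E * 2 + 2) (fun i y μ' => μ' 50 0 = i ∧ μ'.IsStr 20 y ∧
      ∀ b < 100, (b < 20 ∨ 21 ≤ b ∧ b < 42 ∨ 52 ≤ b) → μ' b = μ b) S.num ?_ ?_ ?_).mono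
    (Nat.add_le_add_right (Nat.mul_le_mul_right _ h.num_le) _) (Nat.mul_le_mul_right _ h.num_le)
    fun _ _ h => h.2
  · intro μ' h' h0'
    refine ⟨h0', fun i => ?_, fun b hb hb' => ?_⟩
    · rw [h' _ (by decide), ← h0 i, Nat.zero_add]
    · rw [h' _ (by omega), h1 b hb (by omega)]
  · rintro i s μ' ⟨h1, -, h2⟩ hi
    simp [Expr.val, h2, h.num, h1]
  · rintro i y μ' ⟨h2, h3, h4⟩ hi
    have hr : S.Rep blk K E μ' := h.congr fun b hb => h4 b (by omega) (by omega)
    refine (Impl.comp (T₂ := 1) (q₂ := 0) (Impl.readBit hr hi h2 (hx.congr (h4 _ (by decide)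
      (by decide)))) fun v μ₂ h₂ => Impl.ret_of_det ?_).mono (by omega) (by omega) fun _ _ h => h
    have h50 : μ₂ 50 0 = i := by rw [h₂.2 _ (by decide) (by decide) (by decide), h2]
    refine (Det.assign _ _ _).mono le_rfl le_rfl fun μ₃ h₃ => ?_
    simp only [Expr.val, h50, h₂.1] at h₃
    refine ⟨by rw [h₃, Memory.store_of_ne _ _ _ (by decide), h50], fun μ₄ h₅ h₆ => ⟨h₆,
      fun j => ?_, fun b hb hb' => ?_⟩⟩
    · rw [h₅ _ (by decide), h₃, Memory.store_apply, if_pos rfl]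
      split_ifs with hj
      · simp only [hj, if_true]
      · rw [h₂.2 _ (by decide) (by decide) (by decide), h3 j]
        simp only [hj, if_false]
    · rw [h₅ _ (by omega), h₃, Memory.store_of_ne _ _ _ (by omega), h₂.2 b hb (by omega) (by omega),
        h4 b hb hb']

theorem Impl.readExample (h : S.Rep blk K E μ) :
    Impl O .readExample μ (readTime n K E + 4 * n + 8) (K * (readReps K E * 2 + 2) + 2)
      (readExample O.f O.D (S.coord blk) S (readReps K E))
      fun s μ' => μ'.IsStr 20 s.1 ∧ μ' 21 0 = s.2.toNat ∧
        ∀ b < 100, (b < 20 ∨ 22 ≤ b ∧ b < 42 ∨ 54 ≤ b) → μ' b = μ b := by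
  refine (Impl.comp (T₂ := readTime n K E + 4 * n + 6) (q₂ := K * (readReps K E * 2 + 2) + 1)
    (Impl.drawExample _) fun x μ₁ h₁ => ?_).mono (by omega) (by omega) fun _ _ h => h
  have e₁ : ∀ b, b ≠ 53 → μ₁ b = μ b := fun b hb => by rw [h₁, Memory.storeString_of_ne _ _ hb]
  have hx : μ₁.IsStr 53 x := by
    rw [h₁]
    exact μ.isStr_storeString 53 x
  have hr : S.Rep blk K E μ₁ := h.congr fun b hb => e₁ b (by omega)
  refine (Impl.comp (T₂ := 4 * n + 5) (q₂ := 1) (Impl.readAll hr hx)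
    fun y μ₂ h₂ => Impl.ret_of_det ?_).mono (by omega) (by omega) fun _ _ h => h
  have hr₂ : S.Rep blk K E μ₂ := hr.congr fun b hb => h₂.2 b (by omega) (by omega)
  refine (Det.query hr₂.consts.dim (hr₂.denotes_restr (.read (by decide) (hx.congr
    (h₂.2 _ (by decide) (by decide)))))).mono le_rfl le_rfl ?_
  rintro μ₃ ⟨h3, h4⟩
  refine ⟨h₂.1.congr (h4 _ (by decide) (by decide)), h3, fun b hb hb' => ?_⟩
  rw [h4 b hb (by omega), h₂.2 b hb (by omega), e₁ b (by omega)]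

theorem State.Rep.denotes_expand (h : S.Rep blk K E μ) (hK : K ≤ n) (hy : μ.IsStr 20 y) :
    Denotes μ Stmt.expand (_root_.expand (S.coord blk) y) := by
  intro μ' hμ i hi
  have hc := h.val_coord hμ hi
  by_cases h0 : S.coord blk i = 0
  · have : (Expr.coord.isZero.isZero).val μ' = (false).toNat := by
      rw [Expr.val_nonzero hc, h0]
      rfl
    simp only [Bool.toNat_false] at this
    simp only [Stmt.expand, Expr.and, Expr.val, this, _root_.expand, h0, hμ 20 (by decide), hc]
    -- The conjunction is (cell + 0) - 1, which is 0 only because the cell holds a bit. With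
    -- coordinate 0 the index truncates to 0, a position inside the string.
    by_cases hn : 0 < n
    · have := hy ⟨0, hn⟩
      simp only at this
      simp only [Nat.zero_sub, this]
      cases y ⟨0, hn⟩ <;> simp
    · exact absurd i.2 (by omega)
  · have hlt : S.coord blk i - 1 < n := by
      have := h.pos_le (blk i)
      have := h.num_le
      unfold State.coord at h0 ⊢
      omega
    refine Expr.val_and ?_ (Expr.val_nonzero hc)
    simp only [Expr.val, hc, hμ 20 (by decide), dif_pos hlt]
    exact hy ⟨_, hlt⟩

theorem Impl.uniformExample (h : S.Rep blk K E μ) (hK : K ≤ n) :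
    Impl O .uniformExample μ (10 * n + 9) 1 (uniformExample O.f (S.coord blk))
      fun s μ' => μ'.IsStr 20 s.1 ∧ μ' 21 0 = s.2.toNat ∧
        ∀ b < 100, (b < 20 ∨ 22 ≤ b ∧ b < 42 ∨ 54 ≤ b) → μ' b = μ b := by
  refine (Impl.comp (T₂ := 4 * n + 5) (q₂ := 1) (Impl.randomString h.consts.dim (by decide)
    (by decide)) fun y μ₁ h₁ => Impl.ret_of_det ?_).mono (by omega) (by omega) fun _ _ h => h
  have hr : S.Rep blk K E μ₁ := h.congr fun b hb => h₁.2 b (by omega) (by omega)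
  refine (Det.query hr.consts.dim (hr.denotes_expand hK h₁.1)).mono le_rfl le_rfl ?_
  rintro μ₃ ⟨h3, h4⟩
  refine ⟨h₁.1.congr (h4 _ (by decide) (by decide)), h3, fun b hb hb' => ?_⟩
  rw [h4 b hb (by omega), h₁.2 b hb (by omega)]

theorem Impl.consistencyRound (h : S.Rep blk K E μ) (hK : K ≤ n) :
    Impl O .consistencyRound μ (readTime n K E + 8 * n + 17) (K * (readReps K E * 2 + 2) + 3)
      (consistencyRound O.f O.D (S.coord blk) S (readReps K E))
      fun _ μ' => ∀ b < 100, (b < 20 ∨ 23 ≤ b ∧ b < 42 ∨ 54 ≤ b) → μ' b = μ b := by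
  -- A consistency round is a read example followed by one more query, so the program for examples
  -- can be reused.
  have hrw : _root_.consistencyRound O.f O.D (S.coord blk) S (readReps K E) =
      (_root_.readExample O.f O.D (S.coord blk) S (readReps K E)).andThen fun s =>
        if s.2 ^^ O.f (expand (S.coord blk) s.1) then Run.fail else Run.ret () := by
    unfold _root_.readExample _root_.consistencyRound
    simp only [Run.andThen_assoc, Run.ret_andThen]
  rw [hrw]
  refine (Impl.comp (T₂ := 4 * n + 8) (q₂ := 1) (Impl.readExample h) fun s μ₁ h₁ => ?_).mono
    (by omega) (by omega) fun _ _ h => h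
  have hr : S.Rep blk K E μ₁ := h.congr fun b hb => h₁.2.2 b (by omega) (by omega)
  refine (Impl.det_comp (T₂ := 2) (q₂ := 0)
    (Det.query hr.consts.dim (hr.denotes_expand hK h₁.1)) fun μ₂ h₂ => ?_).mono
    (by omega) (by omega) fun _ _ h => h
  have hv : (Expr.dist (.var 21) (.var 22)).val μ₂ = _ := Expr.val_xor (a := s.2)
      (by simpa only [Expr.val, h₂.2 21 (by decide) (by decide)] using h₁.2.1) h₂.1
  refine (Impl.cond (T := 1) (q := 0) (fun he => ?_) fun he => ?_).mono le_rfl le_rfl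
      fun _ _ h => h
  · rw [hv, Bool.toNat_ne_zero_iff] at he
    rw [if_pos he]
    exact Impl.reject
  · rw [hv, Bool.toNat_eq_zero] at he
    rw [he]
    refine Impl.ret_of_det (Det.skip.mono le_rfl le_rfl ?_)
    rintro μ₄ rfl b hb hb'
    rw [h₂.2 b hb (by omega), h₁.2.2 b hb (by omega)]

end TestPrograms

section WholeProgram

variable {n : ℕ} {O : Oracles n} {blk : Fin n → ℕ} {k K E : ℕ} {S : State n} {μ : Memory}

theorem Det.constants (hn : μ 0 0 = n) (hk : μ 1 0 = k) (hE : μ 2 0 = E)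
    (hK : k - (k - n) = K) :
    Det O .constants μ (16 * K.size + 4 * E.size + 69) 0 fun μ' =>
      Consts n K E μ' ∧ ∀ b, 9 ≤ b → b < 30 → μ' b = μ b := by
  have hb : labelBits K = K.size + K.size + 2 := rfl
  refine (Det.comp (T₂ := 16 * K.size + 4 * E.size + 67) (q₂ := 0) (Det.assign _ _ _)
    fun μ₁ h₁ => ?_).mono (by omega) (by omega) fun _ h => h
  simp only [Expr.val, hn, hk, hK] at h₁
  have e₁ : ∀ b, b ≠ 3 → μ₁ b = μ b := fun b hb => by rw [h₁, Memory.store_of_ne _ _ _ hb]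
  have s₁ : μ₁ 3 0 = K := by rw [h₁, Memory.store_apply]; simp
  refine (Det.comp (T₂ := 12 * K.size + 4 * E.size + 61) (q₂ := 0)
    (Det.size (k := K) (by decide) fun μ' hμ => by
      simp only [Expr.val, hμ 3 (by decide) (by decide), s₁])
    fun μ₂ h₂ => ?_).mono (by omega) (by omega) fun _ h => h
  refine (Det.comp (T₂ := 12 * K.size + 4 * E.size + 59) (q₂ := 0) (Det.assign _ _ _)
    fun μ₃ h₃ => ?_).mono (by omega) (by omega) fun _ h => h
  simp only [Expr.val, h₂.1, ← hb] at h₃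
  have e₃ : ∀ b < 100, b ≠ 3 → b ≠ 8 → b ≠ 4 → μ₃ b = μ b := fun b h0 h1 h2 h3 => by
    rw [h₃, Memory.store_of_ne _ _ _ h3, h₂.2 b h0 h2, e₁ b h1]
  have s₃ : μ₃ 3 0 = K ∧ μ₃ 8 0 = K.size ∧ μ₃ 4 0 = labelBits K := by
    rw [h₃, Memory.store_of_ne _ _ _ (by decide), Memory.store_of_ne _ _ _ (by decide),
      h₂.2 _ (by decide) (by decide), Memory.store_apply]
    exact ⟨s₁, h₂.1, by simp⟩
  refine (Det.comp (T₁ := 8 * K.size + 13) (T₂ := 4 * K.size + 4 * E.size + 45) (q₁ := 0) (q₂ := 0)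
    (R := fun μ₄ => (∀ j < labelBits K, μ₄ 5 j = 2 ^ j) ∧
      ∀ b < 100, b ≠ 5 → b ≠ 34 → μ₄ b = μ₃ b) ?_
    fun μ₄ h₄ => ?_).mono (by omega) (by omega) fun _ h => h
  · refine (Det.comp (T₂ := 4 * labelBits K + 3) (q₂ := 0) (Det.assign _ _ _)
      fun μ₄ h₄ => ?_).mono (by omega) (by omega) fun _ h => h
    simp only [Expr.val] at h₄
    refine (Det.count (T := 1) (q := 0) (fun i μ' => μ' 34 0 = i ∧ (∀ j ≤ i, μ' 5 j = 2 ^ j) ∧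
      ∀ b < 100, b ≠ 5 → b ≠ 34 → μ' b = μ₃ b) (labelBits K) ?_ ?_ ?_).mono (by omega) (by omega)
      fun μ' h => ⟨fun j hj => h.2.1 j hj.le, h.2.2⟩
    · intro μ' h' h0
      refine ⟨h0, fun j hj => ?_, fun b hb h1 h2 => ?_⟩
      · rw [h' _ (by decide), h₄, Memory.store_apply, Nat.le_zero.1 hj]
        simp
      · rw [h' b h2, h₄, Memory.store_of_ne _ _ _ h1]
    · rintro i μ' ⟨h1, -, h2⟩ hi
      simp [Expr.val, h2, s₃.2.2, h1]
    · rintro i μ' ⟨h1, h2, h3⟩ hi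
      refine (Det.assign _ _ _).mono le_rfl le_rfl fun μ₅ h₅ => ?_
      simp only [Expr.val, h1, h2 i le_rfl] at h₅
      refine ⟨by rw [h₅, Memory.store_of_ne _ _ _ (by decide), h1], fun μ₆ h₆ h₇ => ⟨h₇,
        fun j hj => ?_, fun b hb hb1 hb2 => ?_⟩⟩
      · rw [h₆ _ (by decide), h₅, Memory.store_apply, if_pos rfl]
        split_ifs with hji
        · rw [hji, pow_succ, mul_two]
        · exact h2 j (by omega)
      · rw [h₆ b hb2, h₅, Memory.store_of_ne _ _ _ hb1, h3 b hb hb1 hb2]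
  · obtain ⟨hp, e₄⟩ := h₄
    refine (Det.comp (T₂ := 4 * E.size + 7) (q₂ := 0)
      (Det.mul (l := K.size + 8) (k := E + E + E + E) (by decide) fun μ' hμ => ?_)
      fun μ₅ h₅ => ?_).mono (by omega) (by omega) fun _ h => h
    · simp only [Expr.val, hμ 8 (by decide) (by decide), hμ 2 (by decide) (by decide),
        e₄ 8 (by decide) (by decide) (by decide), e₄ 2 (by decide) (by decide) (by decide), s₃.2.1,
        e₃ 2 (by decide) (by decide) (by decide) (by decide), hE, and_self]
    have e₅ : ∀ b < 100, b ≠ 5 → b ≠ 34 → b ≠ 6 → μ₅ b = μ₃ b := fun b h0 h1 h2 h3 => by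
      rw [h₅.2 b h0 h3, e₄ b h0 h1 h2]
    refine (Det.comp (T₂ := 1) (q₂ := 0) (Det.size (k := E) (by decide) fun μ' hμ => ?_)
      fun μ₆ h₆ => ?_).mono (by omega) (by omega) fun _ h => h
    · simp only [Expr.val, hμ 2 (by decide) (by decide),
        e₅ 2 (by decide) (by decide) (by decide) (by decide),
        e₃ 2 (by decide) (by decide) (by decide) (by decide), hE]
    have e₆ : ∀ b < 100, b ≠ 5 → b ≠ 34 → b ≠ 6 → b ≠ 40 → μ₆ b = μ₃ b :=
      fun b h0 h1 h2 h3 h4 => by rw [h₆.2 b h0 h4, e₅ b h0 h1 h2 h3]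
    refine (Det.assign _ _ _).mono le_rfl le_rfl fun μ₇ h₇ => ?_
    simp only [Expr.val, h₆.1, e₆ 8 (by decide) (by decide) (by decide) (by decide) (by decide),
      s₃.2.1] at h₇
    have e₇ : ∀ b < 100, b ≠ 5 → b ≠ 34 → b ≠ 6 → b ≠ 40 → b ≠ 7 → μ₇ b = μ₃ b :=
      fun b h0 h1 h2 h3 h4 h5 => by
        rw [h₇, Memory.store_of_ne _ _ _ h5, e₆ b h0 h1 h2 h3 h4]
    refine ⟨⟨?_, ?_, ?_, ?_, fun j hj => ?_, ?_, ?_⟩, fun b hb hb' => ?_⟩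
    · rw [e₇ _ (by decide) (by decide) (by decide) (by decide) (by decide) (by decide),
        e₃ _ (by decide) (by decide) (by decide) (by decide), hn]
    · rw [e₇ _ (by decide) (by decide) (by decide) (by decide) (by decide) (by decide),
        e₃ _ (by decide) (by decide) (by decide) (by decide), hE]
    · rw [e₇ _ (by decide) (by decide) (by decide) (by decide) (by decide) (by decide), s₃.1]
    · rw [e₇ _ (by decide) (by decide) (by decide) (by decide) (by decide) (by decide), s₃.2.2]
    · rw [h₇, Memory.store_of_ne _ _ _ (by decide), h₆.2 _ (by decide) (by decide),
        h₅.2 _ (by decide) (by decide), hp j hj]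
    · rw [h₇, Memory.store_of_ne _ _ _ (by decide), h₆.2 _ (by decide) (by decide), h₅.1]
      rfl
    · rw [h₇, Memory.store_apply]
      rfl
    · rw [e₇ b (by omega) (by omega) (by omega) (by omega) (by omega) (by omega),
        e₃ b (by omega) (by omega) (by omega) (by omega)]

theorem Impl.partition (h : Consts n K E μ) (h0 : ∀ i : Fin n, μ 10 i = 0) :
    Impl O .partition μ (labelBits K * (10 * n + 10) + 3) 0 (partition n (labelBits K))
      fun blk μ' => (∀ i : Fin n, μ' 10 i = blk i) ∧
        ∀ b < 42, b ≠ 10 → μ' b = μ b := by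
  refine (Impl.count (T := 10 * n + 7) (q := 0) (fun i blk μ' => μ' 50 0 = i ∧
    (∀ i : Fin n, μ' 10 i = blk i) ∧ ∀ b < 42, b ≠ 10 → μ' b = μ b) (labelBits K)
    ?_ ?_ ?_).mono le_rfl (by omega) fun _ _ h => h.2
  · intro μ' h' h0'
    exact ⟨h0', fun i => by rw [h' _ (by decide), h0], fun b hb hb' => h' b (by omega)⟩
  · rintro i s μ' ⟨h1, -, h2⟩ hi
    simp [Expr.val, h2, h.bits, h1]
  · rintro i blk μ' ⟨h1, h2, h3⟩ hi
    refine (Impl.comp (T₂ := 4 * n + 3) (q₂ := 0) (Impl.randomString (n := n)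
      (by rw [h3 _ (by decide) (by decide), h.dim]) (by decide) (by decide))
      fun z μ₁ h₁ => Impl.ret_of_det ?_).mono (by omega) (by omega) fun _ _ h => h
    refine (Det.count (T := 1) (q := 0) (fun j μ₂ => μ₂ 101 0 = j ∧ (∀ b < 100, b ≠ 10 → μ₂ b = μ₁ b) ∧
      (∀ l : Fin n, (l : ℕ) < j → μ₂ 10 l = blk l + blk l + (z l).toNat) ∧
      ∀ l : Fin n, j ≤ (l : ℕ) → μ₂ 10 l = blk l) n ?_ ?_ ?_).mono (by omega) (by omega) ?_
    · intro μ₂ h₄ h₅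
      refine ⟨h₅, fun b hb hb' => h₄ b (by omega), fun l hl => by omega, fun l _ => ?_⟩
      rw [h₄ _ (by decide), h₁.2 _ (by decide) (by decide), h2]
    · rintro j μ₂ ⟨h4, h5, -⟩ hj
      simp [Expr.val, h5 0 (by decide) (by decide), h₁.2 0 (by decide) (by decide),
        h3 0 (by decide) (by decide), h.dim, h4]
    · rintro j μ₂ ⟨h4, h5, h6, h7⟩ hj
      refine (Det.assign _ _ _).mono le_rfl le_rfl fun μ₃ h₃ => ?_
      have hz := h₁.1 ⟨j, hj⟩
      have hl := h7 ⟨j, hj⟩ le_rfl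
      simp only at hz hl
      simp only [Expr.val, h4, h5 42 (by decide) (by decide), hz, hl] at h₃
      refine ⟨by rw [h₃, Memory.store_of_ne _ _ _ (by decide), h4], fun μ₄ h₄ h₅ => ⟨h₅,
        fun b hb hb' => ?_, fun l hl => ?_, fun l hl => ?_⟩⟩
      · rw [h₄ b (by omega), h₃, Memory.store_of_ne _ _ _ hb', h5 b hb hb']
      · rw [h₄ _ (by decide), h₃, Memory.store_apply, if_pos rfl]
        split_ifs with hlj
        · have : l = ⟨j, hj⟩ := Fin.ext hlj
          subst this
          rfl
        · exact h6 l (by omega)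
      · rw [h₄ _ (by decide), h₃, Memory.store_apply, if_pos rfl, if_neg (by omega)]
        exact h7 l (by omega)
    · rintro μ₂ ⟨-, h5, h6, -⟩
      refine ⟨?_, fun μ₃ h₃ h₄ => ⟨h₄, fun l => ?_, fun b hb hb' => ?_⟩⟩
      · rw [h5 _ (by decide) (by decide), h₁.2 _ (by decide) (by decide), h1]
      · rw [h₃ _ (by decide), h6 l l.2]
      · rw [h₃ b (by omega), h5 b (by omega) hb', h₁.2 b (by omega) (by omega), h3 b hb hb']

/-! ## The elimination as a program -/

theorem classAnswer_firstVars (L : Finset (Fin n) → List (BoolFn n)) (q j : ℕ)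
    (x : Fin n → Bool) : classAnswer L (firstVars n q) j x =
      if h : j < (candidates L q).length then ((candidates L q)[j] x).toNat else 2 := by
  unfold classAnswer candidates
  split
  · rename_i g hg
    obtain ⟨h, h'⟩ := List.getElem?_eq_some_iff.1 hg
    rw [dif_pos h, h']
  · rename_i hg
    rw [dif_neg (by simpa using hg)]

/-- What the elimination needs in memory. -/
structure Ready (blk : Fin n → ℕ) (K E : ℕ) (S : State n) (L : Finset (Fin n) → List (BoolFn n))
    (μ : Memory) : Prop where
  rep : S.Rep blk K E μ
  vars : μ.IsStr 19 (firstVars n S.num)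
  count : μ 18 0 = (candidates L S.num).length
  samples : μ 17 0 = learnSamples (candidates L S.num).length E

theorem Ready.congr {L : Finset (Fin n) → List (BoolFn n)} {μ' : Memory}
    (h : Ready blk K E S L μ) (hμ : ∀ b < 20, μ' b = μ b) : Ready blk K E S L μ' :=
  ⟨h.rep.congr fun b hb => hμ b (by omega), h.vars.congr (hμ _ (by decide)),
    by rw [hμ _ (by decide), h.count], by rw [hμ _ (by decide), h.samples]⟩

/-- The number of candidates is not part of the input. It is found by asking for values of functions
number 0, 1, … until the answer 2 appears; the string in array 20 at which they are evaluated does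
not matter. -/
theorem Det.prepare (h : S.Rep blk K E μ) :
    Det O .prepare μ (8 * n + 6 * (candidates O.list S.num).length +
        8 * (candidates O.list S.num).length.size + 41) 0 fun μ' =>
      Ready blk K E S O.list μ' ∧ ∀ j < (candidates O.list S.num).length, μ' 24 j = 0 := by
  set N := (candidates O.list S.num).length with hN
  refine (Det.comp (T₂ := 6 * N + 8 * N.size + 33) (q₂ := 0)
    (Det.write (k := 0) (x := firstVars n S.num) h.consts.dim (by decide) (by decide)
      (fun μ' hμ i hi => ?_) fun _ _ => rfl) fun μ₁ h₁ => ?_).mono (by omega) (by omega)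
      fun _ h => h
  · rw [Expr.val_nonzero (k := S.num - i) (by simp only [Expr.val, hμ 11 (by decide), h.num, hi])]
    congr 1
    rw [firstVars, decide_eq_decide]
    omega
  obtain ⟨h1, -, h2⟩ := h₁
  have hr₁ : S.Rep blk K E μ₁ := h.congr fun b hb => h2 b (by omega) (by omega)
  have hs₁ : μ₁.IsStr 19 (firstVars n S.num) := fun i => by rw [← h1 i, Nat.zero_add]
  have hans : ∀ μ' : Memory, μ' 19 = μ₁ 19 → ∀ j, classAnswer O.list (μ'.string n 19) j
      (μ'.string n 20) ≠ 2 ↔ j < N := fun μ' hμ j => by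
    rw [(hs₁.congr hμ).string, classAnswer_firstVars]
    split_ifs with hj
    · have := Bool.toNat_le ((candidates O.list S.num)[j] (μ'.string n 20))
      exact ⟨fun _ => hj, fun _ => by omega⟩
    · exact ⟨fun h => absurd rfl h, fun h => absurd h hj⟩
  have hle : ∀ μ' : Memory, ∀ j, classAnswer O.list (μ'.string n 19) j (μ'.string n 20) ≤ 2 :=
    fun μ' j => by
      unfold classAnswer
      split
      · exact (Bool.toNat_le _).trans (by decide)
      · exact le_rfl
  refine (Det.comp (T₁ := 6 * N + 5) (T₂ := 8 * N.size + 27) (q₁ := 0) (q₂ := 0)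
    (R := fun μ₂ => (∀ b < 20, b ≠ 18 → μ₂ b = μ₁ b) ∧ μ₂ 18 0 = N ∧ ∀ j < N, μ₂ 24 j = 0) ?_
    fun μ₂ h₂ => ?_).mono (by omega) (by omega) fun _ h => h
  · refine (Det.comp (T₂ := 6 * N + 3) (q₂ := 0) (Det.assign _ _ _) fun μ₂ h₂ => ?_).mono
      (by omega) (by omega) fun _ h => h
    simp only [Expr.val] at h₂
    refine (Det.comp (T₂ := 6 * N + 1) (q₂ := 0) (Det.classValue _ _ _ _) fun μ₃ h₃ => ?_).mono
      (by omega) (by omega) fun _ h => h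
    have h18 : μ₂ 18 0 = 0 := by rw [h₂, Memory.store_apply]; simp
    simp only [Expr.val, h18] at h₃
    refine (Det.loop (T := 5) (q := 0) (fun i μ' => (∀ b < 20, b ≠ 18 → μ' b = μ₁ b) ∧
      μ' 18 0 = i ∧ (∀ j < i, μ' 24 j = 0) ∧ (μ' 22 0 ≠ 2 ↔ i < N) ∧ μ' 22 0 ≤ 2) N
      ?_ ?_ ?_).mono (by omega) (by omega) fun μ' h => ⟨h.1, h.2.1, h.2.2.1⟩
    · rintro i μ' ⟨-, -, -, h4, h5⟩ hi
      rw [← h4]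
      simp only [Expr.val]
      omega
    · rintro i μ' ⟨h3, h4, h5, -, -⟩ hi
      refine (Det.comp (T₂ := 3) (q₂ := 0) (Det.assign _ _ _) fun μ₄ h₄ => ?_).mono
        (by omega) (by omega) fun _ h => h
      simp only [Expr.val, h4] at h₄
      refine (Det.comp (T₂ := 1) (q₂ := 0) (Det.assign _ _ _) fun μ₅ h₅ => ?_).mono
        (by omega) (by omega) fun _ h => h
      have e₄ : μ₄ 18 0 = i := by rw [h₄, Memory.store_of_ne _ _ _ (by decide), h4]
      simp only [Expr.val, e₄] at h₅
      refine (Det.classValue _ _ _ _).mono le_rfl le_rfl fun μ₆ h₆ => ?_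
      have e₅ : μ₅ 18 0 = i + 1 := by rw [h₅, Memory.store_apply]; simp
      simp only [Expr.val, e₅] at h₆
      have f₅ : ∀ b < 20, b ≠ 18 → μ₅ b = μ₁ b := fun b hb hb' => by
        rw [h₅, Memory.store_of_ne _ _ _ hb', h₄, Memory.store_of_ne _ _ _ (by omega), h3 b hb hb']
      have h22 : μ₆ 22 0 = classAnswer O.list (μ₅.string n 19) (i + 1) (μ₅.string n 20) := by
        rw [h₆, Memory.store_apply]; simp
      refine ⟨fun b hb hb' => ?_, ?_, fun j hj => ?_, ?_, ?_⟩
      · rw [h₆, Memory.store_of_ne _ _ _ (by omega), f₅ b hb hb']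
      · rw [h₆, Memory.store_of_ne _ _ _ (by omega), e₅]
      · rw [h₆, Memory.store_of_ne _ _ _ (by omega), h₅, Memory.store_of_ne _ _ _ (by omega), h₄,
          Memory.store_apply, if_pos rfl]
        split_ifs with hji
        · rfl
        · exact h5 j (by omega)
      · rw [h22]
        exact hans μ₅ (f₅ _ (by decide) (by decide)) _
      · rw [h22]
        exact hle _ _
    · have f₂ : ∀ b < 20, b ≠ 18 → μ₂ b = μ₁ b := fun b hb hb' => by
        rw [h₂, Memory.store_of_ne _ _ _ hb']
      have h22 : μ₃ 22 0 = classAnswer O.list (μ₂.string n 19) 0 (μ₂.string n 20) := by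
        rw [h₃, Memory.store_apply]; simp
      refine ⟨fun b hb hb' => ?_, ?_, fun j hj => by omega, ?_, ?_⟩
      · rw [h₃, Memory.store_of_ne _ _ _ (by omega), f₂ b hb hb']
      · rw [h₃, Memory.store_of_ne _ _ _ (by omega), h18]
      · rw [h22]
        exact hans μ₂ (f₂ _ (by decide) (by decide)) _
      · rw [h22]
        exact hle _ _
  · obtain ⟨h3, h4, h5⟩ := h₂
    refine (Det.comp (T₂ := 4 * N.size + 21) (q₂ := 0) (Det.size (k := N) (by decide)
      fun μ' hμ => ?_) fun μ₃ h₃ => ?_).mono (by omega) (by omega) fun _ h => h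
    · simp only [Expr.val, hμ 18 (by decide) (by decide), h4]
    have hr₃ : S.Rep blk K E μ₃ := hr₁.congr fun b hb => by
      rw [h₃.2 b (by omega) (by omega), h3 b (by omega) (by omega)]
    refine (Det.mul (l := N.size + 4) (k := E + E + E + E + (E + E + E + E)) (by decide)
      fun μ' hμ => ?_).mono (by omega) (by omega) fun μ₄ h₄ => ⟨⟨?_, ?_, ?_, ?_⟩, fun j hj => ?_⟩
    · simp only [Expr.val, hμ 23 (by decide) (by decide), hμ 2 (by decide) (by decide), h₃.1,
        hr₃.consts.inv, and_self]
    · exact hr₃.congr fun b hb => h₄.2 b (by omega) (by omega)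
    · exact hs₁.congr (by rw [h₄.2 _ (by decide) (by decide), h₃.2 _ (by decide) (by decide),
        h3 _ (by decide) (by decide)])
    · rw [h₄.2 _ (by decide) (by decide), h₃.2 _ (by decide) (by decide), h4]
    · rw [h₄.1, ← hN]
      rfl
    · rw [h₄.2 _ (by decide) (by decide), h₃.2 _ (by decide) (by decide), h5 j hj]

/-- The program `src` draws a labelled example. -/
def Draws (O : Oracles n) (blk : Fin n → ℕ) (K E : ℕ) (S : State n) (src : Stmt) (T q : ℕ)
    (p : Run ((Fin n → Bool) × Bool)) : Prop :=
  ∀ μ, S.Rep blk K E μ → Impl O src μ T q p fun s μ' =>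
    μ'.IsStr 20 s.1 ∧ μ' 21 0 = s.2.toNat ∧
      ∀ b < 100, (b < 20 ∨ 22 ≤ b ∧ b < 42 ∨ 54 ≤ b) → μ' b = μ b

theorem Impl.eliminationRound {src : Stmt} {T q : ℕ} {p : Run ((Fin n → Bool) × Bool)}
    (hsrc : Draws O blk K E S src T q p) (h : Ready blk K E S O.list μ) {dead : ℕ → Bool}
    (hd : ∀ j < (candidates O.list S.num).length, (μ 24 j ≠ 0 ↔ dead j = true)) :
    Impl O (.eliminationRound src) μ (T + 6 * (candidates O.list S.num).length + 4) q
      (eliminationRound O.list S.num p dead) fun dead' μ' => Ready blk K E S O.list μ' ∧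
        (∀ j < (candidates O.list S.num).length, (μ' 24 j ≠ 0 ↔ dead' j = true)) ∧
        μ' 54 = μ 54 := by
  set N := (candidates O.list S.num).length with hN
  refine (Impl.comp (T₂ := 6 * N + 3) (q₂ := 0) (hsrc μ h.rep) fun s μ₁ h₁ =>
    Impl.ret_of_det ?_).mono (by omega) (by omega) fun _ _ h => h
  obtain ⟨h1, h2, h3⟩ := h₁
  have hr₁ : Ready blk K E S O.list μ₁ := h.congr fun b hb => h3 b (by omega) (by omega)
  refine (Det.count (T := 3) (q := 0) (fun i μ' => μ' 55 0 = i ∧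
    (∀ b < 100, b ≠ 22 → b ≠ 24 → b ≠ 55 → μ' b = μ₁ b) ∧ (∀ j, i ≤ j → μ' 24 j = μ 24 j) ∧
    ∀ j < i, (μ' 24 j ≠ 0 ↔ (dead j ||
      decide (classAnswer O.list (firstVars n S.num) j s.1 ≠ s.2.toNat)) = true)) N ?_ ?_ ?_).mono
    (by omega) (by omega) ?_
  · intro μ' h' h0
    refine ⟨h0, fun b _ _ _ hb => h' b hb, fun j _ => ?_, fun j hj => by omega⟩
    rw [h' _ (by decide), h3 _ (by decide) (by decide)]
  · rintro i μ' ⟨h4, h5, -⟩ hi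
    simp [Expr.val, h5 18 (by decide) (by decide) (by decide) (by decide), hr₁.count, h4, hN]
  · rintro i μ' ⟨h4, h5, h6, h7⟩ hi
    refine (Det.comp (T₂ := 1) (q₂ := 0) (Det.classValue _ _ _ _) fun μ₂ h₂ => ?_).mono
      (by omega) (by omega) fun _ h => h
    rw [(hr₁.vars.congr (h5 19 (by decide) (by decide) (by decide) (by decide))).string,
      (h1.congr (h5 20 (by decide) (by decide) (by decide) (by decide))).string] at h₂
    simp only [Expr.val, h4] at h₂
    refine (Det.assign _ _ _).mono le_rfl le_rfl fun μ₃ h₃ => ?_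
    have e₂ : ∀ b, b ≠ 22 → μ₂ b = μ' b := fun b hb => by rw [h₂, Memory.store_of_ne _ _ _ hb]
    have h55 : μ₂ 55 0 = i := by rw [e₂ _ (by decide), h4]
    have e₃ : ∀ b, b ≠ 24 → μ₃ b = μ₂ b := fun b hb => by rw [h₃, Memory.store_of_ne _ _ _ hb]
    have h24 : ∀ j, μ₃ 24 j = if j = i then μ 24 i +
        (Expr.dist (.var 22) (.var 21)).val μ₂ else μ' 24 j := fun j => by
      rw [h₃, Memory.store_apply, if_pos rfl]
      simp only [Expr.val, h55, e₂ 24 (by decide), h6 i le_rfl]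
    refine ⟨by rw [e₃ _ (by decide), h55], fun μ₄ h₅ h₈ => ⟨h₈, fun b hb hb1 hb2 hb3 => ?_,
      fun j hj => ?_, fun j hj => ?_⟩⟩
    · rw [h₅ b hb3, e₃ b hb2, e₂ b hb1, h5 b hb hb1 hb2 hb3]
    · rw [h₅ _ (by decide), h24, if_neg (by omega), h6 j (by omega)]
    · rw [h₅ _ (by decide), h24]
      split_ifs with hji
      · subst hji
        have hv : (Expr.dist (.var 22) (.var 21)).val μ₂ = 0 ↔
            classAnswer O.list (firstVars n S.num) j s.1 = s.2.toNat := by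
          rw [Expr.val_dist_eq_zero]
          simp only [Expr.val, h5 21 (by decide) (by decide) (by decide) (by decide), h2, h₂,
            Memory.store_apply, if_true, Nat.reduceEqDiff, if_false]
        rw [Bool.or_eq_true, decide_eq_true_eq, ← hd j hi, ne_eq, Nat.add_eq_zero_iff, hv]
        tauto
      · exact h7 j (by omega)
  · rintro μ' ⟨-, h5, -, h7⟩
    refine ⟨hr₁.congr fun b hb => h5 b (by omega) (by omega) (by omega) (by omega), h7, ?_⟩
    rw [h5 _ (by decide) (by decide) (by decide) (by decide), h3 _ (by decide) (by decide)]

/-- Time bound for the elimination with `N` candidates. -/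
def eliminationTime (n E N T : ℕ) : ℕ :=
  learnSamples N E * (T + 6 * N + 7) + 8 * n + 10 * N + 8 * N.size + 60

theorem Impl.elimination {src : Stmt} {T q : ℕ} {p : Run ((Fin n → Bool) × Bool)}
    (hsrc : Draws O blk K E S src T q p) (h : S.Rep blk K E μ) :
    Impl O (.elimination src) μ (eliminationTime n E (candidates O.list S.num).length T)
      (learnSamples (candidates O.list S.num).length E * q) (elimination O.list S.num E p)
      fun _ _ => True := by
  unfold eliminationTime
  have main := @Det.prepare n O blk K E S μ h
  unfold _root_.elimination
  set N := (candidates O.list S.num).length with hN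
  refine (Impl.det_comp (T₂ := learnSamples N E * (T + 6 * N + 7) + 4 * N + 12)
    (q₂ := learnSamples N E * q) main fun μ₁ h₁ => ?_).mono (by omega) (by omega) fun _ _ h => h
  refine (Impl.comp (T₁ := learnSamples N E * (T + 6 * N + 7) + 3) (T₂ := 4 * N + 8)
    (q₁ := learnSamples N E * q) (q₂ := 0) (Impl.count (fun i dead μ' => μ' 54 0 = i ∧
    Ready blk K E S O.list μ' ∧ ∀ j < N, (μ' 24 j ≠ 0 ↔ dead j = true)) (learnSamples N E) ?_ ?_ ?_)
    fun dead μ₂ h₂ => ?_).mono (by omega) (by omega) fun _ _ h => h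
  · intro μ' h' h0
    refine ⟨h0, h₁.1.congr fun b hb => h' b (by omega), fun j hj => ?_⟩
    rw [h' _ (by decide), h₁.2 j hj]
    simp
  · rintro i dead μ' ⟨h1, h2, -⟩ hi
    simp [Expr.val, h2.samples, h1, hN]
  · rintro i dead μ' ⟨h1, h2, h3⟩ hi
    refine (Impl.eliminationRound hsrc h2 h3).mono le_rfl le_rfl ?_
    rintro dead' μ₂ ⟨h4, h5, h6⟩
    refine ⟨by rw [h6, h1], fun μ₃ h7 h8 => ⟨h8, h4.congr fun b hb => h7 b (by omega),
      fun j hj => ?_⟩⟩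
    rw [h7 _ (by decide), h5 j hj]
  · obtain ⟨-, h2, h3⟩ := h₂
    refine (Impl.det_comp (T₂ := 4 * N + 6) (q₂ := 0) (Det.assign _ _ _)
      fun μ₃ h₃ => ?_).mono (by omega) (by omega) fun _ _ h => h
    refine (Impl.det_comp (T₁ := 4 * N + 3) (T₂ := 2) (q₁ := 0) (q₂ := 0)
      ((Det.count (T := 1) (q := 0) (fun i μ' => μ' 55 0 = i ∧ μ' 18 = μ₂ 18 ∧ μ' 24 = μ₂ 24 ∧
      (μ' 26 0 ≠ 0 ↔ ∃ j < i, dead j = false)) N ?_ ?_ ?_).mono (by omega) (by omega)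
      fun _ h => h) fun μ₄ h₄ => ?_).mono (by omega) (by omega) fun _ _ h => h
    · intro μ' h' h0
      refine ⟨h0, ?_, ?_, ?_⟩
      · rw [h' _ (by decide), h₃, Memory.store_of_ne _ _ _ (by decide)]
      · rw [h' _ (by decide), h₃, Memory.store_of_ne _ _ _ (by decide)]
      · rw [h' _ (by decide), h₃, Memory.store_apply]
        simp [Expr.val]
    · rintro i μ' ⟨h4, h5, -⟩ hi
      simp [Expr.val, h5, h2.count, h4, hN]
    · rintro i μ' ⟨h4, h5, h6, h7⟩ hi
      refine (Det.assign _ _ _).mono le_rfl le_rfl fun μ₅ h₅ => ?_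
      have hz := Expr.val_isZero (e := .cell 24 (.var 55)) (μ := μ') (k := μ₂ 24 i)
        (by simp only [Expr.val, h6, h4])
      refine ⟨by rw [h₅, Memory.store_of_ne _ _ _ (by decide), h4], fun μ₆ h₆ h₇ => ⟨h₇, ?_, ?_, ?_⟩⟩
      · rw [h₆ _ (by decide), h₅, Memory.store_of_ne _ _ _ (by decide), h5]
      · rw [h₆ _ (by decide), h₅, Memory.store_of_ne _ _ _ (by decide), h6]
      · rw [h₆ _ (by decide), h₅, Memory.store_apply]
        have h26 : (Expr.plus (.var 26) (Expr.cell 24 (.var 55)).isZero).val μ' =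
            μ' 26 0 + (decide (μ₂ 24 i = 0)).toNat := by
          rw [← hz]
          rfl
        have hdi := h3 i hi
        rw [h26]
        simp only [Expr.val, if_true]
        rw [ne_eq, Nat.add_eq_zero_iff, not_and_or, ← ne_eq, h7, ← ne_eq, Bool.toNat_ne_zero_iff,
          decide_eq_true_eq]
        have hdi' : μ₂ 24 i = 0 ↔ dead i = false := by
          rw [← not_iff_not, ← ne_eq, hdi]
          simp
        rw [hdi']
        constructor
        · rintro (⟨j, hj, hj'⟩ | hj)
          · exact ⟨j, by omega, hj'⟩
          · exact ⟨i, by omega, hj⟩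
        · rintro ⟨j, hj, hj'⟩
          by_cases hji : j = i
          · subst hji
            exact Or.inr hj'
          · exact Or.inl ⟨j, by omega, hj'⟩
    · refine (Impl.cond (T := 1) (q := 0) (fun he => ?_) fun he => ?_).mono le_rfl le_rfl
        fun _ _ h => h
      · rw [if_pos (h₄.2.2.2.1 he)]
        exact Impl.ret_of_det (Det.skip.mono le_rfl le_rfl fun _ _ => trivial)
      · rw [if_neg fun hx => h₄.2.2.2.2 hx he]
        exact Impl.reject

end WholeProgram

/-! ### The complete testers as programs. -/

section Testers

variable {n : ℕ} {O : Oracles n} {blk : Fin n → ℕ} {k K E N : ℕ} {S : State n} {μ : Memory}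

theorem Impl.consistency (h : S.Rep blk K E μ) (hK : K ≤ n) :
    Impl O .consistency μ (32 * E * (readTime n K E + 8 * n + 20) + 137)
      (32 * E * (K * (readReps K E * 2 + 2) + 3))
      (Run.iter (fun _ _ => _root_.consistencyRound O.f O.D (S.coord blk) S (readReps K E)) 0 (32 * E) ())
      fun _ μ' => S.Rep blk K E μ' := by
  refine (Impl.det_comp (T₂ := 32 * E * (readTime n K E + 8 * n + 20) + 3)
    (q₂ := 32 * E * (K * (readReps K E * 2 + 2) + 3)) (Det.mul (l := 32) (k := E) (by decide)
    fun μ' hμ => ⟨rfl, by simp only [Expr.val, hμ 2 (by decide) (by decide), h.consts.inv]⟩)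
    fun μ₁ h₁ => ?_).mono (by omega) (by omega) fun _ _ h => h
  refine (Impl.count (T := readTime n K E + 8 * n + 17) (fun i _ μ' => μ' 54 0 = i ∧
    μ' 25 0 = 32 * E ∧ S.Rep blk K E μ') (32 * E) ?_ ?_ ?_).mono le_rfl le_rfl fun _ _ h => h.2.2
  · intro μ' h' h0
    exact ⟨h0, by rw [h' _ (by decide), h₁.1],
      h.congr fun b hb => by rw [h' b (by omega), h₁.2 b (by omega) (by omega)]⟩
  · rintro i _ μ' ⟨h1, h2, -⟩ hi
    simp [Expr.val, h2, h1]
  · rintro i _ μ' ⟨h1, h2, h3⟩ hi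
    refine (Impl.consistencyRound h3 hK).mono le_rfl le_rfl fun _ μ₂ h4 => ?_
    refine ⟨by rw [h4 _ (by decide) (by decide), h1], fun μ₃ h5 h6 => ⟨h6, ?_,
      h3.congr fun b hb => ?_⟩⟩
    · rw [h5 _ (by decide), h4 _ (by decide) (by decide), h2]
    · rw [h5 b (by omega), h4 b (by omega) (by omega)]

theorem learnSamples_mono {N N' : ℕ} (h : N ≤ N') : learnSamples N E ≤ learnSamples N' E :=
  Nat.mul_le_mul_right _ (Nat.add_le_add_right (Nat.size_le_size h) _)

theorem eliminationTime_mono {N N' T : ℕ} (h : N ≤ N') :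
    eliminationTime n E N T ≤ eliminationTime n E N' T := by
  unfold eliminationTime
  have := Nat.mul_le_mul (learnSamples_mono (E := E) h)
    (show T + 6 * N + 7 ≤ T + 6 * N' + 7 by omega)
  have := Nat.size_le_size h
  omega

/-- Time bound for the steps that the two testers have in common. -/
def commonTime (n K E : ℕ) : ℕ :=
  16 * K.size + 4 * E.size + (labelBits K * (10 * n + 10)) +
    (K + K + 2) * (roundTime n K E + 3) + K * (384 * (46 * n + 59) + 6) + 100

/-- Query bound for the steps that the two testers have in common. -/
def commonQueries (K E : ℕ) : ℕ :=
  (K + K + 2) * (searchSamples K E * 3 + labelBits K + 4) + K * (384 * 7)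

/-- The initial memory. -/
def startMemory (n k m : ℕ) : Memory := (startConfig .skip n k m).mem

/-- The two testers differ only in the statement `s` that follows the dictator test, and that
statement needs nothing but a represented search state. -/
theorem Impl.common {s : Stmt} {T q : ℕ} {p : (Fin n → ℕ) → State n → Run Unit}
    (hK : k - (k - n) = K)
    (hs : ∀ blk S μ, S.Rep blk K E μ → Impl O s μ T q (p blk S) fun _ _ => True) :
    Impl O (.comp₃ .constants .partition (.comp₃ .searchAll .dictatorTest s))
      (startMemory n k E) (commonTime n K E + T) (commonQueries K E + q)
      ((_root_.partition n (labelBits K)).andThen fun blk =>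
        (State.searchAll O.f O.D blk K E).andThen fun S =>
          (_root_.dictatorTest O.f (S.coord blk) S).andThen fun _ => p blk S) fun _ _ => True := by
  have h0 : ∀ b, 9 ≤ b → ∀ j, startMemory n k E b j = 0 := fun b hb j => by
    simp [startMemory, startConfig, show b ≠ 0 by omega, show b ≠ 1 by omega,
      show b ≠ 2 by omega]
  set R := (K + K + 2) * (roundTime n K E + 3) with hR
  set A := K * (384 * (46 * n + 59) + 6) with hA
  set B := labelBits K * (10 * n + 10) with hB
  set Q := (K + K + 2) * (searchSamples K E * 3 + labelBits K + 4) with hQ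
  set C := K * (384 * 7) with hC
  refine (Impl.det_comp (T₂ := B + R + A + T + 20) (q₂ := Q + C + q)
    (Det.constants (n := n) (k := k) (K := K) (E := E) (μ := startMemory n k E)
      rfl rfl rfl hK) fun μ₁ h₁ => ?_).mono
    (by unfold commonTime; omega) (by unfold commonQueries; omega) fun _ _ h => h
  refine (Impl.comp (T₂ := R + A + T + 16) (q₂ := Q + C + q) (Impl.partition h₁.1 fun i => by
    rw [h₁.2 _ (by decide) (by decide), h0 _ (by decide)]) fun blk μ₂ h₂ => ?_).mono
    (by omega) (by omega) fun _ _ h => h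
  have hz : ∀ b, 11 ≤ b → b < 30 → ∀ j, μ₂ b j = 0 := fun b hb hb' j => by
    rw [h₂.2 b (by omega) (by omega), h₁.2 b (by omega) hb', h0 b (by omega)]
  have hr : (State.init n).Rep blk K E μ₂ := by
    refine ⟨h₁.1.congr fun b hb => h₂.2 b (by omega) (by omega), h₂.1, hz _ (by decide) (by decide) _,
      hz _ (by decide) (by decide), fun p hp => ?_, fun p hp => absurd hp (Nat.not_lt_zero _),
      hz _ (by decide) (by decide) _, Nat.zero_le _, le_rfl, fun _ => le_rfl⟩
    rw [hz _ (by decide) (by decide), Nat.le_zero.1 hp, Nat.zero_mul]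
  refine (Impl.comp (T₂ := A + T + 5) (q₂ := C + q) (Impl.searchAll hr) fun S μ₃ h₃ => ?_).mono
    (by omega) (by omega) fun _ _ h => h
  exact (Impl.comp (Impl.dictatorTest h₃) fun _ μ₄ h₄ => hs blk S μ₄ h₄).mono (by omega) (by omega)
    fun _ _ h => h

theorem Impl.elimination_of_le {src : Stmt} {T q : ℕ} {p : Run ((Fin n → Bool) × Bool)}
    (hsrc : Draws O blk K E S src T q p) (hN : ∀ j, (candidates O.list j).length ≤ N)
    (h : S.Rep blk K E μ) : Impl O (.elimination src) μ (eliminationTime n E N T)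
      (learnSamples N E * q) (_root_.elimination O.list S.num E p) fun _ _ => True :=
  (Impl.elimination hsrc h).mono (eliminationTime_mono (hN _))
    (Nat.mul_le_mul_right _ (learnSamples_mono (hN _))) fun _ _ h => h

theorem Impl.uniformTester (hK : k - (k - n) = K) (hN : ∀ j, (candidates O.list j).length ≤ N) :
    Impl O .uniformTester (startMemory n k E)
      (commonTime n K E + (32 * E * (readTime n K E + 8 * n + 20) + 138 +
        eliminationTime n E N (10 * n + 9)))
      (commonQueries K E + (32 * E * (K * (readReps K E * 2 + 2) + 3) + learnSamples N E * 1))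
      (_root_.uniformTester O.f O.D O.list K E) fun _ _ => True := by
  refine Impl.common hK fun blk S μ h => ?_
  refine (Impl.comp (Impl.consistency h (by omega)) fun _ μ' h' =>
    Impl.elimination_of_le (fun _ hr => Impl.uniformExample hr (by omega)) hN h').mono (by omega)
    le_rfl fun _ _ h => h

theorem Impl.distributionFreeTester (hK : k - (k - n) = K)
    (hN : ∀ j, (candidates O.list j).length ≤ N) :
    Impl O .distributionFreeTester (startMemory n k E)
      (commonTime n K E + eliminationTime n E N (readTime n K E + 4 * n + 8))
      (commonQueries K E + learnSamples N E * (K * (readReps K E * 2 + 2) + 2))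
      (_root_.distributionFreeTester O.f O.D O.list K E) fun _ _ => True :=
  Impl.common hK fun _ _ _ h => Impl.elimination_of_le (fun _ hr => Impl.readExample hr) hN h

/-- The verdict of a program that accepts when it does not reject. -/
theorem Impl.accept {s : Stmt} {T q : ℕ} {p : Run Unit}
    (h : Impl O s (startMemory n k E) T q p fun _ _ => True) :
    (∀ c ∈ (runFor O (T + 2) (startConfig (.accept s) n k E)).support,
      c.verdict ≠ none ∧ c.queries ≤ q) ∧
    ∀ κ : Bool → ℝ≥0∞, ∑' c, runFor O (T + 2) (startConfig (.accept s) n k E) c *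
      c.verdict.elim 0 κ ≤ p.cost (κ false) fun _ => κ true := by
  have key : ∀ κ, Bound O κ (T + 2) q (p.cost (κ false) fun _ => κ true)
      (startConfig (.accept s) n k E) := fun κ => by
    have hb : ∀ μ' Q, Bound O κ 0 0 (κ true) ⟨[], μ', Q, some true⟩ := fun μ' Q => by
      refine ⟨fun c' hc' => ?_, ?_⟩
      · rw [runFor, PMF.mem_support_pure_iff] at hc'
        subst hc'
        simp
      · rw [runFor, PMF.tsum_pure_mul]
        simp
    have h1 := h κ [.halt true] 1 0 (fun _ => κ true) (fun _ μ' _ Q =>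
      (Bound.step_pure (q' := 0) (by rfl) (by simp) (hb μ' Q)).mono (by omega) (by omega) le_rfl) 0
    exact (Bound.step_pure (q' := 0) (by rfl) (by simp) h1).mono (by omega) (by omega) le_rfl
  refine ⟨fun c hc => ?_, fun κ => (key κ).2⟩
  have := (key fun _ => 0).1 c hc
  exact ⟨this.2.1, by simpa [startConfig] using this.2.2⟩

end Testers

/-! ## Certain events -/

namespace Run

variable {α β : Type}

/-- The computation never rejects, and its results have property `P`. -/
def Always (p : Run α) (P : α → Prop) : Prop :=
  ∀ o ∈ p.support, ∃ a, o = some a ∧ P a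

theorem Always.mono {p : Run α} {P P' : α → Prop} (h : Always p P) (hP : ∀ a, P a → P' a) :
    Always p P' := fun o ho => by
  obtain ⟨a, rfl, ha⟩ := h o ho
  exact ⟨a, rfl, hP a ha⟩

theorem always_ret {a : α} {P : α → Prop} (h : P a) : Always (ret a) P := fun o ho => by
  rw [ret, PMF.mem_support_pure_iff] at ho
  exact ⟨a, ho, h⟩

theorem always_lift {p : PMF α} {P : α → Prop} (h : ∀ a, P a) : Always (lift p) P := fun o ho => by
  rw [lift, PMF.mem_support_map_iff] at ho
  obtain ⟨a, -, rfl⟩ := ho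
  exact ⟨a, rfl, h a⟩

theorem Always.andThen {p : Run α} {g : α → Run β} {P : α → Prop} {P' : β → Prop}
    (h : Always p P) (hg : ∀ a, P a → Always (g a) P') : Always (p.andThen g) P' := fun o ho => by
  rw [Run.andThen, PMF.mem_support_bind_iff] at ho
  obtain ⟨o', ho', ho⟩ := ho
  obtain ⟨a, rfl, ha⟩ := h o' ho'
  exact hg a ha o ho

theorem always_iter {F : ℕ → α → Run α} {P : ℕ → α → Prop} (m : ℕ)
    (hF : ∀ i a, P i a → i < m → Always (F i a) (P (i + 1))) (l : ℕ) {i : ℕ} {a : α}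
    (hi : i + l = m) (h : P i a) : Always (iter F i l a) (P m) := by
  induction l generalizing i a with
  | zero =>
    rw [← hi]
    exact always_ret h
  | succ l ih => exact (hF i a h (by omega)).andThen fun a' ha' => ih (by omega) ha'

theorem Always.cost_eq_zero {p : Run α} {P : α → Prop} (h : Always p P) (c : ℝ≥0∞) :
    cost c p (fun _ => 0) = 0 := by
  unfold cost
  rw [ENNReal.tsum_eq_zero]
  intro o
  by_cases ho : o ∈ p.support
  · obtain ⟨a, rfl, -⟩ := h o ho
    simp
  · rw [PMF.mem_support_iff, not_not] at ho
    simp [ho]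

end Run

/-! ## Relevant variables -/

section Relevant

variable {n : ℕ}

/-- Pass from `b` to `a` one coordinate at a time: a step at a relevant variable changes nothing in
the string, and a step elsewhere cannot change the value. -/
theorem eq_of_eqOn_relevantVars (f : BoolFn n) {a b : Fin n → Bool}
    (h : ∀ i ∈ relevantVars f, a i = b i) : f a = f b := by
  classical
  have key : ∀ s : Finset (Fin n), f (s.piecewise a b) = f b := by
    intro s
    induction s using Finset.induction_on with
    | empty => simp
    | insert i s _ ih =>
      rw [Finset.piecewise_insert, ← ih]
      by_cases hi : i ∈ relevantVars f
      · by_cases his : i ∈ s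
        · congr 1
          rw [Function.update_eq_self_iff, Finset.piecewise_eq_of_mem _ _ _ his]
        · congr 1
          rw [Function.update_eq_self_iff, Finset.piecewise_eq_of_notMem _ _ _ his, h i hi]
      · by_contra hne
        refine hi ?_
        simp only [relevantVars, Finset.mem_filter, Finset.mem_univ, true_and]
        exact ⟨_, _, Ne.symm hne⟩
  have := key Finset.univ
  rwa [Finset.piecewise_univ] at this

theorem mem_relevantVars {f : BoolFn n} {i : Fin n} {a : Fin n → Bool} {b : Bool}
    (h : f a ≠ f (Function.update a i b)) : i ∈ relevantVars f := by
  simp only [relevantVars, Finset.mem_filter, Finset.mem_univ, true_and]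
  exact ⟨a, b, h⟩

/-- After `i` halvings the interval has length 2 ^ (b - i), with `P` false at its left end and true
at its right end. No monotonicity of `P` is needed. -/
theorem bisect_spec (P : ℕ → Bool) (b : ℕ) (h0 : P 0 = false) (h1 : P (2 ^ b) = true) :
    P (bisect P b b) = false ∧ P (bisect P b b + 1) = true := by
  have key : ∀ i ≤ b, P (bisect P b i) = false ∧ P (bisect P b i + 2 ^ (b - i)) = true := by
    intro i
    induction i with
    | zero => exact fun _ => ⟨h0, by simpa [bisect] using h1⟩
    | succ i ih =>
      intro hi
      obtain ⟨h2, h3⟩ := ih (by omega)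
      have hb : b - i = b - 1 - i + 1 := by omega
      have hb' : b - (i + 1) = b - 1 - i := by omega
      rw [bisect, hb']
      by_cases hP : P (bisect P b i + 2 ^ (b - 1 - i)) = true
      · rw [if_pos hP]
        exact ⟨h2, hP⟩
      · rw [if_neg hP]
        refine ⟨by simpa using hP, ?_⟩
        rw [hb, pow_succ, mul_two, ← add_assoc] at h3
        exact h3
  simpa using key b le_rfl

end Relevant

/-! ## The search accepts juntas with separated variables -/

section Completeness

variable {n : ℕ} {f : BoolFn n} {blk : Fin n → ℕ} {K E : ℕ} {S : State n}

/-- The invariant of the search. -/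
structure State.Sound (f : BoolFn n) (blk : Fin n → ℕ) (S : State n) : Prop where
  pos_le : ∀ l, S.pos l ≤ S.num
  pos_inj : ∀ l l', S.pos l ≠ 0 → S.pos l = S.pos l' → l = l'
  wit : ∀ p < S.num, f (S.wit p) ≠ f (substBlock (S.coord blk) p (S.wit p) fun _ => false)
  restr : ∀ p < S.val, restr (S.coord blk) (S.wit p) = S.wit p
  val_le : S.val ≤ S.num

/-- Clearing a block without relevant variables could not change the value at its witness. -/
theorem State.Sound.exists_relevant (h : S.Sound f blk) {p : ℕ} (hp : p < S.num) :
    ∃ i ∈ relevantVars f, S.coord blk i = p + 1 := by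
  by_contra! hne
  refine h.wit p hp (eq_of_eqOn_relevantVars f fun i hi => ?_)
  rw [substBlock, if_neg (hne i hi)]

theorem State.Sound.num_le (h : S.Sound f blk) : S.num ≤ (relevantVars f).card := by
  choose t ht ht' using fun p : Fin S.num => h.exists_relevant p.2
  have := Finset.card_le_card_of_injOn (s := Finset.univ) (t := relevantVars f) t
    (fun p _ => ht p) fun p _ p' _ hpp => by
      have h1 := ht' p
      have h2 := ht' p'
      rw [hpp, h2] at h1
      exact Fin.ext (by omega)
  simpa using this

/-- Bisection yields two consecutive hybrids with different values. They differ at most on one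
block, which is new because all hybrids agree on the found blocks, and clearing it in the later
hybrid gives the earlier one. Older witnesses keep their properties, since adding a block only
enlarges the set of found coordinates. -/
theorem State.Sound.add_search (h : S.Sound f blk) (hblk : ∀ i, blk i < 2 ^ labelBits K)
    {u : Fin n → Bool} (hu : f u ≠ f (_root_.restr (S.coord blk) u)) :
    (S.add (S.search f blk K u)
      (hybrid blk (S.coord blk) u (S.search f blk K u + 1))).Sound f blk := by
  set l := S.search f blk K u with hl
  have hs : f (hybrid blk (S.coord blk) u l) = f (_root_.restr (S.coord blk) u) ∧
      f (hybrid blk (S.coord blk) u (l + 1)) ≠ f (_root_.restr (S.coord blk) u) := by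
    have := bisect_spec (fun j => f (hybrid blk (S.coord blk) u j) ^^
      f (_root_.restr (S.coord blk) u)) (labelBits K) ?_ ?_
    · rw [← State.search, ← hl] at this
      simpa using this
    · have : hybrid blk (S.coord blk) u 0 = _root_.restr (S.coord blk) u := by
        funext i
        simp [hybrid, _root_.restr]
      simp [this]
    · have : hybrid blk (S.coord blk) u (2 ^ labelBits K) = u := by
        funext i
        have := hblk i
        simp only [hybrid]
        rw [decide_eq_true (by omega), Bool.and_true]
      rw [this]
      simpa using hu
  -- If the block were already found, the two consecutive hybrids would coincide.
  have hpos : S.pos l = 0 := by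
    by_contra hne
    refine hs.2 ?_
    rw [← hs.1]
    congr 1
    funext i
    simp only [hybrid]
    congr 1
    rw [decide_eq_decide]
    by_cases hi : blk i = l
    · have : S.coord blk i ≠ 0 := by rw [State.coord, hi]; exact hne
      omega
    · omega
  have hc : ∀ i, (S.add l (hybrid blk (S.coord blk) u (l + 1))).coord blk i =
      if blk i = l then S.num + 1 else S.coord blk i := fun i => by
    simp [State.coord, State.add, Function.update_apply]
  have hle : ∀ i, S.coord blk i ≤ S.num := fun i => h.pos_le _
  refine ⟨fun m => ?_, fun m m' => ?_, fun p hp => ?_, fun p hp => ?_, ?_⟩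
  · have := h.pos_le m
    simp only [State.add, Function.update_apply]
    split_ifs <;> omega
  · have h1 := h.pos_le m
    have h2 := h.pos_le m'
    have h3 := h.pos_inj m m'
    simp only [State.add, Function.update_apply]
    split_ifs with hm hm' hm'
    · intros; omega
    · intros; omega
    · intros; omega
    · exact h3
  · simp only [State.add] at hp
    by_cases hpn : p = S.num
    · subst hpn
      simp only [State.add, Function.update_self]
      rw [show substBlock _ S.num (hybrid blk (S.coord blk) u (l + 1)) (fun _ => false) =
        hybrid blk (S.coord blk) u l from ?_, hs.1]
      · exact hs.2
      · funext i
        have hci := hc i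
        simp only [State.add] at hci
        have := hle i
        simp only [substBlock, hci]
        by_cases hi : blk i = l
        · simp [hybrid, hi, State.coord, hpos]
        · rw [if_neg hi, if_neg (by omega)]
          simp only [hybrid]
          congr 1
          rw [decide_eq_decide]
          omega
    · have hw := h.wit p (by omega)
      have : (S.add l (hybrid blk (S.coord blk) u (l + 1))).wit p = S.wit p := by
        simp [State.add, hpn]
      rw [this]
      refine fun hne => hw (hne.trans (congrArg f (funext fun i => ?_)))
      rw [substBlock, substBlock, hc]
      by_cases hi : blk i = l
      · rw [if_pos hi, if_neg (by omega), if_neg]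
        rw [State.coord, hi, hpos]
        omega
      · rw [if_neg hi]
  · simp only [State.add] at hp
    have hpv := h.val_le
    have : (S.add l (hybrid blk (S.coord blk) u (l + 1))).wit p = S.wit p := by
      simp [State.add, show p ≠ S.num by omega]
    rw [this]
    have hr := h.restr p hp
    funext i
    have hri := congrFun hr i
    simp only [_root_.restr] at hri ⊢
    rw [hc]
    by_cases hi : blk i = l
    · rw [if_pos hi]
      simp
    · rw [if_neg hi]
      exact hri
  · exact h.val_le.trans (Nat.le_succ _)

theorem State.Sound.always_extend (h : S.Sound f blk) (hblk : ∀ i, blk i < 2 ^ labelBits K)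
    (hK : (relevantVars f).card ≤ K) {u : Fin n → Bool}
    (hu : f u ≠ f (_root_.restr (S.coord blk) u)) :
    (S.extend f blk K u).Always fun S' => S'.Sound f blk ∧ S'.num = S.num + 1 ∧
      S'.val = S.val := by
  have hs := h.add_search hblk hu
  have hn := hs.num_le
  simp only [State.add] at hn
  rw [State.extend, if_pos (by omega)]
  exact Run.always_ret ⟨hs, rfl, rfl⟩

/-- Restriction commutes with clearing a found block. If `f` still distinguishes the two restricted
strings, the restricted witness is valid. Otherwise f(w) ≠ f(w₀) forces `w` or `w₀` to differ in
value from its restriction, which exposes a new block. In both cases the measure num + val grows by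
one. -/
theorem State.Sound.always_validate (h : S.Sound f blk) (hblk : ∀ i, blk i < 2 ^ labelBits K)
    (hK : (relevantVars f).card ≤ K) (hv : S.val < S.num) :
    (S.validate f blk K).Always fun S' => S'.Sound f blk ∧
      S'.num + S'.val = S.num + S.val + 1 := by
  have hw := h.wit S.val hv
  unfold State.validate
  simp only
  set c := S.coord blk with hc
  set w := S.wit S.val with hw'
  set w₀ := substBlock c S.val w fun _ => false with hw₀
  split_ifs with h1 h2
  · refine Run.always_ret ⟨⟨h.pos_le, h.pos_inj, fun p hp => ?_, fun p hp => ?_, hv⟩, ?_⟩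
    · change p < S.num at hp
      change f (Function.update S.wit S.val (_root_.restr c w) p) ≠
        f (substBlock c p (Function.update S.wit S.val (_root_.restr c w) p) fun _ => false)
      by_cases hpv : p = S.val
      · subst hpv
        rw [Function.update_self]
        have : substBlock c S.val (_root_.restr c w) (fun _ => false) = _root_.restr c w₀ := by
          funext i
          simp only [hw₀, substBlock, _root_.restr]
          split_ifs <;> simp
        rw [this]
        simpa using h1
      · rw [Function.update_of_ne hpv]
        exact h.wit p hp
    · change p < S.val + 1 at hp
      change _root_.restr c (Function.update S.wit S.val (_root_.restr c w) p) =
        Function.update S.wit S.val (_root_.restr c w) p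
      by_cases hpv : p = S.val
      · subst hpv
        rw [Function.update_self]
        funext i
        simp [_root_.restr]
      · rw [Function.update_of_ne hpv]
        exact h.restr p (by omega)
    · change S.num + (S.val + 1) = _
      omega
  · exact (h.always_extend hblk hK (by simpa using h2)).mono fun S' hS' => ⟨hS'.1, by omega⟩
  · refine (h.always_extend hblk hK ?_).mono fun S' hS' => ⟨hS'.1, by omega⟩
    have h1' : f (_root_.restr c w) = f (_root_.restr c w₀) := by
      revert h1; cases f (_root_.restr c w) <;> cases f (_root_.restr c w₀) <;> simp
    have h2' : f w = f (_root_.restr c w) := by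
      revert h2; cases f (_root_.restr c w) <;> cases f w <;> simp
    rw [← h1', ← h2']
    exact hw.symm

theorem State.always_findBad (D : PMF (Fin n → Bool)) (c : Fin n → ℕ) (M : ℕ) :
    (State.findBad f D c M).Always fun o => ∀ u, o = some u → f u ≠ f (_root_.restr c u) := by
  refine Run.always_iter (P := fun _ (o : Option (Fin n → Bool)) => ∀ u, o = some u →
    f u ≠ f (_root_.restr c u)) M (fun i o ho _ => ?_) M (Nat.zero_add M) (by simp)
  rcases o with _ | u
  · refine (Run.always_lift (P := fun _ => True) fun _ => trivial).andThen fun u _ =>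
      Run.always_ret fun u' hu' => ?_
    split_ifs at hu' with h
    obtain rfl := Option.some.inj hu'
    simpa using h
  · exact Run.always_ret ho

/-- Each unfinished round raises num + val by one. This sum is at most 2K, because distinct found
blocks contain distinct relevant variables and val ≤ num, so the rounds cannot run out. -/
theorem State.always_searchAll (D : PMF (Fin n → Bool)) (hblk : ∀ i, blk i < 2 ^ labelBits K)
    (hK : (relevantVars f).card ≤ K) :
    (State.searchAll f D blk K E).Always fun S => S.Sound f blk ∧ S.val = S.num := by
  unfold State.searchAll
  refine (Run.always_iter (P := fun i (s : State n × Bool) => s.1.Sound f blk ∧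
    (s.2 = true → s.1.val = s.1.num) ∧ (s.2 = false → i ≤ s.1.num + s.1.val)) (K + K + 2)
    (fun i s hs _ => ?_) (K + K + 2) (Nat.zero_add _) ?_).andThen fun s hs => ?_
  · obtain ⟨S, done⟩ := s
    obtain ⟨h1, h2, h3⟩ := hs
    simp only at h1 h2 h3
    rcases done with _ | _
    · simp only [State.round]
      split_ifs with hv
      · refine (h1.always_validate hblk hK hv).andThen fun S' hS' => Run.always_ret
          ⟨hS'.1, by simp, fun _ => ?_⟩
        have := h3 rfl
        simp only
        omega
      · refine (State.always_findBad D _ _).andThen fun o ho => ?_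
        rcases o with _ | u
        · refine Run.always_ret ⟨h1, fun _ => ?_, by simp⟩
          have := h1.val_le
          simp only
          omega
        · refine (h1.always_extend hblk hK (ho u rfl)).andThen fun S' hS' => Run.always_ret
            ⟨hS'.1, by simp, fun _ => ?_⟩
          have := h3 rfl
          simp only
          omega
    · exact Run.always_ret ⟨h1, h2, by simp⟩
  · refine ⟨⟨fun _ => le_rfl, fun l l' h => absurd rfl h, fun p hp => absurd hp (Nat.not_lt_zero _),
      fun p hp => absurd hp (Nat.not_lt_zero _), le_rfl⟩, by simp, fun _ => Nat.zero_le _⟩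
  · obtain ⟨h1, h2, h3⟩ := hs
    have hdone : s.2 = true := by
      by_contra hne
      have := h3 (by simpa using hne)
      have := h1.num_le
      have := h1.val_le
      omega
    rw [if_pos hdone]
    exact Run.always_ret ⟨h1, h2 hdone⟩

end Completeness

/-! ## The tests accept -/

section Acceptance

variable {n : ℕ} {f : BoolFn n} {blk : Fin n → ℕ} {K E : ℕ} {S : State n}

/-- A found block contains a relevant variable, and only one because the relevant variables are
separated. So the block function depends on a single bit, and the witness shows that it is not
constant. -/
theorem State.Sound.exists_dictator (h : S.Sound f blk)
    (hinj : Set.InjOn blk (relevantVars f)) {p : ℕ} (hp : p < S.num) :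
    ∃ τ ∈ relevantVars f, S.coord blk τ = p + 1 ∧
      (∀ i ∈ relevantVars f, S.coord blk i = p + 1 → i = τ) ∧
      ∃ b, ∀ z, blockFn f (S.coord blk) p (S.wit p) z = (z τ ^^ b) := by
  obtain ⟨τ, hτ, hcτ⟩ := h.exists_relevant hp
  have huniq : ∀ i ∈ relevantVars f, S.coord blk i = p + 1 → i = τ := fun i hi hci =>
    hinj hi hτ (h.pos_inj _ _ (by rw [State.coord] at hci; omega) (by
      rw [State.coord] at hci hcτ; omega))
  have hdep : ∀ z z' : Fin n → Bool, z τ = z' τ → blockFn f (S.coord blk) p (S.wit p) z =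
      blockFn f (S.coord blk) p (S.wit p) z' := fun z z' hz =>
    eq_of_eqOn_relevantVars f fun i hi => by
      rw [substBlock, substBlock]
      split_ifs with hci
      · rw [huniq i hi hci, hz]
      · rfl
  have hwit : blockFn f (S.coord blk) p (S.wit p) (S.wit p) ≠
      blockFn f (S.coord blk) p (S.wit p) fun _ => false := by
    have : substBlock (S.coord blk) p (S.wit p) (S.wit p) = S.wit p := by
      funext i; simp [substBlock]
    rw [blockFn, this]
    exact h.wit p hp
  refine ⟨τ, hτ, hcτ, huniq, blockFn f (S.coord blk) p (S.wit p) fun _ => false, fun z => ?_⟩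
  have hw : S.wit p τ = true := by
    by_contra hne
    exact hwit (hdep _ _ (by simpa using hne))
  cases hz : z τ
  · rw [hdep z (fun _ => false) hz, Bool.false_xor]
  · rw [hdep z (S.wit p) (hz.trans hw.symm), Bool.true_xor]
    revert hwit
    cases blockFn f (S.coord blk) p (S.wit p) (S.wit p) <;>
      cases blockFn f (S.coord blk) p (S.wit p) fun _ => false <;> simp

theorem always_uniform {P : (Fin n → Bool) → Prop} (h : ∀ x, P x) :
    (Run.uniform n).Always P := Run.always_lift h

theorem always_dictatorRound {g : BoolFn n} {τ : Fin n} {b : Bool} (hg : ∀ z, g z = (z τ ^^ b)) :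
    (dictatorRound g).Always fun _ => True := by
  refine (always_uniform (P := fun _ => True) fun _ => trivial).andThen fun x _ =>
    (always_uniform (P := fun _ => True) fun _ => trivial).andThen fun y _ =>
      (always_uniform (P := fun _ => True) fun _ => trivial).andThen fun z _ => ?_
  rw [if_neg]
  · exact Run.always_ret trivial
  · simp only [violation, shiftDiff, hg]
    cases x τ <;> cases y τ <;> cases z τ <;> cases b <;> decide

theorem State.Sound.always_dictatorTest (h : S.Sound f blk)
    (hinj : Set.InjOn blk (relevantVars f)) :
    (dictatorTest f (S.coord blk) S).Always fun _ => True := by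
  refine Run.always_iter (P := fun _ _ => True) S.num (fun p _ _ hp => ?_) _ (Nat.zero_add _)
    trivial
  obtain ⟨τ, -, -, -, b, hg⟩ := h.exists_dictator hinj hp
  exact Run.always_iter (P := fun _ _ => True) 384 (fun _ _ _ _ => always_dictatorRound hg) _
    (Nat.zero_add _) trivial

/-- The difference does not depend on the random shift, so all readings agree. -/
theorem always_readBit {g : BoolFn n} {τ : Fin n} {b : Bool} (hg : ∀ z, g z = (z τ ^^ b))
    (r : ℕ) (x : Fin n → Bool) : (readBit g r x).Always fun v => v = x τ := by
  have h1 : (readOnce g x).Always fun v => v = x τ :=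
    (always_uniform (P := fun _ => True) fun _ => trivial).andThen fun z _ => Run.always_ret (by
      simp only [shiftDiff, hg]
      cases x τ <;> cases z τ <;> cases b <;> rfl)
  refine h1.andThen fun v hv => ?_
  refine (Run.always_iter (P := fun _ _ => True) r (fun _ _ _ _ => h1.andThen fun v' hv' => ?_) r
    (Nat.zero_add _) trivial).andThen fun _ _ => Run.always_ret hv
  rw [hv, hv', Bool.xor_self]
  exact Run.always_ret trivial

theorem State.Sound.always_readAll (h : S.Sound f blk) (hinj : Set.InjOn blk (relevantVars f))
    (r : ℕ) (x : Fin n → Bool) : (readAll f (S.coord blk) S r x).Always fun y =>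
      f (_root_.restr (S.coord blk) x) = f (expand (S.coord blk) y) := by
  have hn : S.num ≤ n := h.num_le.trans (by simpa using Finset.card_le_univ (relevantVars f))
  refine (Run.always_iter (P := fun p (y : Fin n → Bool) => ∀ i ∈ relevantVars f,
    S.coord blk i ≠ 0 → S.coord blk i ≤ p → ∀ hi : S.coord blk i - 1 < n,
      y ⟨S.coord blk i - 1, hi⟩ = x i) S.num (fun p y hy hp => ?_) _
    (Nat.zero_add _) ?_).mono fun y hy => ?_
  · obtain ⟨τ, -, hcτ, huniq, b, hg⟩ := h.exists_dictator hinj hp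
    refine (always_readBit hg r x).andThen fun v hv => Run.always_ret fun i hi h0 hle hlt => ?_
    simp only
    split_ifs with hip
    · rw [hv, huniq i hi (by omega)]
    · exact hy i hi h0 (by omega) hlt
  · intro i _ h0 h1
    omega
  · refine eq_of_eqOn_relevantVars f fun i hi => ?_
    rw [_root_.restr, expand]
    by_cases h0 : S.coord blk i = 0
    · simp [h0]
    · have hle : S.coord blk i ≤ S.num := h.pos_le _
      have hlt : S.coord blk i - 1 < n := by omega
      rw [dif_pos hlt, hy i hi h0 hle hlt]

/-- The function of the relevant variables that `f` restricted to the found blocks is. -/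
def projected (f : BoolFn n) (c : Fin n → ℕ) : BoolFn n := fun y => f (expand c y)

theorem mem_of_restrict {C : Set (BoolFn n)} (h0 : ClosedUnderZeroProjection C) (hf : f ∈ C)
    (s : Finset (Fin n)) : (fun x => f fun i => if i ∈ s then false else x i) ∈ C := by
  induction s using Finset.induction_on with
  | empty => simpa using hf
  | insert i s hi ih =>
    convert h0 _ ih i using 1
    funext x
    congr 1
    funext j
    by_cases hj : j = i
    · subst hj; simp
    · simp [hj]

/-- Substitute 0 for all variables outside the found blocks, then identify the variables of each
block with its number. The second map is not injective in general, which is why arbitrary variable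
projections are needed. -/
theorem State.Sound.projected_mem (h : S.Sound f blk) {C : Set (BoolFn n)}
    (h0 : ClosedUnderZeroProjection C) (hv : ClosedUnderVariableProjection C) (hf : f ∈ C) :
    projected f (S.coord blk) ∈ C := by
  have hn : S.num ≤ n := h.num_le.trans (by simpa using Finset.card_le_univ (relevantVars f))
  have := hv _ (mem_of_restrict h0 hf (Finset.univ.filter fun i => S.coord blk i = 0))
    fun i => if hi : S.coord blk i - 1 < n then ⟨S.coord blk i - 1, hi⟩ else i
  convert this using 1
  funext y
  refine congrArg f (funext fun i => ?_)
  simp only [Finset.mem_filter, Finset.mem_univ, true_and, expand]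
  by_cases hc : S.coord blk i = 0
  · simp [hc]
  · have hle : S.coord blk i ≤ S.num := h.pos_le _
    have hlt : S.coord blk i - 1 < n := by omega
    simp [hc, hlt]

/-- This is the purpose of restricting the witnesses. A witness vanishing outside the found blocks
agrees, on the relevant variables, with the expansion of a string of block values, and so it shows
that its block number is relevant for the projected function. -/
theorem State.Sound.relevantVars_projected (h : S.Sound f blk) (hval : S.val = S.num)
    (hinj : Set.InjOn blk (relevantVars f)) :
    relevantVars (projected f (S.coord blk)) =
      Finset.univ.filter fun i => firstVars n S.num i = true := by
  have hn : S.num ≤ n := h.num_le.trans (by simpa using Finset.card_le_univ (relevantVars f))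
  have hle : ∀ i, S.coord blk i ≤ S.num := fun i => h.pos_le _
  ext p
  simp only [Finset.mem_filter, Finset.mem_univ, true_and, firstVars, decide_eq_true_eq]
  constructor
  · intro hp
    by_contra hge
    simp only [relevantVars, Finset.mem_filter, Finset.mem_univ, true_and] at hp
    obtain ⟨a, b, hab⟩ := hp
    refine hab (congrArg f (funext fun i => ?_))
    rw [expand, expand]
    by_cases hc : S.coord blk i = 0
    · simp [hc]
    · have := hle i
      have hlt : S.coord blk i - 1 < n := by omega
      rw [dif_pos hlt, dif_pos hlt, Function.update_of_ne]
      intro heq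
      have := congrArg Fin.val heq
      simp only at this
      omega
  · intro hp
    have : Nonempty (Fin n) := ⟨p⟩
    choose! t ht hct huniq _ using fun (q : ℕ) (hq : q < S.num) => h.exists_dictator hinj hq
    -- The string records the values of witness `p` at the relevant variables of the blocks; setting
    -- coordinate `p` to 0 corresponds to clearing the block.
    refine mem_relevantVars (a := fun j : Fin n => S.wit p (t j)) (b := false) ?_
    have hr := h.restr p (by omega)
    have e1 : projected f (S.coord blk) (fun j : Fin n => S.wit p (t j)) = f (S.wit p) := by
      refine eq_of_eqOn_relevantVars f fun i hi => ?_
      rw [expand]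
      by_cases hc : S.coord blk i = 0
      · rw [← hr, _root_.restr]
        simp [hc]
      · have := hle i
        have hlt : S.coord blk i - 1 < n := by omega
        rw [dif_pos hlt]
        simp only [hc, ne_eq, not_false_eq_true, decide_true, Bool.and_true]
        rw [← huniq (S.coord blk i - 1) (by omega) i hi (by omega)]
    have e2 : projected f (S.coord blk)
        (Function.update (fun j : Fin n => S.wit p (t j)) p false) =
        f (substBlock (S.coord blk) p (S.wit p) fun _ => false) := by
      refine eq_of_eqOn_relevantVars f fun i hi => ?_
      rw [expand, substBlock]
      by_cases hc : S.coord blk i = 0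
      · rw [if_neg (by omega), ← hr, _root_.restr]
        simp [hc]
      · have := hle i
        have hlt : S.coord blk i - 1 < n := by omega
        rw [dif_pos hlt]
        simp only [hc, ne_eq, not_false_eq_true, decide_true, Bool.and_true]
        rw [Function.update_apply]
        by_cases hcp : S.coord blk i = p + 1
        · rw [if_pos hcp, if_pos (Fin.ext (by simp only; omega))]
        · rw [if_neg hcp, if_neg fun heq => hcp (by
            have := congrArg Fin.val heq
            simp only at this
            omega)]
          rw [← huniq (S.coord blk i - 1) (by omega) i hi (by omega)]
    rw [e1, e2]
    exact h.wit p hp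

variable {D : PMF (Fin n → Bool)} {L : Finset (Fin n) → List (BoolFn n)} {C : Set (BoolFn n)}

/-- The projection of `f` is itself a candidate, and no correctly labelled example refutes it. -/
theorem State.Sound.always_elimination (h : S.Sound f blk) (hval : S.val = S.num)
    (hinj : Set.InjOn blk (relevantVars f)) (h0 : ClosedUnderZeroProjection C)
    (hv : ClosedUnderVariableProjection C) (hL : IsListing C L) (hf : f ∈ C)
    {src : Run ((Fin n → Bool) × Bool)}
    (hsrc : src.Always fun s => s.2 = projected f (S.coord blk) s.1) :
    (elimination L S.num E src).Always fun _ => True := by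
  have hmem : projected f (S.coord blk) ∈ candidates L S.num :=
    ((hL _).2 _).2 ⟨h.projected_mem h0 hv hf, h.relevantVars_projected hval hinj⟩
  obtain ⟨j, hj, hg⟩ := List.getElem_of_mem hmem
  refine (Run.always_iter (P := fun _ (dead : ℕ → Bool) => dead j = false) _
    (fun i dead hd _ => ?_) _ (Nat.zero_add _) rfl).andThen fun dead hd => ?_
  · refine hsrc.andThen fun s hs => Run.always_ret ?_
    beta_reduce
    rw [hd, Bool.false_or, classAnswer_firstVars, dif_pos hj, hg, hs]
    simp
  · rw [if_pos ⟨j, hj, hd⟩]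
    exact Run.always_ret trivial

theorem always_uniformTester (hblk : ∀ i, blk i < 2 ^ labelBits K)
    (hK : (relevantVars f).card ≤ K) (hinj : Set.InjOn blk (relevantVars f))
    (h0 : ClosedUnderZeroProjection C) (hv : ClosedUnderVariableProjection C)
    (hL : IsListing C L) (hf : f ∈ C) :
    ((State.searchAll f D blk K E).andThen fun S =>
      (dictatorTest f (S.coord blk) S).andThen fun _ =>
        (Run.iter (fun _ _ => consistencyRound f D (S.coord blk) S (readReps K E)) 0
          (32 * E) ()).andThen fun _ =>
            elimination L S.num E (uniformExample f (S.coord blk))).Always fun _ => True := by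
  refine (State.always_searchAll D hblk hK).andThen fun S hS => ?_
  refine (hS.1.always_dictatorTest hinj).andThen fun _ _ => ?_
  refine (Run.always_iter (P := fun _ _ => True) _ (fun _ _ _ _ => ?_) _
    (Nat.zero_add _) trivial).andThen fun _ _ => ?_
  · refine (Run.always_lift (P := fun _ => True) fun _ => trivial).andThen fun x _ =>
      (hS.1.always_readAll hinj _ x).andThen fun y hy => ?_
    rw [hy, Bool.xor_self]
    exact Run.always_ret trivial
  · exact hS.1.always_elimination hS.2 hinj h0 hv hL hf
      ((always_uniform (P := fun _ => True) fun _ => trivial).andThen fun y _ =>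
        Run.always_ret rfl)

theorem always_distributionFreeTester (hblk : ∀ i, blk i < 2 ^ labelBits K)
    (hK : (relevantVars f).card ≤ K) (hinj : Set.InjOn blk (relevantVars f))
    (h0 : ClosedUnderZeroProjection C) (hv : ClosedUnderVariableProjection C)
    (hL : IsListing C L) (hf : f ∈ C) :
    ((State.searchAll f D blk K E).andThen fun S =>
      (dictatorTest f (S.coord blk) S).andThen fun _ =>
        elimination L S.num E (readExample f D (S.coord blk) S (readReps K E))).Always
          fun _ => True := by
  refine (State.always_searchAll D hblk hK).andThen fun S hS => ?_
  refine (hS.1.always_dictatorTest hinj).andThen fun _ _ => ?_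
  exact hS.1.always_elimination hS.2 hinj h0 hv hL hf
    ((Run.always_lift (P := fun _ => True) fun _ => trivial).andThen fun x _ =>
      (hS.1.always_readAll hinj _ x).andThen fun y hy => Run.always_ret hy)

end Acceptance

/-! ## Random partitions separate few variables -/

section Partition

variable {n : ℕ}

theorem always_partition (b : ℕ) : (partition n b).Always fun blk => ∀ i, blk i < 2 ^ b := by
  refine Run.always_iter (P := fun m (blk : Fin n → ℕ) => ∀ i, blk i < 2 ^ m) b
    (fun m blk h _ => ?_) b (Nat.zero_add _) (by simp)
  refine (always_uniform (P := fun _ => True) fun _ => trivial).andThen fun z _ =>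
    Run.always_ret fun i => ?_
  have := h i
  have := Bool.toNat_le (z i)
  rw [pow_succ]
  omega

/-- Averaging over coordinate `i` alone already gives one half, for every value of coordinate `j`.
-/
theorem tsum_uniform_eq_coord {i j : Fin n} (hij : i ≠ j) :
    ∑' z : Fin n → Bool, PMF.uniformOfFintype (Fin n → Bool) z * (if z i = z j then 1 else 0) =
      2⁻¹ := by
  rw [PMF.tsum_uniformOfFintype_mul]
  have h := sum_update_bool i fun z : Fin n → Bool => if z i = z j then (1 : ℝ≥0∞) else 0
  have h2 : ∀ x : Fin n → Bool, ∑ b : Bool, (if (Function.update x i b) i =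
      (Function.update x i b) j then (1 : ℝ≥0∞) else 0) = 1 := fun x => by
    simp only [Function.update_self, Function.update_of_ne hij.symm, Fintype.sum_bool]
    cases x j <;> simp
  rw [Finset.sum_comm, Finset.sum_congr rfl fun x _ => h2 x, Finset.sum_const, Finset.card_univ,
    nsmul_eq_mul, mul_one] at h
  have h3 : ∑ z : Fin n → Bool, (if z i = z j then (1 : ℝ≥0∞) else 0) =
      2⁻¹ * Fintype.card (Fin n → Bool) := by
    rw [h, ← mul_assoc, ENNReal.inv_mul_cancel (by simp) (by simp), one_mul]
  rw [h3, mul_left_comm, ENNReal.inv_mul_cancel (by simp) (ENNReal.natCast_ne_top _), mul_one]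

/-- A round appends a random low-order binary digit to every label, so two labels stay equal only if
all `b` digits agree. -/
theorem cost_partition_pair (c : ℝ≥0∞) (b : ℕ) {i j : Fin n} (hij : i ≠ j) :
    (partition n b).cost c (fun blk => if blk i = blk j then 1 else 0) = 2⁻¹ ^ b := by
  have key : ∀ m s (blk : Fin n → ℕ), (Run.iter (fun _ blk => (Run.uniform n).andThen fun z =>
      Run.ret fun i => blk i + blk i + (z i).toNat) s m blk).cost c
      (fun blk => if blk i = blk j then 1 else 0) = if blk i = blk j then 2⁻¹ ^ m else 0 := by
    intro m
    induction m with
    | zero => intro s blk; rw [Run.iter, Run.cost_ret]; simp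
    | succ m ih =>
      intro s blk
      rw [Run.iter, Run.cost_andThen]
      simp only [ih]
      rw [Run.cost_andThen, Run.uniform, Run.cost_lift]
      simp only [Run.cost_ret]
      have : ∀ z : Fin n → Bool, (if blk i + blk i + (z i).toNat = blk j + blk j + (z j).toNat
          then (2⁻¹ : ℝ≥0∞) ^ m else 0) =
          (if z i = z j then 1 else 0) * if blk i = blk j then 2⁻¹ ^ m else 0 := fun z => by
        have h1 := Bool.toNat_le (z i)
        have h2 := Bool.toNat_le (z j)
        have : (blk i + blk i + (z i).toNat = blk j + blk j + (z j).toNat) ↔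
            (z i = z j ∧ blk i = blk j) := by
          cases z i <;> cases z j <;> simp <;> omega
        simp only [this, ite_and]
        split_ifs <;> simp
      simp only [this, ← mul_assoc]
      rw [ENNReal.tsum_mul_right, tsum_uniform_eq_coord hij]
      split_ifs
      · rw [pow_succ, mul_comm]
      · simp
  rw [partition, key, if_pos rfl]

theorem cost_partition_collision (b : ℕ) (s : Finset (Fin n)) [DecidablePred
    fun blk : Fin n → ℕ => Set.InjOn blk s] :
    (partition n b).cost 0 (fun blk => if Set.InjOn blk s then 0 else 1) ≤
      (s.card * s.card : ℕ) * 2⁻¹ ^ b := by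
  classical
  calc (partition n b).cost 0 (fun blk => if Set.InjOn blk s then 0 else 1)
      ≤ (partition n b).cost 0 (fun blk => ∑ p ∈ s.offDiag, if blk p.1 = blk p.2 then 1 else 0) := by
        refine Run.cost_mono fun blk => ?_
        split_ifs with h
        · exact zero_le
        · simp only [Set.InjOn] at h
          push Not at h
          obtain ⟨i, hi, j, hj, hb, hne⟩ := h
          refine le_trans ?_ (Finset.single_le_sum (fun _ _ => zero_le)
            (Finset.mem_offDiag.2 ⟨hi, hj, hne⟩ : (i, j) ∈ s.offDiag))
          simp [hb]
    _ = ∑ p ∈ s.offDiag, (partition n b).cost 0 (fun blk => if blk p.1 = blk p.2 then 1 else 0) := by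
        unfold Run.cost
        rw [← Summable.tsum_finsetSum fun _ _ => ENNReal.summable]
        congr 1
        funext o
        cases o <;> simp only [Option.elim, Finset.mul_sum, mul_zero, Finset.sum_const_zero]
    _ ≤ ∑ p ∈ s.offDiag, 2⁻¹ ^ b := Finset.sum_le_sum fun p hp =>
        (cost_partition_pair 0 b (Finset.mem_offDiag.1 hp).2.2).le
    _ ≤ (s.card * s.card : ℕ) * 2⁻¹ ^ b := by
        rw [Finset.sum_const, nsmul_eq_mul, Finset.offDiag_card]
        gcongr
        omega

end Partition

/-! ## Completeness -/

section Complete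

variable {n : ℕ} {α : Type}

theorem Run.cost_le {c b : ℝ≥0∞} {p : Run α} {w : α → ℝ≥0∞} (hc : c ≤ b) (hw : ∀ a, w a ≤ b) :
    Run.cost c p w ≤ b := by
  calc Run.cost c p w ≤ ∑' o, p o * b := ENNReal.tsum_le_tsum fun o => by
        cases o
        · exact mul_le_mul_right hc _
        · exact mul_le_mul_right (hw _) _
    _ = b := by rw [ENNReal.tsum_mul_right, PMF.tsum_coe, one_mul]

theorem Run.Always.cost_le {c c' : ℝ≥0∞} {p : Run α} {P : α → Prop} {w w' : α → ℝ≥0∞}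
    (h : p.Always P) (hw : ∀ a, P a → w a ≤ w' a) : p.cost c w ≤ p.cost c' w' := by
  refine ENNReal.tsum_le_tsum fun o => ?_
  by_cases ho : o ∈ p.support
  · obtain ⟨a, rfl, ha⟩ := h o ho
    exact mul_le_mul_right (hw a ha) _
  · rw [PMF.mem_support_iff, not_not] at ho
    simp [ho]

/-- Rejection is charged only to partitions in which two relevant variables collide. There are at
most K² ordered pairs and more than 4K² labels, whence the bound 1/4. -/
theorem cost_partition_andThen_le {f : BoolFn n} {K : ℕ} (hK : (relevantVars f).card ≤ K)
    {g : (Fin n → ℕ) → Run Unit}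
    (hg : ∀ blk, (∀ i, blk i < 2 ^ labelBits K) → Set.InjOn blk (relevantVars f) →
      (g blk).Always fun _ => True) :
    ((partition n (labelBits K)).andThen g).cost 1 (fun _ => 0) ≤ 1 / 4 := by
  classical
  rw [Run.cost_andThen]
  refine ((always_partition _).cost_le (c' := 0)
    (w' := fun blk => if Set.InjOn blk (relevantVars f) then 0 else 1) fun blk hblk => ?_).trans
    ((cost_partition_collision _ _).trans ?_)
  · split_ifs with h
    · rw [(hg blk hblk h).cost_eq_zero]
    · exact Run.cost_le le_rfl fun _ => zero_le
  · have h1 : K < 2 ^ K.size := Nat.lt_size_self K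
    have h2 : (relevantVars f).card * (relevantVars f).card ≤ 2 ^ (K.size + K.size) := by
      rw [pow_add]
      exact Nat.mul_le_mul (by omega) (by omega)
    calc (((relevantVars f).card * (relevantVars f).card : ℕ) : ℝ≥0∞) * 2⁻¹ ^ labelBits K
        ≤ (2 ^ (K.size + K.size) : ℕ) * 2⁻¹ ^ labelBits K := by gcongr
      _ = 1 / 4 := by
        rw [labelBits, pow_add _ _ 2, ← mul_assoc, Nat.cast_pow, ← mul_pow, Nat.cast_ofNat,
          ENNReal.mul_inv_cancel (by simp) (by simp), one_pow, one_mul, ← ENNReal.inv_pow, one_div]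
        norm_num

variable {f : BoolFn n} {D : PMF (Fin n → Bool)} {L : Finset (Fin n) → List (BoolFn n)}
  {C : Set (BoolFn n)} {K E : ℕ}

theorem cost_uniformTester_of_mem (hK : (relevantVars f).card ≤ K)
    (h0 : ClosedUnderZeroProjection C) (hv : ClosedUnderVariableProjection C)
    (hL : IsListing C L) (hf : f ∈ C) :
    (uniformTester f D L K E).cost 1 (fun _ => 0) ≤ 1 / 4 :=
  cost_partition_andThen_le hK fun _ hblk hinj =>
    always_uniformTester hblk hK hinj h0 hv hL hf

theorem cost_distributionFreeTester_of_mem (hK : (relevantVars f).card ≤ K)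
    (h0 : ClosedUnderZeroProjection C) (hv : ClosedUnderVariableProjection C)
    (hL : IsListing C L) (hf : f ∈ C) :
    (distributionFreeTester f D L K E).cost 1 (fun _ => 0) ≤ 1 / 4 :=
  cost_partition_andThen_le hK fun _ hblk hinj =>
    always_distributionFreeTester hblk hK hinj h0 hv hL hf

end Complete

/-! ## Testing that a function is a variable or its negation -/

section DictatorTest

open Finset
open scoped BigOperators

variable {n : ℕ}

/-- The probability that `P` holds at a random string. -/
noncomputable def pr (P : (Fin n → Bool) → Bool) : ℝ := 𝔼 z, if P z then 1 else 0

/-- The sum of two strings. -/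
def xorStr (z x : Fin n → Bool) : Fin n → Bool := fun i => z i ^^ x i

theorem xorStr_comm (z x : Fin n → Bool) : xorStr z x = xorStr x z :=
  funext fun _ => Bool.xor_comm _ _

theorem xorStr_assoc (x y z : Fin n → Bool) : xorStr (xorStr x y) z = xorStr x (xorStr y z) :=
  funext fun _ => Bool.xor_assoc _ _ _

theorem xorStr_self_right (x y : Fin n → Bool) : xorStr (xorStr x y) y = x :=
  funext fun i => by simp [xorStr]

theorem expect_xorStr (w : (Fin n → Bool) → ℝ) (y : Fin n → Bool) :
    𝔼 z, w (xorStr z y) = 𝔼 z, w z :=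
  Fintype.expect_equiv (Function.Involutive.toPerm (fun z => xorStr z y) fun z =>
    xorStr_self_right z y) _ _ fun _ => rfl

theorem pr_xorStr (P : (Fin n → Bool) → Bool) (y : Fin n → Bool) :
    pr (fun z => P (xorStr z y)) = pr P := expect_xorStr (fun z => if P z then 1 else 0) y

theorem pr_mono {P Q : (Fin n → Bool) → Bool} (h : ∀ z, P z = true → Q z = true) :
    pr P ≤ pr Q := expect_le_expect fun z _ => by
  have := h z
  cases hP : P z
  · cases Q z <;> simp
  · simp [this hP]

theorem pr_or_le (P Q : (Fin n → Bool) → Bool) : pr (fun z => P z || Q z) ≤ pr P + pr Q := by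
  unfold pr
  rw [← expect_add_distrib]
  refine expect_le_expect fun z _ => ?_
  beta_reduce
  cases P z <;> cases Q z <;> simp

theorem pr_le_add {P Q R : (Fin n → Bool) → Bool}
    (h : ∀ z, P z = true → Q z = true ∨ R z = true) : pr P ≤ pr Q + pr R :=
  (pr_mono fun z hz => by simpa using h z hz).trans (pr_or_le Q R)

theorem pr_true : pr (fun _ : Fin n → Bool => true) = 1 := by
  simp only [pr, if_true]
  exact Fintype.expect_const _

theorem pr_nonneg (P : (Fin n → Bool) → Bool) : 0 ≤ pr P :=
  expect_nonneg fun z _ => by split_ifs <;> simp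

theorem pr_not (P : (Fin n → Bool) → Bool) : pr (fun z => !P z) = 1 - pr P := by
  rw [← pr_true (n := n)]
  unfold pr
  rw [← expect_sub_distrib]
  refine expect_congr rfl fun z _ => ?_
  beta_reduce
  cases P z <;> simp

theorem exists_of_pr_lt_one {P : (Fin n → Bool) → Bool} (h : pr P < 1) : ∃ z, P z = false := by
  by_contra! hne
  have : P = fun _ => true := funext fun z => by simpa using hne z
  rw [this, pr_true] at h
  exact lt_irrefl _ h

variable {g : BoolFn n}

theorem shiftDiff_eq (g : BoolFn n) (z x : Fin n → Bool) :
    shiftDiff g z x = (g (xorStr z x) ^^ g z) := rfl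

/-- The probability of a violation. -/
noncomputable def violationPr (g : BoolFn n) : ℝ := 𝔼 x, 𝔼 y, pr (violation g x y)

/-- The value that `shiftDiff g z x` has for most `z`. -/
noncomputable def majority (g : BoolFn n) (x : Fin n → Bool) : Bool :=
  decide (1 / 2 < pr fun z => shiftDiff g z x)

theorem expect_pr_linear_le (g : BoolFn n) :
    𝔼 x, pr (fun z => shiftDiff g z x ^^ (g x ^^ g fun _ => false)) ≤ violationPr g := by
  refine expect_le_expect fun x _ => le_expect univ_nonempty fun y _ => pr_mono fun z hz => ?_
  rw [violation, hz, Bool.true_or]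

/-- With z' = u + z the sum of the differences at z and z' in direction x equals the sum of the
differences in direction u at z and z + x. Both are usually g(u) + g(0), by the first identity of
the test, and then they cancel. -/
theorem expect_pr_shiftDiff_ne_le (g : BoolFn n) (x : Fin n → Bool) :
    𝔼 z, pr (fun z' => shiftDiff g z x ^^ shiftDiff g z' x) ≤ 2 * violationPr g := by
  have h1 := expect_pr_linear_le g
  set h : (Fin n → Bool) → Bool := fun u => g u ^^ g fun _ => false with hh
  have h2 : 𝔼 z, pr (fun u => shiftDiff g z u ^^ h u) ≤ violationPr g := by
    refine le_trans (le_of_eq ?_) h1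
    unfold pr
    rw [expect_comm]
  have h3 : 𝔼 z, pr (fun u => shiftDiff g (xorStr z x) u ^^ h u) ≤ violationPr g :=
    (expect_xorStr (fun z => pr fun u => shiftDiff g z u ^^ h u) x).trans_le h2
  rw [two_mul]
  refine le_trans ?_ (add_le_add h2 h3)
  rw [← expect_add_distrib]
  refine expect_le_expect fun z _ => ?_
  rw [← pr_xorStr _ z]
  refine pr_le_add fun u hu => ?_
  have e : xorStr (xorStr u z) x = xorStr (xorStr z x) u := by
    funext i; simp only [xorStr]; cases u i <;> cases z i <;> cases x i <;> rfl
  rw [shiftDiff_eq, shiftDiff_eq, e, xorStr_comm u z] at hu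
  simp only [shiftDiff_eq]
  revert hu
  generalize g (xorStr z x) = a
  generalize g z = b
  generalize g (xorStr (xorStr z x) u) = c
  generalize g (xorStr z u) = d
  generalize h u = e
  cases a <;> cases b <;> cases c <;> cases d <;> cases e <;> decide

/-- Two independent copies of a bit that is 1 with probability a differ with probability 2a(1 - a).
-/
theorem expect_pr_xor (P : (Fin n → Bool) → Bool) :
    𝔼 z, pr (fun z' => P z ^^ P z') = 2 * pr P * (1 - pr P) := by
  have h : ∀ z, pr (fun z' => P z ^^ P z') =
      (if P z then 1 else 0) * (1 - 2 * pr P) + pr P := fun z => by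
    cases P z
    · simp
    · simp only [Bool.true_xor, pr_not, if_true]
      ring
  simp only [h]
  rw [expect_add_distrib, ← expect_mul, Fintype.expect_const]
  change pr P * _ + _ = _
  ring

/-- If m ≤ 1/2 is the probability of the minority value, then two samples differ with probability
2m(1 - m) ≥ m. -/
theorem pr_shiftDiff_ne_majority_le (g : BoolFn n) (x : Fin n → Bool) :
    pr (fun z => shiftDiff g z x ^^ majority g x) ≤ 2 * violationPr g := by
  have h := (expect_pr_xor fun z => shiftDiff g z x).symm.trans_le (expect_pr_shiftDiff_ne_le g x)
  rw [majority]
  by_cases hx : 1 / 2 < pr fun z => shiftDiff g z x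
  · rw [decide_eq_true hx]
    simp only [Bool.xor_true, pr_not]
    set a := pr fun z => shiftDiff g z x
    have : 0 ≤ 1 - a := by
      rw [← pr_not]
      exact pr_nonneg _
    nlinarith
  · rw [decide_eq_false hx]
    simp only [Bool.xor_false]
    have := pr_nonneg fun z => shiftDiff g z x
    nlinarith

/-- The three exceptional events together have probability below 1, so some z makes all three
differences equal to their majority values. At this z they telescope. -/
theorem majority_xorStr (hg : violationPr g < 1 / 48) (x y : Fin n → Bool) :
    majority g (xorStr x y) = (majority g x ^^ majority g y) := by
  have h1 := pr_shiftDiff_ne_majority_le g x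
  have h2 := pr_shiftDiff_ne_majority_le g y
  have h3 := pr_shiftDiff_ne_majority_le g (xorStr x y)
  have h4 : pr (fun z => shiftDiff g (xorStr z x) y ^^ majority g y) ≤ 2 * violationPr g :=
    (pr_xorStr (fun z => shiftDiff g z y ^^ majority g y) x).trans_le h2
  obtain ⟨z, hz⟩ := exists_of_pr_lt_one ((pr_or_le _ _).trans_lt
    (lt_of_le_of_lt (add_le_add ((pr_or_le _ _).trans (add_le_add h1 h4)) h3) (by linarith)))
  simp only [shiftDiff_eq, Bool.or_eq_false_iff, xorStr_assoc] at hz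
  obtain ⟨⟨hx, hy⟩, hxy⟩ := hz
  revert hx hy hxy
  generalize g (xorStr z x) = a
  generalize g z = b
  generalize g (xorStr z (xorStr x y)) = c
  generalize majority g x = d
  generalize majority g y = e
  generalize majority g (xorStr x y) = i
  cases a <;> cases b <;> cases c <;> cases d <;> cases e <;> cases i <;> decide

/-- The meet of two strings. -/
def andStr (x y : Fin n → Bool) : Fin n → Bool := fun i => x i && y i

/-- By additivity the defect B of multiplicativity is a symmetric bilinear form over the two-element
field. If it is not zero then it is 1 on at least a quarter of all pairs, whereas the test bounds
the density by 7 times the violation probability, which is below 7/48. -/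
theorem majority_andStr (hg : violationPr g < 1 / 48) (x y : Fin n → Bool) :
    majority g (andStr x y) = (majority g x && majority g y) := by
  set φ := majority g with hφ
  have hadd := majority_xorStr hg
  set B : (Fin n → Bool) → (Fin n → Bool) → Bool := fun x y => φ (andStr x y) ^^ (φ x && φ y)
    with hB
  have hBx : ∀ x x' y, B (xorStr x x') y = (B x y ^^ B x' y) := fun x x' y => by
    have e : andStr (xorStr x x') y = xorStr (andStr x y) (andStr x' y) := by
      funext i; simp only [andStr, xorStr]; cases x i <;> cases x' i <;> cases y i <;> rfl
    simp only [hB, e, hφ, hadd]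
    generalize majority g (andStr x y) = a
    generalize majority g (andStr x' y) = b
    generalize majority g x = c
    generalize majority g x' = d
    generalize majority g y = e
    cases a <;> cases b <;> cases c <;> cases d <;> cases e <;> rfl
  have hBs : ∀ x y, B x y = B y x := fun x y => by
    have : andStr x y = andStr y x := funext fun i => Bool.and_comm _ _
    simp only [hB, this, Bool.and_comm]
  have hBy : ∀ x y y', B x (xorStr y y') = (B x y ^^ B x y') := fun x y y' => by
    rw [hBs, hBx, hBs y, hBs y']
  -- If B x y = 1 then every z gives a violation or one of three minority values. So the violations
  -- at (x, y) and three terms of size 2 * violationPr g add up to at least 1.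
  have hsmall : 𝔼 x, pr (B x) ≤ 7 * violationPr g := by
    have h1 : ∀ x y, (if B x y then (1 : ℝ) else 0) ≤
        pr (violation g x y) + 6 * violationPr g := fun x y => by
      have h1 := pr_shiftDiff_ne_majority_le g x
      have h2 := pr_shiftDiff_ne_majority_le g y
      have h3 := pr_shiftDiff_ne_majority_le g (andStr x y)
      have h4 := pr_nonneg (violation g x y)
      have h0 := (pr_nonneg _).trans h1
      cases hb : B x y
      · simp only [Bool.false_eq_true, if_false]
        linarith
      · simp only [if_true]
        by_contra hlt
        obtain ⟨z, hz⟩ := exists_of_pr_lt_one ((pr_or_le _ _).trans_lt (lt_of_le_of_lt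
          (add_le_add ((pr_or_le _ _).trans (add_le_add ((pr_or_le (violation g x y) _).trans
            (add_le_add le_rfl h1)) h2)) h3) (by linarith)))
        simp only [violation, Bool.or_eq_false_iff] at hz
        obtain ⟨⟨⟨⟨-, hv, -⟩, hx⟩, hy⟩, hxy⟩ := hz
        change (shiftDiff g z (andStr x y) ^^ _) = false at hv
        revert hv hx hy hxy hb
        simp only [hB, hφ]
        generalize shiftDiff g z (andStr x y) = a
        generalize shiftDiff g z x = b
        generalize shiftDiff g z y = c
        generalize majority g x = d
        generalize majority g y = e
        generalize majority g (andStr x y) = i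
        cases a <;> cases b <;> cases c <;> cases d <;> cases e <;> cases i <;> decide
    calc 𝔼 x, pr (B x) ≤ 𝔼 x, 𝔼 y, (pr (violation g x y) + 6 * violationPr g) :=
          expect_le_expect fun x _ => expect_le_expect fun y _ => h1 x y
      _ = 7 * violationPr g := by
          simp only [expect_add_distrib, Fintype.expect_const]
          rw [← violationPr]
          ring
  by_contra hne
  have hxy : B x y = true := by
    revert hne
    simp only [hB]
    cases φ (andStr x y) <;> cases φ x <;> cases φ y <;> simp
  -- The values of B at (u, v), (u, v + y), (u + x, v) and (u + x, v + y) add up to B x y = 1, so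
  -- one of the four is 1.
  have h1 : ∀ u, 1 ≤ 2 * (pr (B u) + pr (B (xorStr u x))) := fun u => by
    have : pr (fun _ : Fin n → Bool => true) ≤
        (pr (B u) + pr (fun v => B u (xorStr v y))) +
        (pr (B (xorStr u x)) + pr (fun v => B (xorStr u x) (xorStr v y))) := by
      refine le_trans (pr_mono fun v _ => ?_) ((pr_or_le _ _).trans
        (add_le_add (pr_or_le _ _) (pr_or_le _ _)))
      simp only [hBx, hBy, hxy]
      cases B u v <;> cases B u y <;> cases B x v <;> rfl
    rw [pr_true, pr_xorStr (B u), pr_xorStr (B (xorStr u x))] at this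
    linarith
  have h2 : (1 : ℝ) ≤ 𝔼 u : Fin n → Bool, 2 * (pr (B u) + pr (B (xorStr u x))) :=
    le_expect univ_nonempty fun u _ => h1 u
  rw [← mul_expect, expect_add_distrib, expect_xorStr (fun u => pr (B u))] at h2
  linarith

/-- The all-ones string has value 1 and is the sum of the unit strings, so by additivity some unit
string has value 1. Multiplying `x` by that string leaves either zero or the unit string, according
to the bit of `x` there. -/
theorem exists_majority_eq (hg : violationPr g < 1 / 48) : ∃ τ, ∀ x, majority g x = x τ := by
  have hadd := majority_xorStr hg
  have hone : majority g (fun _ => true) = true := by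
    have h1 := pr_shiftDiff_ne_majority_le g fun _ => true
    have h2 : pr (fun z => !shiftDiff g z fun _ => true) ≤ violationPr g :=
      le_expect univ_nonempty fun x _ => le_expect univ_nonempty fun y _ => pr_mono fun z hz => by
        rw [violation, hz]
        simp
    obtain ⟨z, hz⟩ := exists_of_pr_lt_one ((pr_or_le _ _).trans_lt
      (lt_of_le_of_lt (add_le_add h1 h2) (by linarith)))
    revert hz
    generalize shiftDiff g z (fun _ => true) = a
    generalize majority g (fun _ => true) = b
    cases a <;> cases b <;> decide
  have hzero : majority g (fun _ => false) = false := by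
    have h := hadd (fun _ => false) fun _ => false
    rw [Bool.xor_self] at h
    exact h
  obtain ⟨τ, hτ⟩ : ∃ τ, majority g (fun i => decide (i = τ)) = true := by
    by_contra! hne
    have key : ∀ s : Finset (Fin n), majority g (fun i => decide (i ∈ s)) = false := fun s => by
      induction s using Finset.induction_on with
      | empty => simpa using hzero
      | insert i s hi ih =>
        have : (fun j => decide (j ∈ insert i s)) =
            xorStr (fun j => decide (j = i)) fun j => decide (j ∈ s) := funext fun j => by
          simp only [mem_insert, xorStr]
          by_cases hj : j = i
          · subst hj; simp [hi]
          · simp [hj]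
        rw [this, hadd, ih]
        simpa using hne i
    have := key univ
    simp only [mem_univ, decide_true, hone] at this
    cases this
  refine ⟨τ, fun x => ?_⟩
  have h := majority_andStr hg x fun i => decide (i = τ)
  rw [hτ, Bool.and_true] at h
  rw [← h]
  cases hx : x τ
  · rw [← hzero]
    congr 1
    funext i
    by_cases hi : i = τ <;> simp [andStr, hi, hx]
  · rw [← hτ]
    congr 1
    funext i
    by_cases hi : i = τ <;> simp [andStr, hi, hx]

/-- If violations are rare then `shiftDiff g z x` is mostly the value of some variable at `x`. -/
theorem exists_pr_shiftDiff_ne_le (hg : violationPr g < 1 / 48) :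
    ∃ τ, ∀ x, pr (fun z => shiftDiff g z x ^^ x τ) ≤ 1 / 24 := by
  obtain ⟨τ, hτ⟩ := exists_majority_eq hg
  refine ⟨τ, fun x => ?_⟩
  have := pr_shiftDiff_ne_majority_le g x
  rw [hτ] at this
  linarith

end DictatorTest

/-! ## Bounds for expected costs -/

namespace Run

variable {α β : Type}

/-- The results of the computation, if it does not reject, have property `P`. -/
def Ensures (p : Run α) (P : α → Prop) : Prop := ∀ a, some a ∈ p.support → P a

theorem ensures_ret {a : α} {P : α → Prop} (h : P a) : Ensures (ret a) P := fun b hb => by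
  rw [ret, PMF.mem_support_pure_iff] at hb
  rwa [Option.some.inj hb]

theorem ensures_fail {P : α → Prop} : Ensures fail P := fun b hb => by
  rw [fail, PMF.mem_support_pure_iff] at hb
  cases hb

theorem ensures_true (p : Run α) : Ensures p fun _ => True := fun _ _ => trivial

theorem Ensures.andThen {p : Run α} {g : α → Run β} {P : α → Prop} {P' : β → Prop}
    (h : Ensures p P) (hg : ∀ a, P a → Ensures (g a) P') : Ensures (p.andThen g) P' := fun b hb => by
  rw [Run.andThen, PMF.mem_support_bind_iff] at hb
  obtain ⟨o, ho, hb⟩ := hb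
  cases o with
  | none =>
    rw [Option.elim, PMF.mem_support_pure_iff] at hb
    cases hb
  | some a => exact hg a (h a ho) b hb

theorem ensures_iter {F : ℕ → α → Run α} {P : α → Prop} (hF : ∀ i a, P a → Ensures (F i a) P)
    (l : ℕ) {i : ℕ} {a : α} (h : P a) : Ensures (iter F i l a) P := by
  induction l generalizing i a with
  | zero => exact ensures_ret h
  | succ l ih => exact (hF i a h).andThen fun a' ha' => ih ha'

theorem Ensures.cost_le {p : Run α} {P : α → Prop} {w w' : α → ℝ≥0∞} (h : Ensures p P)
    (hw : ∀ a, P a → w a ≤ w' a) : cost 0 p w ≤ cost 0 p w' := by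
  refine ENNReal.tsum_le_tsum fun o => ?_
  cases o with
  | none => simp
  | some a =>
    by_cases ho : some a ∈ p.support
    · exact mul_le_mul_right (hw a (h a ho)) _
    · rw [PMF.mem_support_iff, not_not] at ho
      simp [ho]

theorem cost_add (p : Run α) (w w' : α → ℝ≥0∞) :
    cost 0 p (fun a => w a + w' a) = cost 0 p w + cost 0 p w' := by
  unfold cost
  rw [← ENNReal.tsum_add]
  congr 1
  funext o
  cases o <;> simp [mul_add]

theorem cost_sum {ι : Type*} (p : Run α) (s : Finset ι) (w : ι → α → ℝ≥0∞) :
    cost 0 p (fun a => ∑ j ∈ s, w j a) = ∑ j ∈ s, cost 0 p (w j) := by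
  unfold cost
  rw [← Summable.tsum_finsetSum fun _ _ => ENNReal.summable]
  congr 1
  funext o
  cases o <;> simp only [Option.elim, Finset.mul_sum, mul_zero, Finset.sum_const_zero]

theorem cost_mul (p : Run α) (c : ℝ≥0∞) (w : α → ℝ≥0∞) :
    cost 0 p (fun a => c * w a) = c * cost 0 p w := by
  unfold cost
  rw [← ENNReal.tsum_mul_left]
  congr 1
  funext o
  cases o <;> simp [mul_left_comm]

theorem cost_le_add {p : Run α} {w w' : α → ℝ≥0∞} {b : ℝ≥0∞} (h : ∀ a, w a ≤ w' a + b) :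
    cost 0 p w ≤ cost 0 p w' + b := by
  refine (cost_mono h).trans ?_
  rw [cost_add]
  gcongr
  exact cost_le zero_le fun _ => le_rfl

/-- A union bound over rounds: W is a potential whose expectation grows by at most ρ in a round. -/
theorem cost_iter_le_add {F : ℕ → α → Run α} {W : ℕ → α → ℝ≥0∞} {ρ : ℝ≥0∞} (m : ℕ)
    (hF : ∀ i a, i < m → cost 0 (F i a) (W (i + 1)) ≤ W i a + ρ) (l : ℕ) {i : ℕ} (hi : i + l = m)
    (a : α) : cost 0 (iter F i l a) (W m) ≤ W i a + l * ρ := by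
  induction l generalizing i a with
  | zero =>
    rw [← hi, iter, cost_ret]
    simp
  | succ l ih =>
    rw [iter, cost_andThen]
    calc _ ≤ cost 0 (F i a) (W (i + 1)) + l * ρ := cost_le_add fun a' => ih (by omega) a'
      _ ≤ W i a + ρ + l * ρ := by
        gcongr
        exact hF i a (by omega)
      _ = _ := by push_cast; ring

theorem cost_iter_le_mul {F : ℕ → α → Run α} {W : α → ℝ≥0∞} {ρ : ℝ≥0∞}
    (hF : ∀ i a, cost 0 (F i a) W ≤ ρ * W a) (l i : ℕ) (a : α) :
    cost 0 (iter F i l a) W ≤ ρ ^ l * W a := by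
  induction l generalizing i a with
  | zero =>
    rw [iter, cost_ret]
    simp
  | succ l ih =>
    rw [iter, cost_andThen]
    calc _ ≤ cost 0 (F i a) (fun a' => ρ ^ l * W a') := cost_mono fun a' => ih _ a'
      _ ≤ ρ ^ l * (ρ * W a) := by
        rw [cost_mul]
        gcongr
        exact hF i a
      _ = _ := by rw [pow_succ, mul_assoc]

theorem cost_iter_le_pow {F : ℕ → Unit → Run Unit} {ρ : ℝ≥0∞}
    (hF : ∀ i, cost 0 (F i ()) (fun _ => 1) ≤ ρ) (l i : ℕ) :
    cost 0 (iter F i l ()) (fun _ => 1) ≤ ρ ^ l := by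
  simpa using cost_iter_le_mul (W := fun _ => 1) (fun i _ => by simpa using hF i) l i ()

theorem cost_andThen_le {p : Run α} {g : α → Run β} {w : β → ℝ≥0∞} {b : ℝ≥0∞}
    (h : ∀ a, cost 0 (g a) w ≤ b) : cost 0 (p.andThen g) w ≤ b := by
  rw [cost_andThen]
  exact cost_le zero_le h

theorem cost_andThen_le_left {p : Run α} {g : α → Run β} :
    cost 0 (p.andThen g) (fun _ => 1) ≤ cost 0 p fun _ => 1 := by
  rw [cost_andThen]
  exact cost_mono fun _ => cost_le zero_le fun _ => le_rfl

end Run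

/-- From (1 - 1/t)^t ≤ 1/e ≤ 1/2. The hypothesis is stated as a sum to avoid truncated subtraction.
-/
theorem ENNReal.pow_le_of_add_inv_le {ρ : ℝ≥0∞} {t : ℕ} (ht : t ≠ 0)
    (h : ρ + (t : ℝ≥0∞)⁻¹ ≤ 1) (l : ℕ) : ρ ^ (t * l) ≤ 2⁻¹ ^ l := by
  rw [pow_mul]
  gcongr
  have hρ : ρ ≠ ⊤ := fun hρ => by simp [hρ] at h
  have hi : (t : ℝ≥0∞)⁻¹ ≠ ⊤ := by simpa using ht
  have h1 : ρ.toReal ≤ 1 - 1 / t := by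
    have := ENNReal.toReal_mono ENNReal.one_ne_top h
    rw [ENNReal.toReal_add hρ hi, ENNReal.toReal_inv, ENNReal.toReal_natCast,
      ENNReal.toReal_one] at this
    rw [one_div]
    linarith
  have h2 : ρ.toReal ^ t ≤ 2⁻¹ := by
    refine (pow_le_pow_left₀ ENNReal.toReal_nonneg h1 t).trans
      ((Real.one_sub_div_pow_le_exp_neg (by exact_mod_cast Nat.one_le_iff_ne_zero.2 ht)).trans ?_)
    rw [Real.exp_neg]
    exact inv_anti₀ (by norm_num) Real.exp_one_gt_two.le
  rw [← ENNReal.toReal_le_toReal (ENNReal.pow_ne_top hρ) (by simp), ENNReal.toReal_pow]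
  simpa using h2

/-! ## Probabilities -/

section Mass

open Finset
open scoped BigOperators

variable {n : ℕ} {D : PMF (Fin n → Bool)}

/-- The probability of `P` under the distribution `D`. -/
noncomputable def mass (D : PMF (Fin n → Bool)) (P : (Fin n → Bool) → Bool) : ℝ≥0∞ :=
  ∑' x, D x * if P x then 1 else 0

theorem mass_le_add {P Q R : (Fin n → Bool) → Bool}
    (h : ∀ z, P z = true → Q z = true ∨ R z = true) : mass D P ≤ mass D Q + mass D R := by
  unfold mass
  rw [← ENNReal.tsum_add]
  refine ENNReal.tsum_le_tsum fun z => ?_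
  rw [← mul_add]
  gcongr
  have := h z
  revert this
  cases P z <;> cases Q z <;> cases R z <;> simp

theorem mass_add_mass_not (P : (Fin n → Bool) → Bool) :
    mass D P + mass D (fun z => !P z) = 1 := by
  unfold mass
  rw [← ENNReal.tsum_add]
  refine Eq.trans ?_ D.tsum_coe
  congr 1
  funext z
  beta_reduce
  cases P z <;> simp

theorem prob_eq_toReal_mass (P : (Fin n → Bool) → Bool) :
    prob D {x | P x = true} = (mass D P).toReal := by
  rw [prob, mass, PMF.toOuterMeasure_apply]
  congr 2
  funext x
  by_cases h : P x = true <;> simp [Set.indicator, h]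

theorem tsum_uniformOfFintype_mul_ofReal {w : (Fin n → Bool) → ℝ} (hw : ∀ x, 0 ≤ w x) :
    ∑' x, PMF.uniformOfFintype (Fin n → Bool) x * ENNReal.ofReal (w x) =
      ENNReal.ofReal (𝔼 x, w x) := by
  rw [PMF.tsum_uniformOfFintype_mul, Fintype.expect_eq_sum_div_card, div_eq_inv_mul,
    ENNReal.ofReal_mul (by positivity), ENNReal.ofReal_sum_of_nonneg fun x _ => hw x,
    ENNReal.ofReal_inv_of_pos (by exact_mod_cast Fintype.card_pos), ENNReal.ofReal_natCast]

theorem mass_uniformOfFintype (P : (Fin n → Bool) → Bool) :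
    mass (PMF.uniformOfFintype (Fin n → Bool)) P = ENNReal.ofReal (pr P) := by
  rw [pr, ← tsum_uniformOfFintype_mul_ofReal fun x => by split_ifs <;> simp, mass]
  congr 1
  funext x
  cases P x <;> simp

theorem Run.cost_uniform (P : (Fin n → Bool) → Bool) :
    (Run.uniform n).cost 0 (fun z => if P z then 1 else 0) = ENNReal.ofReal (pr P) := by
  rw [Run.uniform, Run.cost_lift, ← mass_uniformOfFintype, mass]

variable {g : BoolFn n} {x : Fin n → Bool} {b : Bool}

theorem cost_dictatorRound_add (g : BoolFn n) :
    (dictatorRound g).cost 0 (fun _ => 1) + ENNReal.ofReal (violationPr g) = 1 := by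
  have h : (dictatorRound g).cost 0 (fun _ => 1) = ENNReal.ofReal (1 - violationPr g) := by
    have h1 : ∀ x y, (Run.uniform n).cost 0 (fun z => Run.cost 0
        (if violation g x y z then Run.fail else Run.ret ()) fun _ => 1) =
        ENNReal.ofReal (1 - pr (violation g x y)) := fun x y => by
      rw [← pr_not, ← Run.cost_uniform]
      congr 1
      funext z
      cases violation g x y z
      · exact Run.cost_ret _ _ _
      · exact Run.cost_fail _ _
    have h0 : ∀ x y, 0 ≤ 1 - pr (violation g x y) := fun x y => by
      rw [← pr_not]
      exact pr_nonneg _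
    simp only [dictatorRound, Run.cost_andThen, h1]
    rw [Run.uniform, Run.cost_lift]
    simp only [Run.cost_lift]
    simp only [tsum_uniformOfFintype_mul_ofReal (h0 _)]
    rw [tsum_uniformOfFintype_mul_ofReal fun x => expect_nonneg fun y _ => h0 x y]
    simp only [expect_sub_distrib, Fintype.expect_const]
    rfl
  have h0 : violationPr g ≤ 1 := by
    refine expect_le univ_nonempty fun x _ => expect_le univ_nonempty fun y _ => ?_
    rw [← pr_true (n := n)]
    exact pr_mono fun _ _ => rfl
  have h1 : 0 ≤ violationPr g := expect_nonneg fun x _ => expect_nonneg fun y _ => pr_nonneg _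
  rw [h, ← ENNReal.ofReal_add (by linarith) h1, sub_add_cancel, ENNReal.ofReal_one]

/-- If the first reading is right there is no error. If it is wrong, survival requires every
repetition to be wrong as well, which happens with probability at most 1/24 ≤ 1/2 each time. -/
theorem cost_readBit_ne_le (h : pr (fun z => shiftDiff g z x ^^ b) ≤ 1 / 24) (r : ℕ) :
    (readBit g r x).cost 0 (fun v => if v ^^ b then 1 else 0) ≤ 2⁻¹ ^ r := by
  have h1 : (readOnce g x).cost 0 (fun v => if v ^^ b then 1 else 0) ≤ 2⁻¹ := by
    rw [readOnce, Run.cost_andThen]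
    simp only [Run.cost_ret]
    rw [Run.cost_uniform fun z => shiftDiff g z x ^^ b]
    refine (ENNReal.ofReal_le_ofReal (h.trans (by norm_num : (1 : ℝ) / 24 ≤ 2⁻¹))).trans ?_
    rw [ENNReal.ofReal_inv_of_pos two_pos]
    simp
  refine Run.cost_andThen_le fun v => ?_
  rw [Run.cost_andThen]
  simp only [Run.cost_ret]
  cases hv : v ^^ b
  · exact Run.cost_le zero_le (by simp)
  · simp only [if_true]
    refine Run.cost_iter_le_pow (fun _ => ?_) _ _
    rw [Run.cost_andThen]
    refine (Run.cost_mono fun v' => ?_).trans h1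
    revert hv
    cases v' <;> cases v <;> cases b <;> simp [Run.cost_ret, Run.cost_fail]

/-- The first `q` coordinates of `x`. -/
def truncate (q : ℕ) (x : Fin n → Bool) : Fin n → Bool := fun i => x i && decide ((i : ℕ) < q)

/-- The potential indicates that the part read so far is not the correct prefix; each block adds one
reading error. The comparison is with a truncation since positions beyond the found blocks keep
their initial 0. -/
theorem cost_readAll_ne_le {f : BoolFn n} {c : Fin n → ℕ} {S : State n} {x y : Fin n → Bool}
    (hn : S.num ≤ n)
    (h : ∀ p : Fin n, (p : ℕ) < S.num →
      pr (fun z => shiftDiff (blockFn f c p (S.wit p)) z x ^^ y p) ≤ 1 / 24) (r : ℕ) :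
    (readAll f c S r x).cost 0 (fun y' => if y' = truncate S.num y then 0 else 1) ≤
      S.num * 2⁻¹ ^ r := by
  have h0 : (fun _ => false) = truncate 0 y := by funext i; simp [truncate]
  have := Run.cost_iter_le_add (W := fun p y' => if y' = truncate p y then (0 : ℝ≥0∞) else 1)
    (F := fun p y => (readBit (blockFn f c p (S.wit p)) r x).andThen fun v =>
      Run.ret fun i : Fin n => if (i : ℕ) = p then v else y i) (ρ := 2⁻¹ ^ r) S.num
    (fun p y' hp => ?_) S.num (i := 0) (Nat.zero_add _) fun _ => false
  · rw [if_pos h0, zero_add] at this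
    exact this
  · by_cases hy' : y' = truncate p y
    · rw [if_pos hy', zero_add, Run.cost_andThen]
      refine le_trans (Run.cost_mono fun v => ?_)
        (cost_readBit_ne_le (b := y ⟨p, by omega⟩) (h ⟨p, by omega⟩ hp) r)
      rw [Run.cost_ret]
      cases hv : v ^^ y ⟨p, by omega⟩
      · rw [if_pos]
        · simp
        · funext i
          subst hy'
          simp only [truncate]
          by_cases hi : (i : ℕ) = p
          · subst hi
            revert hv
            cases v <;> cases y i <;> simp
          · rw [if_neg hi]
            congr 1
            rw [decide_eq_decide]
            omega
      · rw [if_pos rfl]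
        split_ifs <;> simp
    · rw [if_neg hy']
      refine (Run.cost_le zero_le fun a => ?_).trans le_self_add
      split_ifs <;> simp

end Mass

/-! ## Soundness of the search -/

section SearchSound

variable {n : ℕ} {f : BoolFn n} {D : PMF (Fin n → Bool)} {blk : Fin n → ℕ} {K E : ℕ} {S : State n}

/-- The error unit `1 / (8 E)`. -/
noncomputable def unitError (E : ℕ) : ℝ≥0∞ := ((8 * E : ℕ) : ℝ≥0∞)⁻¹

theorem two_mul_unitError (E : ℕ) : 2 * unitError E = ((4 * E : ℕ) : ℝ≥0∞)⁻¹ := by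
  have h : ((8 * E : ℕ) : ℝ≥0∞) = 2 * (4 * E : ℕ) := by push_cast; ring
  rw [unitError, h, ENNReal.mul_inv (by simp) (by simp), ← mul_assoc,
    ENNReal.mul_inv_cancel (by simp) (by simp), one_mul]

theorem eight_mul_unitError (E : ℕ) : 8 * unitError E = (E : ℝ≥0∞)⁻¹ := by
  rw [unitError, Nat.cast_mul, ENNReal.mul_inv (by simp) (by simp), ← mul_assoc]
  norm_num [ENNReal.mul_inv_cancel]

/-- The probability that `f` and its restriction to the coordinates with `c i ≠ 0` differ. -/
noncomputable def restrError (f : BoolFn n) (D : PMF (Fin n → Bool)) (c : Fin n → ℕ) : ℝ≥0∞ :=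
  mass D fun u => f u ^^ f (restr c u)

theorem cost_findBad (f : BoolFn n) (D : PMF (Fin n → Bool)) (c : Fin n → ℕ) (M : ℕ) :
    (State.findBad f D c M).cost 0 (fun o => if o = none then 1 else 0) ≤
      mass D (fun u => !(f u ^^ f (restr c u))) ^ M := by
  refine (Run.cost_iter_le_mul (W := fun o : Option (Fin n → Bool) => if o = none then 1 else 0)
    (ρ := mass D fun u => !(f u ^^ f (restr c u))) (fun _ o => ?_) M 0 none).trans (by simp)
  cases o with
  | some u => rw [State.sample, Run.cost_ret]; simp
  | none =>
    rw [State.sample, Run.cost_andThen, Run.cost_lift, if_pos rfl, mul_one]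
    refine ENNReal.tsum_le_tsum fun u => ?_
    rw [Run.cost_ret]
    beta_reduce
    generalize (f u ^^ f (restr c u)) = b
    cases b <;> simp

theorem State.ensures_extend (h : S.num ≤ K ∧ ∀ l, S.pos l ≤ S.num) (u : Fin n → Bool) :
    (S.extend f blk K u).Ensures fun S' => S'.num ≤ K ∧ ∀ l, S'.pos l ≤ S'.num := by
  rw [State.extend]
  split_ifs with hK
  · refine Run.ensures_ret ⟨hK, fun l => ?_⟩
    have := h.2 l
    simp only [State.add, Function.update_apply]
    split_ifs <;> omega
  · exact Run.ensures_fail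

theorem State.ensures_searchAll (f : BoolFn n) (D : PMF (Fin n → Bool)) (blk : Fin n → ℕ)
    (K E : ℕ) : (State.searchAll f D blk K E).Ensures fun S =>
      S.num ≤ K ∧ ∀ l, S.pos l ≤ S.num := by
  refine (Run.ensures_iter (P := fun s : State n × Bool => s.1.num ≤ K ∧
    ∀ l, s.1.pos l ≤ s.1.num) (fun i s hs => ?_) _ ⟨Nat.zero_le _, fun _ => le_rfl⟩).andThen
    fun s hs => ?_
  · obtain ⟨S, done⟩ := s
    rcases done with _ | _
    · simp only [State.round]
      split_ifs with hv
      · refine Run.Ensures.andThen (P := fun S' => S'.num ≤ K ∧ ∀ l, S'.pos l ≤ S'.num) ?_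
          fun S' hS' => Run.ensures_ret hS'
        simp only [State.validate]
        split_ifs
        · exact Run.ensures_ret hs
        · exact State.ensures_extend hs _
        · exact State.ensures_extend hs _
      · refine (Run.ensures_true _).andThen fun o _ => ?_
        cases o with
        | none => exact Run.ensures_ret hs
        | some u => exact (State.ensures_extend hs u).andThen fun S' hS' => Run.ensures_ret hS'
    · exact Run.ensures_ret hs
  · split_ifs
    · exact Run.ensures_ret hs
    · exact Run.ensures_fail

/-- A bad state is declared complete only if 4E(size K + 8) samples all miss a set of mass at least
1/(4E), which has probability at most 2^-(size K + 8). There are at most 2^(size K + 1) rounds in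
which this can happen. -/
theorem cost_searchAll_le (f : BoolFn n) (D : PMF (Fin n → Bool)) (blk : Fin n → ℕ) (K : ℕ)
    (hE : E ≠ 0) : (State.searchAll f D blk K E).cost 0 (fun S =>
      if 2 * unitError E ≤ restrError f D (S.coord blk) then 1 else 0) ≤ 2⁻¹ ^ 7 := by
  set W : State n × Bool → ℝ≥0∞ := fun s =>
    if s.2 = true ∧ 2 * unitError E ≤ restrError f D (s.1.coord blk) then 1 else 0 with hW
  have hround : ∀ (i : ℕ) (s : State n × Bool), i < K + K + 2 →
      (State.round f D blk K E s).cost 0 W ≤ W s + 2⁻¹ ^ (K.size + 8) := fun _ s _ => by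
    obtain ⟨S, done⟩ := s
    have hfalse : ∀ p : Run (State n), (p.andThen fun S' => Run.ret (S', false)).cost 0 W ≤ 0 :=
      fun p => Run.cost_andThen_le fun S' => by
        rw [Run.cost_ret]
        simp [hW]
    rcases done with _ | _
    · simp only [State.round]
      split_ifs with hv
      · exact (hfalse _).trans zero_le
      · refine le_trans ?_ le_add_self
        by_cases hbad : 2 * unitError E ≤ restrError f D (S.coord blk)
        · have hcost := cost_findBad f D (S.coord blk) (searchSamples K E)
          have hM : searchSamples K E = 4 * E * (K.size + 8) := by rw [searchSamples]; ring
          rw [Run.cost_andThen]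
          refine (Run.cost_mono fun o => ?_).trans (hcost.trans ?_)
          · cases o with
            | none =>
              refine (Run.cost_ret _ _ _).trans_le ?_
              simp only [hW]
              split_ifs <;> simp_all
            | some u => exact (hfalse _).trans zero_le
          · rw [hM]
            refine ENNReal.pow_le_of_add_inv_le (by omega) ?_ _
            rw [← two_mul_unitError, ← mass_add_mass_not (D := D) (fun u => f u ^^
              f (restr (S.coord blk) u)), add_comm]
            gcongr
            exact hbad
        · refine (Run.cost_andThen_le fun o => ?_).trans zero_le
          cases o with
          | none =>
            refine (Run.cost_ret _ _ _).trans_le ?_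
            simp [hW, hbad]
          | some u => exact hfalse _
    · rw [State.round, Run.cost_ret]
      exact le_self_add
  rw [State.searchAll, Run.cost_andThen]
  refine (Run.cost_mono (w' := W) fun s => ?_).trans
    ((Run.cost_iter_le_add (W := fun _ => W) (K + K + 2) hround _ (Nat.zero_add _) _).trans ?_)
  · cases hs : s.2
    · simp [Run.cost_fail]
    · simp [Run.cost_ret, hW, hs]
  · have h1 : K < 2 ^ K.size := Nat.lt_size_self K
    have h2 : K + K + 2 ≤ 2 ^ (K.size + 1) := by rw [pow_succ]; omega
    simp only [hW, Bool.false_eq_true, false_and, if_false, zero_add]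
    calc ((K + K + 2 : ℕ) : ℝ≥0∞) * 2⁻¹ ^ (K.size + 8)
        ≤ (2 ^ (K.size + 1) : ℕ) * 2⁻¹ ^ (K.size + 8) := by gcongr
      _ = 2⁻¹ ^ 7 := by
        rw [show K.size + 8 = K.size + 1 + 7 by ring, pow_add _ (K.size + 1) 7, ← mul_assoc,
          Nat.cast_pow, ← mul_pow, Nat.cast_ofNat, ENNReal.mul_inv_cancel (by simp) (by simp),
          one_pow, one_mul]

end SearchSound

/-! ## Soundness of the tests -/

section TestsSound

open Finset

variable {n : ℕ} {f : BoolFn n} {D : PMF (Fin n → Bool)} {c : Fin n → ℕ} {K E : ℕ} {S : State n}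
  {σ : Equiv.Perm (Fin n)} {L : Finset (Fin n) → List (BoolFn n)} {C : Set (BoolFn n)}

/-- Block number `p` is mostly read as variable number `σ p`. -/
def ReadsAs (f : BoolFn n) (c : Fin n → ℕ) (S : State n) (σ : Equiv.Perm (Fin n)) : Prop :=
  ∀ p : Fin n, (p : ℕ) < S.num → ∀ x,
    pr (fun z => shiftDiff (blockFn f c p (S.wit p)) z x ^^ x (σ p)) ≤ 1 / 24

/-- The variable read from a block must lie in that block. Hence different blocks read different
variables, and the assignment extends to a permutation. -/
theorem exists_readsAs (h : ∀ p < S.num, violationPr (blockFn f c p (S.wit p)) < 1 / 48) :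
    ∃ σ, ReadsAs f c S σ := by
  have h1 : ∀ p : Fin n, ∃ τ, (p : ℕ) < S.num → c τ = p + 1 ∧ ∀ x,
      pr (fun z => shiftDiff (blockFn f c p (S.wit p)) z x ^^ x τ) ≤ 1 / 24 := fun p => by
    by_cases hp : (p : ℕ) < S.num
    · obtain ⟨τ, hτ⟩ := exists_pr_shiftDiff_ne_le (h p hp)
      refine ⟨τ, fun _ => ⟨?_, hτ⟩⟩
      by_contra hne
      -- A shift by a unit string outside the block is invisible to the block function, so its bit τ
      -- would always be read as 0 instead of 1.
      have h2 : ∀ z, shiftDiff (blockFn f c p (S.wit p)) z (fun i => decide (i = τ)) = false := by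
        intro z
        have : substBlock c p (S.wit p) (fun i => z i ^^ decide (i = τ)) =
            substBlock c p (S.wit p) z := funext fun i => by
          rw [substBlock, substBlock]
          split_ifs with hi
          · have : i ≠ τ := fun hi' => hne (hi' ▸ hi)
            simp [this]
          · rfl
        rw [shiftDiff, blockFn, blockFn, this, Bool.xor_self]
      have h3 := hτ fun i => decide (i = τ)
      simp only [h2, decide_true, Bool.xor_true, Bool.not_false, pr_true] at h3
      norm_num at h3
    · exact ⟨p, fun h => absurd h hp⟩
  choose τ hτ using h1
  obtain ⟨σ, hσ⟩ := Set.MapsTo.exists_equiv_extend_of_card_eq (t := univ) (f := τ)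
    (s := {p : Fin n | (p : ℕ) < S.num}) (by simp) (fun _ _ => by simp) fun p hp p' hp' he => by
      have h2 := (hτ p hp).1
      have h3 := (hτ p' hp').1
      rw [he] at h2
      exact Fin.ext (by omega)
  refine ⟨σ.trans (Equiv.subtypeUnivEquiv fun _ => mem_univ _), fun p hp x => ?_⟩
  have := (hτ p hp).2 x
  rw [← hσ p hp] at this
  exact this

/-- Either every block passes the structural criterion, so that what follows may assume `ReadsAs`,
or some block alone makes the test reject except with probability 2^-8. -/
theorem cost_dictatorTest_andThen_le {g : Run Unit} {b : ℝ≥0∞} (hb : 2⁻¹ ^ 8 ≤ b)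
    (h : ∀ σ, ReadsAs f c S σ → g.cost 0 (fun _ => 1) ≤ b) :
    ((dictatorTest f c S).andThen fun _ => g).cost 0 (fun _ => 1) ≤ b := by
  by_cases hall : ∀ p < S.num, violationPr (blockFn f c p (S.wit p)) < 1 / 48
  · obtain ⟨σ, hσ⟩ := exists_readsAs hall
    exact Run.cost_andThen_le fun _ => h σ hσ
  push Not at hall
  obtain ⟨p, hp, hv⟩ := hall
  refine Run.cost_andThen_le_left.trans (le_trans ?_ hb)
  have hround : (dictatorRound (blockFn f c p (S.wit p))).cost 0 (fun _ => 1) +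
      ((48 : ℕ) : ℝ≥0∞)⁻¹ ≤ 1 := by
    refine le_trans ?_ (cost_dictatorRound_add (blockFn f c p (S.wit p))).le
    gcongr
    refine le_trans ?_ (ENNReal.ofReal_le_ofReal hv)
    rw [one_div, ENNReal.ofReal_inv_of_pos (by norm_num)]
    norm_num
  have hinner : (Run.iter (fun _ _ => dictatorRound (blockFn f c p (S.wit p))) 0 384 ()).cost 0
      (fun _ => 1) ≤ 2⁻¹ ^ 8 :=
    (Run.cost_iter_le_pow (fun _ => le_rfl) _ _).trans
      (ENNReal.pow_le_of_add_inv_le (t := 48) (by norm_num) hround 8)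
  -- The potential records that the bad block `p` is still to be tested; it rises from 2^-8 to 1
  -- exactly when that test is survived.
  have := Run.cost_iter_le_add (ρ := 0)
    (W := fun i (_ : Unit) => if i ≤ p then (2⁻¹ ^ 8 : ℝ≥0∞) else 1)
    (F := fun p _ => Run.iter (fun _ _ => dictatorRound (blockFn f c p (S.wit p))) 0 384 ()) S.num
    (fun i _ _ => ?_) S.num (Nat.zero_add _) ()
  · simpa [Nat.not_le.2 hp, dictatorTest] using this
  · rw [add_zero]
    rcases lt_trichotomy i p with hi | rfl | hi
    · rw [if_pos hi.le, if_pos (Nat.succ_le_of_lt hi)]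
      exact Run.cost_le zero_le fun _ => le_rfl
    · rw [if_pos le_rfl, if_neg (by omega)]
      exact hinner
    · rw [if_neg (by omega), if_neg (by omega)]
      exact Run.cost_le zero_le fun _ => le_rfl

theorem num_mul_pow_readReps_le (hK : S.num ≤ K) :
    (S.num : ℝ≥0∞) * 2⁻¹ ^ readReps K E ≤ unitError E := by
  have h1 : K < 2 ^ K.size := Nat.lt_size_self K
  have h2 : E < 2 ^ E.size := Nat.lt_size_self E
  have h3 : S.num * (8 * E) ≤ 2 ^ readReps K E := by
    rw [readReps, pow_add, pow_add]
    calc S.num * (8 * E) ≤ 2 ^ K.size * (8 * 2 ^ E.size) := by gcongr; omega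
      _ ≤ 2 ^ K.size * 2 ^ E.size * 2 ^ 8 := by
        rw [mul_comm 8, ← mul_assoc]
        gcongr
        norm_num
  rw [unitError, ENNReal.le_inv_iff_mul_le, mul_right_comm, ← ENNReal.inv_pow, ← div_eq_mul_inv]
  refine ENNReal.div_le_of_le_mul ?_
  rw [one_mul]
  exact_mod_cast h3

/-- The string read may be replaced by the true values of the variables assigned by σ, at the price
of the probability of a misreading. -/
theorem cost_lift_readAll_le (hn : S.num ≤ n) (hσ : ReadsAs f c S σ) {r : ℕ}
    {w : (Fin n → Bool) → (Fin n → Bool) → ℝ≥0∞} {Q : (Fin n → Bool) → Bool}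
    (hw1 : ∀ x y, w x y ≤ 1)
    (hw : ∀ x, w x (truncate S.num fun p => x (σ p)) ≤ if Q x then 1 else 0) :
    (Run.lift D).cost 0 (fun x => (readAll f c S r x).cost 0 (w x)) ≤
      mass D Q + S.num * 2⁻¹ ^ r := by
  have h := Run.cost_le_add (p := Run.lift D)
    (w := fun x => (readAll f c S r x).cost 0 (w x)) (w' := fun x => if Q x then 1 else 0)
    (b := S.num * 2⁻¹ ^ r) fun x => ?_
  · rw [Run.cost_lift _ _ fun x => if Q x then 1 else 0] at h
    exact h
  · rw [add_comm]
    refine (Run.cost_le_add fun y => ?_).trans (add_le_add (cost_readAll_ne_le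
      (y := fun p => x (σ p)) hn (fun p hp => hσ p hp x) r) le_rfl)
    by_cases hy : y = truncate S.num fun p => x (σ p)
    · rw [if_pos hy, zero_add, hy]
      exact hw x
    · rw [if_neg hy]
      exact (hw1 x y).trans le_self_add

theorem projected_truncate (hc : ∀ i, c i ≤ S.num) (y : Fin n → Bool) :
    projected f c (truncate S.num y) = projected f c y := by
  refine congrArg f (funext fun i => ?_)
  rw [expand, expand]
  by_cases h0 : c i = 0
  · simp [h0]
  · have := hc i
    split_ifs with hlt
    · have : c i - 1 < S.num := by omega
      simp [truncate, this]
    · rfl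

/-- A round is passed only if the two values agree, which has probability at most 1 - 2u, or after a
misreading, of probability at most u. So it is passed with probability at most 1 - u, where u =
1/(8E), and there are 4 * 8E rounds. -/
theorem cost_consistency_le (hn : S.num ≤ n) (hK : S.num ≤ K) (hE : E ≠ 0)
    (hc : ∀ i, c i ≤ S.num) (hσ : ReadsAs f c S σ)
    (h : 2 * unitError E ≤ mass D fun x => f (restr c x) ^^ projected f c fun p => x (σ p)) :
    (Run.iter (fun _ _ => consistencyRound f D c S (readReps K E)) 0 (32 * E) ()).cost 0
      (fun _ => 1) ≤ 2⁻¹ ^ 4 := by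
  refine (Run.cost_iter_le_pow (fun _ => le_rfl) _ _).trans ?_
  rw [show 32 * E = 8 * E * 4 by ring]
  refine ENNReal.pow_le_of_add_inv_le (by omega) ?_ 4
  rw [← unitError]
  refine le_of_le_of_eq ?_ ((add_comm _ _).trans (mass_add_mass_not (D := D) fun x =>
    f (restr c x) ^^ projected f c fun p => x (σ p)))
  calc _ ≤ mass D (fun x => !(f (restr c x) ^^ projected f c fun p => x (σ p))) + unitError E +
        unitError E := by
        gcongr
        rw [consistencyRound, Run.cost_andThen]
        simp only [Run.cost_andThen]
        refine (cost_lift_readAll_le hn hσ (fun x y => Run.cost_le zero_le fun _ => le_rfl)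
          fun x => ?_).trans (add_le_add le_rfl (num_mul_pow_readReps_le hK))
        have := projected_truncate (f := f) hc fun p => x (σ p)
        rw [projected] at this
        rw [this]
        cases f (restr c x) ^^ projected f c fun p => x (σ p)
        · simp [Run.cost_ret]
        · simp [Run.cost_fail]
    _ ≤ _ := by
        rw [add_assoc, ← two_mul]
        gcongr

/-- Each candidate survives 8E(size N + 4) examples with probability at most 2^-(size N + 4), and N
≤ 2^(size N) candidates leave 2^-4. -/
theorem cost_elimination_le {q : ℕ} {src : Run ((Fin n → Bool) × Bool)} (hE : E ≠ 0)
    (h : ∀ G ∈ candidates L q, src.cost 0 (fun s => if G s.1 ^^ s.2 then 0 else 1) +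
      unitError E ≤ 1) : (elimination L q E src).cost 0 (fun _ => 1) ≤ 2⁻¹ ^ 4 := by
  set N := (candidates L q).length with hN
  have hj : ∀ j ∈ range N, (Run.iter (fun _ => eliminationRound L q src) 0 (learnSamples N E)
      fun _ => false).cost 0 (fun dead => if dead j then 0 else 1) ≤ 2⁻¹ ^ (N.size + 4) := by
    intro j hj
    rw [mem_range] at hj
    refine (Run.cost_iter_le_mul (W := fun dead : ℕ → Bool => if dead j then 0 else 1)
      (ρ := src.cost 0 fun s => if (candidates L q)[j] s.1 ^^ s.2 then 0 else 1)
      (fun _ dead => ?_) _ _ _).trans ?_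
    · rw [eliminationRound, Run.cost_andThen]
      cases hd : dead j
      · simp only [Bool.false_eq_true, if_false, mul_one]
        refine Run.cost_mono fun s => ?_
        rw [Run.cost_ret]
        have ha : classAnswer L (firstVars n q) j s.1 = ((candidates L q)[j] s.1).toNat := by
          rw [classAnswer_firstVars, dif_pos hj]
        beta_reduce
        rw [ha, hd]
        cases (candidates L q)[j] s.1 <;> cases s.2 <;> simp
      · refine (Run.cost_le zero_le fun s => ?_).trans zero_le
        rw [Run.cost_ret]
        simp [hd]
    · have hM : learnSamples N E = 8 * E * (N.size + 4) := by rw [learnSamples]; ring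
      simp only [Bool.false_eq_true, if_false, mul_one]
      rw [hM]
      exact ENNReal.pow_le_of_add_inv_le (by omega) (h _ (List.getElem_mem hj)) _
  rw [elimination, Run.cost_andThen]
  calc _ ≤ (Run.iter (fun _ => eliminationRound L q src) 0 (learnSamples N E)
        fun _ => false).cost 0 (fun dead => ∑ j ∈ range N, if dead j then 0 else 1) := by
        refine Run.cost_mono fun dead => ?_
        split_ifs with hd
        · obtain ⟨j, hj, hd⟩ := hd
          rw [Run.cost_ret]
          refine le_trans ?_ (single_le_sum (fun _ _ => zero_le) (mem_range.2 hj))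
          simp [hd]
        · rw [Run.cost_fail]
          exact zero_le
    _ ≤ ∑ j ∈ range N, 2⁻¹ ^ (N.size + 4) := by
        rw [Run.cost_sum]
        exact sum_le_sum hj
    _ ≤ (2 ^ N.size : ℕ) * 2⁻¹ ^ (N.size + 4) := by
        rw [sum_const, card_range, nsmul_eq_mul]
        gcongr
        exact (Nat.lt_size_self N).le
    _ = 2⁻¹ ^ 4 := by
        rw [pow_add, ← mul_assoc, Nat.cast_pow, ← mul_pow, Nat.cast_ofNat,
          ENNReal.mul_inv_cancel (by simp) (by simp), one_pow, one_mul]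

end TestsSound

/-! ## Soundness -/

section Soundness

variable {n : ℕ} {f : BoolFn n} {D : PMF (Fin n → Bool)} {c : Fin n → ℕ} {K E : ℕ} {S : State n}
  {σ : Equiv.Perm (Fin n)} {L : Finset (Fin n) → List (BoolFn n)} {C : Set (BoolFn n)}

theorem candidate_truncate (hL : IsListing C L) {q : ℕ} {G : BoolFn n} (hG : G ∈ candidates L q)
    (y : Fin n → Bool) : G (truncate q y) = G y := by
  refine eq_of_eqOn_relevantVars G fun i hi => ?_
  rw [(((hL _).2 G).1 hG).2] at hi
  simp only [firstVars, Finset.mem_filter, Finset.mem_univ, true_and, decide_eq_true_eq] at hi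
  simp [truncate, hi]

/-- A candidate with permuted variables is still in the class, so farness applies to it. -/
theorem eight_mul_unitError_le_mass (hL : IsListing C L) (hv : ClosedUnderVariableProjection C)
    (hfar : ∀ g ∈ C, (E : ℝ≥0∞)⁻¹ ≤ mass D fun x => f x ^^ g x) {q : ℕ} {G : BoolFn n}
    (hG : G ∈ candidates L q) (σ : Equiv.Perm (Fin n)) :
    8 * unitError E ≤ mass D fun x => f x ^^ G fun p => x (σ p) := by
  rw [eight_mul_unitError]
  exact hfar _ (hv G (((hL _).2 G).1 hG).1 σ)

/-- Permuting coordinates preserves the uniform distribution; this allows the uniform tester to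
label fresh uniform strings instead of reading examples. -/
theorem mass_uniformOfFintype_perm (σ : Equiv.Perm (Fin n)) (P : (Fin n → Bool) → Bool) :
    mass (PMF.uniformOfFintype (Fin n → Bool)) (fun x => P fun p => x (σ p)) =
      mass (PMF.uniformOfFintype (Fin n → Bool)) P := by
  rw [mass_uniformOfFintype, mass_uniformOfFintype]
  congr 1
  exact Fintype.expect_equiv (σ.arrowCongr (Equiv.refl Bool)).symm _ _ fun x => rfl

/-- Triangle inequality through the restriction and the projection of `f`: of the distance 8u to the
candidate at most 2u is lost at each of the two passages, so more than u remains for the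
elimination. -/
theorem cost_uniformExample_le (hL : IsListing C L)
    (hv : ClosedUnderVariableProjection C) {q : ℕ} {G : BoolFn n} (hG : G ∈ candidates L q)
    (hfar : ∀ g ∈ C, (E : ℝ≥0∞)⁻¹ ≤ mass (PMF.uniformOfFintype (Fin n → Bool)) fun x => f x ^^ g x)
    (h1 : restrError f (PMF.uniformOfFintype _) c < 2 * unitError E)
    (h2 : mass (PMF.uniformOfFintype _) (fun x => f (restr c x) ^^ projected f c fun p => x (σ p)) <
      2 * unitError E) :
    (uniformExample f c).cost 0 (fun s => if G s.1 ^^ s.2 then 0 else 1) + unitError E ≤ 1 := by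
  set U := PMF.uniformOfFintype (Fin n → Bool) with hU
  have h3 : unitError E ≤ mass U fun y => projected f c y ^^ G y := by
    by_contra hlt
    rw [not_le, ← mass_uniformOfFintype_perm σ] at hlt
    have h4 := eight_mul_unitError_le_mass hL hv hfar hG σ
    have h5 : mass U (fun x => f x ^^ G fun p => x (σ p)) ≤
        restrError f U c + (mass U (fun x => f (restr c x) ^^ projected f c fun p => x (σ p)) +
          mass U fun x => projected f c (fun p => x (σ p)) ^^ G fun p => x (σ p)) := by
      refine (mass_le_add (R := fun x => f (restr c x) ^^ G fun p => x (σ p)) fun x hx => ?_).trans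
        (add_le_add le_rfl (mass_le_add fun x hx => ?_))
      · revert hx
        cases f x <;> cases f (restr c x) <;> simp
      · revert hx
        cases f (restr c x) <;> cases projected f c fun p => x (σ p) <;> simp
    have h6 := (h4.trans h5).trans_lt (ENNReal.add_lt_add h1 (ENNReal.add_lt_add h2 hlt))
    have h7 : 2 * unitError E + (2 * unitError E + unitError E) = 5 * unitError E := by ring
    rw [h7] at h6
    refine absurd h6 (not_lt.2 ?_)
    gcongr
    norm_num
  refine (add_le_add le_rfl h3).trans (le_of_eq (Eq.trans ?_ ((add_comm _ _).trans
    (mass_add_mass_not (D := U) fun y => projected f c y ^^ G y))))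
  congr 1
  rw [uniformExample, Run.cost_andThen, Run.uniform, Run.cost_lift, mass]
  congr 1
  funext y
  rw [Run.cost_ret, Bool.xor_comm]
  change _ * (if f (expand c y) ^^ G y then _ else _) = _ * if !(f (expand c y) ^^ G y) then _ else _
  generalize (f (expand c y) ^^ G y) = b
  cases b <;> simp [hU]

/-- Passing to the restriction costs 2u of the distance 8u. At least 2u is left, of which the
misreadings can hide u. -/
theorem cost_readExample_le (hn : S.num ≤ n) (hK : S.num ≤ K) (hσ : ReadsAs f c S σ) (hL : IsListing C L)
    (hv : ClosedUnderVariableProjection C) {G : BoolFn n} (hG : G ∈ candidates L S.num)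
    (hfar : ∀ g ∈ C, (E : ℝ≥0∞)⁻¹ ≤ mass D fun x => f x ^^ g x)
    (h1 : restrError f D c < 2 * unitError E) :
    (readExample f D c S (readReps K E)).cost 0 (fun s => if G s.1 ^^ s.2 then 0 else 1) +
      unitError E ≤ 1 := by
  have h3 : 2 * unitError E ≤ mass D fun x => f (restr c x) ^^ G fun p => x (σ p) := by
    by_contra hlt
    rw [not_le] at hlt
    have h4 := eight_mul_unitError_le_mass hL hv hfar hG σ
    have h5 : mass D (fun x => f x ^^ G fun p => x (σ p)) ≤
        restrError f D c + mass D (fun x => f (restr c x) ^^ G fun p => x (σ p)) := by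
      refine mass_le_add fun x hx => ?_
      revert hx
      cases f x <;> cases f (restr c x) <;> simp
    have h6 := (h4.trans h5).trans_lt (ENNReal.add_lt_add h1 hlt)
    have h7 : 2 * unitError E + 2 * unitError E = 4 * unitError E := by ring
    rw [h7] at h6
    refine absurd h6 (not_lt.2 ?_)
    gcongr
    norm_num
  refine le_of_le_of_eq ?_ ((add_comm _ _).trans (mass_add_mass_not (D := D) fun x =>
    f (restr c x) ^^ G fun p => x (σ p)))
  refine le_trans ?_ (add_le_add le_rfl h3)
  rw [two_mul, ← add_assoc]
  gcongr
  rw [readExample, Run.cost_andThen]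
  simp only [Run.cost_andThen, Run.cost_ret]
  refine (cost_lift_readAll_le hn hσ (fun x y => ?_) fun x => ?_).trans
    (add_le_add le_rfl (num_mul_pow_readReps_le hK))
  · split_ifs <;> simp
  · rw [candidate_truncate hL hG, Bool.xor_comm]
    generalize (f (restr c x) ^^ G fun p => x (σ p)) = b
    cases b <;> simp

/-- No property of the partition is used: a bad search result costs 2^-7 and the later tests cost
2^-4, which together stay below 1/3. -/
theorem cost_search_andThen_le (hE : E ≠ 0) {b : ℕ} {g : (Fin n → ℕ) → State n → Run Unit}
    (hg : ∀ blk S, S.num ≤ K → (∀ i, S.coord blk i ≤ S.num) →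
      restrError f D (S.coord blk) < 2 * unitError E → (g blk S).cost 0 (fun _ => 1) ≤ 2⁻¹ ^ 4) :
    ((partition n b).andThen fun blk => (State.searchAll f D blk K E).andThen (g blk)).cost 0
      (fun _ => 1) ≤ 1 / 3 := by
  refine Run.cost_andThen_le fun blk => ?_
  rw [Run.cost_andThen]
  calc _ ≤ (State.searchAll f D blk K E).cost 0 (fun S =>
        (if 2 * unitError E ≤ restrError f D (S.coord blk) then 1 else 0) + 2⁻¹ ^ 4) := by
        refine (State.ensures_searchAll f D blk K E).cost_le fun S hS => ?_
        by_cases h : 2 * unitError E ≤ restrError f D (S.coord blk)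
        · rw [if_pos h]
          exact (Run.cost_le zero_le fun _ => le_rfl).trans le_self_add
        · rw [if_neg h, zero_add]
          exact hg blk S hS.1 (fun i => hS.2 _) (not_le.1 h)
    _ ≤ 2⁻¹ ^ 7 + 2⁻¹ ^ 4 := (Run.cost_le_add fun _ => le_rfl).trans
        (add_le_add (cost_searchAll_le f D blk K hE) le_rfl)
    _ ≤ 1 / 3 := by
        rw [← ENNReal.toReal_le_toReal (by finiteness) (by finiteness), ENNReal.toReal_add
          (by finiteness) (by finiteness)]
        norm_num

theorem cost_uniformTester_of_far (hE : E ≠ 0) (hK : K ≤ n) (hL : IsListing C L)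
    (hv : ClosedUnderVariableProjection C)
    (hfar : ∀ g ∈ C, (E : ℝ≥0∞)⁻¹ ≤ mass (PMF.uniformOfFintype _) fun x => f x ^^ g x) :
    (uniformTester f (PMF.uniformOfFintype _) L K E).cost 0 (fun _ => 1) ≤ 1 / 3 := by
  refine cost_search_andThen_le hE fun blk S hS hc hr => ?_
  refine cost_dictatorTest_andThen_le (by
    exact pow_le_pow_of_le_one zero_le (by simp) (by norm_num)) fun σ hσ => ?_
  by_cases h : 2 * unitError E ≤ mass (PMF.uniformOfFintype _) fun x =>
      f (restr (S.coord blk) x) ^^ projected f (S.coord blk) fun p => x (σ p)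
  · exact Run.cost_andThen_le_left.trans (cost_consistency_le (hS.trans hK) hS hE hc hσ h)
  · exact Run.cost_andThen_le fun _ => cost_elimination_le hE fun G hG =>
      cost_uniformExample_le hL hv hG hfar hr (not_le.1 h)

theorem cost_distributionFreeTester_of_far (hE : E ≠ 0) (hK : K ≤ n) (hL : IsListing C L)
    (hv : ClosedUnderVariableProjection C)
    (hfar : ∀ g ∈ C, (E : ℝ≥0∞)⁻¹ ≤ mass D fun x => f x ^^ g x) :
    (distributionFreeTester f D L K E).cost 0 (fun _ => 1) ≤ 1 / 3 := by
  refine cost_search_andThen_le hE fun blk S hS hc hr => ?_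
  refine cost_dictatorTest_andThen_le (by
    exact pow_le_pow_of_le_one zero_le (by simp) (by norm_num)) fun σ hσ => ?_
  exact cost_elimination_le hE fun G hG =>
    cost_readExample_le (hS.trans hK) hS hσ hL hv hG hfar hr

end Soundness

/-! ## Bounds for the resources -/

section Resources

variable {n k K E N B : ℕ}

theorem size_le_self (m : ℕ) : m.size ≤ m := Nat.size_le.2 Nat.lt_two_pow_self

/-- All parameters are replaced by one bound and lower powers are absorbed. The junta size enters
only through K, which the testers take at most n; thus k itself is absent from the time. -/
theorem time_bounds (hB : 1 ≤ B) (hn : n ≤ B) (hK : K ≤ B) (hE : E ≤ B) (hN : N ≤ B) :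
    commonTime n K E ≤ 45200 * B ^ 4 ∧ readTime n K E ≤ 440 * B ^ 3 ∧
      ∀ T, T ≤ 460 * B ^ 3 → eliminationTime n E N T ≤ 19500 * B ^ 5 := by
  have sK := (size_le_self K).trans hK
  have sE := (size_le_self E).trans hE
  have sN := (size_le_self N).trans hN
  have b1 : 1 ≤ B := hB
  have b2 : B ≤ B ^ 2 := Nat.le_self_pow (by norm_num) B
  have b3 : B ^ 2 ≤ B ^ 3 := Nat.pow_le_pow_right hB (by norm_num)
  have b4 : B ^ 3 ≤ B ^ 4 := Nat.pow_le_pow_right hB (by norm_num)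
  have b5 : B ^ 4 ≤ B ^ 5 := Nat.pow_le_pow_right hB (by norm_num)
  have h1 : searchSamples K E ≤ 36 * B ^ 2 := by
    calc searchSamples K E ≤ (B + 8) * (B + B + B + B) := by unfold searchSamples; gcongr
      _ ≤ _ := by linarith
  have h2 : labelBits K ≤ 4 * B := by unfold labelBits; omega
  have h3 : readReps K E ≤ 10 * B := by unfold readReps; omega
  have h4 : learnSamples N E ≤ 40 * B ^ 2 := by
    calc learnSamples N E ≤ (B + 4) * (B + B + B + B + (B + B + B + B)) := by
          unfold learnSamples; gcongr
      _ ≤ _ := by linarith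
  have h5 : roundTime n K E ≤ 1142 * B ^ 3 := by
    calc roundTime n K E ≤ 36 * B ^ 2 * (8 * B + 19) + 4 * B * (4 * B + 13) + 32 * B + 70 := by
          unfold roundTime; gcongr
      _ ≤ _ := by linarith
  refine ⟨?_, ?_, fun T hT => ?_⟩
  · calc commonTime n K E ≤ 16 * B + 4 * B + (4 * B * (10 * B + 10)) +
          (B + B + 2) * (1142 * B ^ 3 + 3) + B * (384 * (46 * B + 59) + 6) + 100 := by
          unfold commonTime; gcongr
      _ ≤ _ := by linarith
  · calc readTime n K E ≤ B * (10 * B * (14 * B + 23) + 14 * B + 28) + 8 * B + 11 := by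
          unfold readTime; gcongr
      _ ≤ _ := by linarith
  · calc eliminationTime n E N T ≤ 40 * B ^ 2 * (460 * B ^ 3 + 6 * B + 7) + 8 * B + 10 * B +
          8 * B + 60 := by
          unfold eliminationTime; gcongr
      _ ≤ _ := by linarith

theorem uniformTester_time_le (hB : 1 ≤ B) (hn : n ≤ B) (hK : K ≤ B) (hE : E ≤ B) (hN : N ≤ B) :
    commonTime n K E + (32 * E * (readTime n K E + 8 * n + 20) + 138 +
      eliminationTime n E N (10 * n + 9)) + 2 ≤ 100000 * B ^ 5 := by
  obtain ⟨h1, h2, h3⟩ := time_bounds hB hn hK hE hN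
  have b2 : B ≤ B ^ 2 := Nat.le_self_pow (by norm_num) B
  have b3 : B ^ 2 ≤ B ^ 3 := Nat.pow_le_pow_right hB (by norm_num)
  have b4 : B ^ 3 ≤ B ^ 4 := Nat.pow_le_pow_right hB (by norm_num)
  have b5 : B ^ 4 ≤ B ^ 5 := Nat.pow_le_pow_right hB (by norm_num)
  have h4 := h3 (10 * n + 9) (by linarith)
  calc _ ≤ 45200 * B ^ 4 + (32 * B * (440 * B ^ 3 + 8 * B + 20) + 138 + 19500 * B ^ 5) + 2 := by
        gcongr
    _ ≤ _ := by linarith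

theorem distributionFreeTester_time_le (hB : 1 ≤ B) (hn : n ≤ B) (hK : K ≤ B) (hE : E ≤ B)
    (hN : N ≤ B) : commonTime n K E + eliminationTime n E N (readTime n K E + 4 * n + 8) + 2 ≤
      100000 * B ^ 5 := by
  obtain ⟨h1, h2, h3⟩ := time_bounds hB hn hK hE hN
  have b2 : B ≤ B ^ 2 := Nat.le_self_pow (by norm_num) B
  have b3 : B ^ 2 ≤ B ^ 3 := Nat.pow_le_pow_right hB (by norm_num)
  have b4 : B ^ 3 ≤ B ^ 4 := Nat.pow_le_pow_right hB (by norm_num)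
  have b5 : B ^ 4 ≤ B ^ 5 := Nat.pow_le_pow_right hB (by norm_num)
  have h4 := h3 (readTime n K E + 4 * n + 8) (by linarith)
  linarith

/-! ### Query counts with one logarithmic factor. -/

theorem size_le_logb_add_one {m : ℕ} (hm : 1 ≤ m) : (m.size : ℝ) ≤ Real.logb 2 m + 1 := by
  have h0 : 0 < m.size := Nat.size_pos.2 hm
  have h1 : 2 ^ (m.size - 1) ≤ m := Nat.lt_size.1 (by omega)
  have h2 : ((m.size - 1 : ℕ) : ℝ) ≤ Real.logb 2 m := by
    rw [Real.le_logb_iff_rpow_le (by norm_num) (by exact_mod_cast hm), Real.rpow_natCast]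
    exact_mod_cast h1
  rw [Nat.cast_sub h0] at h2
  push_cast at h2
  linarith

theorem logb_two_le {x : ℝ} (hx : 1 ≤ x) : Real.logb 2 x ≤ 2 * Real.log x := by
  rw [Real.logb, div_le_iff₀ (Real.log_pos (by norm_num))]
  have := Real.log_two_gt_d9
  have := Real.log_nonneg hx
  nlinarith

/-- The setting of the query bounds: `l` is `log (t + 2)` for some `t ≥ u`. -/
structure QueryBounds (K E : ℕ) (u l : ℝ) : Prop where
  one_le_l : 1 ≤ l
  size_K : (K.size : ℝ) ≤ 3 * l
  size_E : (E.size : ℝ) ≤ 5 * l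
  mul_le : (K : ℝ) * E ≤ 2 * u
  E_le : (E : ℝ) ≤ 2 * u
  K_le : (K : ℝ) ≤ u
  one_le_u : 1 ≤ u

theorem queryBounds {t ε : ℝ} (hk : 1 ≤ k) (hε : 0 < ε) (hε1 : ε ≤ 1) (hK : K ≤ k)
    (ht : k / ε ≤ t) : QueryBounds K ⌈1 / ε⌉₊ (k / ε) (Real.log (t + 2)) := by
  have hk' : (1 : ℝ) ≤ k := by exact_mod_cast hk
  have hK' : (K : ℝ) ≤ k := by exact_mod_cast hK
  have h1 : 1 ≤ 1 / ε := by rwa [le_div_iff₀ hε, one_mul]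
  have hE : (⌈1 / ε⌉₊ : ℝ) ≤ 2 * (1 / ε) := by
    have := (Nat.ceil_lt_add_one (by positivity : 0 ≤ 1 / ε)).le
    linarith
  have hkε : (k : ℝ) * (1 / ε) = k / ε := by rw [mul_one_div]
  have hu : (1 : ℝ) / ε ≤ k / ε := by rw [← hkε]; nlinarith
  have hku : (k : ℝ) ≤ k / ε := by rw [← hkε]; nlinarith
  have hE1 : 1 ≤ ⌈1 / ε⌉₊ := Nat.one_le_ceil_iff.2 (by positivity)
  have hl : 1 ≤ Real.log (t + 2) := by
    -- Here t ≥ k/ε ≥ 1, so t + 2 ≥ 3 > e; the logarithm is then large enough to absorb constants.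
    rw [Real.le_log_iff_exp_le (by linarith)]
    have := Real.exp_one_lt_d9
    linarith
  refine ⟨hl, ?_, ?_, ?_, by linarith, by linarith, by linarith⟩
  · rcases Nat.eq_zero_or_pos K with h0 | h0
    · subst h0
      simp only [Nat.size_zero, Nat.cast_zero]
      linarith
    · have h2 := size_le_logb_add_one h0
      have hK1 : (1 : ℝ) ≤ K := by exact_mod_cast h0
      have h3 := logb_two_le hK1
      have h4 := Real.log_le_log (by linarith) (by linarith : (K : ℝ) ≤ t + 2)
      linarith
  · have h2 := size_le_logb_add_one hE1
    have hE1' : (1 : ℝ) ≤ ⌈1 / ε⌉₊ := by exact_mod_cast hE1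
    have h3 := logb_two_le hE1'
    have h4 := Real.log_le_log (by linarith) (by linarith : (⌈1 / ε⌉₊ : ℝ) ≤ 2 * (t + 2))
    rw [Real.log_mul (by norm_num) (by linarith)] at h4
    have := Real.log_two_lt_d9
    linarith
  · calc (K : ℝ) * ⌈1 / ε⌉₊ ≤ k * (2 * (1 / ε)) := by gcongr
      _ ≤ _ := by linarith

variable {u l : ℝ}

theorem QueryBounds.commonQueries_le (h : QueryBounds K E u l) :
    (commonQueries K E : ℝ) ≤ 4000 * (u * l) := by
  obtain ⟨hl, hK, hE, hKE, hEu, hKu, hu⟩ := h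
  have hK0 : (0 : ℝ) ≤ K := K.cast_nonneg
  have hE0 : (0 : ℝ) ≤ E := E.cast_nonneg
  calc (commonQueries K E : ℝ) = (K + K + 2) * (((K.size : ℝ) + 8) * (12 * E) +
        (2 * K.size + 6)) + 2688 * K := by
        simp only [commonQueries, searchSamples, labelBits]
        push_cast
        ring
    _ ≤ (K + K + 2) * (((3 * l + 8 * l) * (12 * E)) + (2 * (3 * l) + 6 * l)) + 2688 * (u * l) := by
        gcongr
        · linarith
        · linarith
        · nlinarith
    _ = (264 * (K * E) + 264 * E + 24 * K + 24) * l + 2688 * (u * l) := by ring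
    _ ≤ (264 * (2 * u) + 264 * (2 * u) + 24 * u + 24 * u) * l + 2688 * (u * l) := by
        gcongr
        linarith
    _ ≤ 4000 * (u * l) := by nlinarith

theorem QueryBounds.read_le (h : QueryBounds K E u l) :
    (E : ℝ) * (K * (readReps K E * 2 + 2) + 3) ≤ 80 * (u * l) := by
  obtain ⟨hl, hK, hE, hKE, hEu, hKu, hu⟩ := h
  have hK0 : (0 : ℝ) ≤ K := K.cast_nonneg
  have hE0 : (0 : ℝ) ≤ E := E.cast_nonneg
  have hr : (readReps K E : ℝ) ≤ 16 * l := by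
    simp only [readReps]
    push_cast
    linarith
  calc (E : ℝ) * (K * (readReps K E * 2 + 2) + 3) ≤ E * (K * (16 * l * 2 + 2 * l) + 3 * l) := by
        gcongr <;> linarith
    _ = (34 * (K * E) + 3 * E) * l := by ring
    _ ≤ (34 * (2 * u) + 3 * (2 * u)) * l := by gcongr
    _ ≤ 80 * (u * l) := by nlinarith

theorem learnSamples_le (hN : 1 ≤ N) :
    (learnSamples N E : ℝ) ≤ 8 * (Real.logb 2 N + 5) * E := by
  have h := size_le_logb_add_one hN
  simp only [learnSamples]
  push_cast
  calc ((N.size : ℝ) + 4) * (E + E + E + E + (E + E + E + E)) = 8 * (N.size + 4) * E := by ring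
    _ ≤ _ := mul_le_mul_of_nonneg_right (by linarith) E.cast_nonneg

theorem uniformTester_queries_le {ε : ℝ} (hk : 1 ≤ k) (hε : 0 < ε) (hε1 : ε ≤ 1) (hK : K ≤ k)
    (hN : 1 ≤ N) (hE : E = ⌈1 / ε⌉₊) :
    ((commonQueries K E + (32 * E * (K * (readReps K E * 2 + 2) + 3) +
      learnSamples N E * 1) : ℕ) : ℝ) ≤ 10000 * ((k + Real.logb 2 N) / ε *
        Real.log ((k + Real.logb 2 N) / ε + 2)) := by
  have hlog : 0 ≤ Real.logb 2 N := Real.logb_nonneg (by norm_num) (by exact_mod_cast hN)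
  have ht : (k : ℝ) / ε ≤ (k + Real.logb 2 N) / ε := by gcongr; linarith
  have h := queryBounds hk hε hε1 hK ht
  rw [← hE] at h
  set t := (k + Real.logb 2 N) / ε with ht'
  set l := Real.log (t + 2)
  have h1 := h.commonQueries_le
  have h2 := h.read_le
  have h3 := learnSamples_le (E := E) hN
  have h4 : 8 * (Real.logb 2 N + 5) * E ≤ 80 * t := by
    have hk' : (1 : ℝ) ≤ k := by exact_mod_cast hk
    have hE' : (E : ℝ) ≤ 2 * (1 / ε) := by
      have := (Nat.ceil_lt_add_one (by positivity : 0 ≤ 1 / ε)).le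
      have h1 : 1 ≤ 1 / ε := by rwa [le_div_iff₀ hε, one_mul]
      rw [hE]
      linarith
    calc 8 * (Real.logb 2 N + 5) * E ≤ 8 * (5 * (k + Real.logb 2 N)) * (2 * (1 / ε)) := by
          gcongr
          linarith
      _ = 80 * t := by rw [ht']; ring
  have hl := h.one_le_l
  have h5 : (k : ℝ) / ε * l ≤ t * l := by gcongr
  have h6 : t ≤ t * l := by
    have := h.one_le_u
    nlinarith
  push_cast
  linarith

theorem distributionFreeTester_queries_le {ε : ℝ} (hk : 1 ≤ k) (hε : 0 < ε) (hε1 : ε ≤ 1)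
    (hK : K ≤ k) (hN : 1 ≤ N) (hE : E = ⌈1 / ε⌉₊) :
    ((commonQueries K E + learnSamples N E * (K * (readReps K E * 2 + 2) + 2) : ℕ) : ℝ) ≤
      10000 * (k / ε * Real.logb 2 (2 * N) * Real.log (k / ε * Real.logb 2 (2 * N) + 2)) := by
  have hN' : (1 : ℝ) ≤ N := by exact_mod_cast hN
  have hlog : 0 ≤ Real.logb 2 N := Real.logb_nonneg (by norm_num) hN'
  have hlog2 : Real.logb 2 (2 * N) = 1 + Real.logb 2 N := by
    rw [Real.logb_mul (by norm_num) (by linarith), Real.logb_self_eq_one (by norm_num)]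
  rw [hlog2]
  have ht : (k : ℝ) / ε ≤ k / ε * (1 + Real.logb 2 N) :=
    le_mul_of_one_le_right (by positivity) (by linarith)
  have h := queryBounds hk hε hε1 hK ht
  rw [← hE] at h
  set u := (k : ℝ) / ε
  set m := Real.logb 2 N
  set l := Real.log (u * (1 + m) + 2)
  have h1 := h.commonQueries_le
  have h2 := h.read_le
  have hl := h.one_le_l
  have hu := h.one_le_u
  have h3 : (learnSamples N E * (K * (readReps K E * 2 + 2) + 2) : ℝ) ≤
      40 * (1 + m) * (80 * (u * l)) := by
    calc (learnSamples N E * (K * (readReps K E * 2 + 2) + 2) : ℝ)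
        ≤ (8 * (m + 5) * E) * (K * (readReps K E * 2 + 2) + 3) := by
          gcongr
          · exact learnSamples_le hN
          · norm_num
      _ = 8 * (m + 5) * (E * (K * (readReps K E * 2 + 2) + 3)) := by ring
      _ ≤ 40 * (1 + m) * (80 * (u * l)) :=
        mul_le_mul (by linarith) h2 (by positivity) (by positivity)
  have h5 : u * l ≤ u * (1 + m) * l := by gcongr
  push_cast
  have e : 40 * (1 + m) * (80 * (u * l)) = 3200 * (u * (1 + m) * l) := by ring
  have : 0 ≤ u * l := by positivity
  linarith

end Resources

/-! ## The testers -/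

section Main

variable {n : ℕ}

theorem prob_verdict_ge {p : PMF Config} {b : Bool} (hp : ∀ c ∈ p.support, c.verdict ≠ none)
    (h : ∑' c, p c * c.verdict.elim 0 (fun b' => if b' = b then 0 else 1) ≤ 1 / 3) :
    2 / 3 ≤ prob p {c | c.verdict = some b} := by
  have h1 : p.toOuterMeasure {c | c.verdict = some b} +
      ∑' c, p c * c.verdict.elim 0 (fun b' => if b' = b then 0 else 1) = 1 := by
    rw [PMF.toOuterMeasure_apply, ← ENNReal.tsum_add, ← p.tsum_coe]
    congr 1
    funext c
    by_cases hc : c ∈ p.support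
    · cases hv : c.verdict with
      | none => exact absurd hv (hp c hc)
      | some b' => by_cases hb : b' = b <;> simp [Set.indicator, hv, hb]
    · rw [PMF.mem_support_iff, not_not] at hc
      simp [Set.indicator, hc]
  have h2 : p.toOuterMeasure {c | c.verdict = some b} ≠ ⊤ :=
    ne_top_of_le_ne_top ENNReal.one_ne_top (h1 ▸ le_self_add)
  have h3 := ENNReal.toReal_mono (by finiteness) h
  have h4 := congrArg ENNReal.toReal h1
  rw [ENNReal.toReal_add h2 (ne_top_of_le_ne_top (by finiteness) h), ENNReal.toReal_one] at h4
  rw [prob]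
  norm_num at h3
  linarith

theorem length_candidates_le {C : Set (BoolFn n)} {L : Finset (Fin n) → List (BoolFn n)}
    (hL : IsListing C L) (q : ℕ) : (candidates L q).length ≤ maxSliceCard C := by
  classical
  set Γ := Finset.univ.filter fun i => firstVars n q i = true
  have h : slice C Γ = ((L Γ).toFinset : Set (BoolFn n)) := by
    ext g
    simpa using ((hL Γ).2 g).symm
  calc (candidates L q).length = (slice C Γ).ncard := by
        rw [h, Set.ncard_coe_finset, List.toFinset_card_of_nodup (hL Γ).1]
        rfl
    _ ≤ maxSliceCard C :=
        Finset.le_sup (f := fun Γ => (slice C Γ).ncard) (Finset.mem_univ Γ)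

theorem one_le_maxSliceCard {C : Set (BoolFn n)} (hC : C.Nonempty) : 1 ≤ maxSliceCard C := by
  obtain ⟨f, hf⟩ := hC
  refine le_trans ?_ (Finset.le_sup (f := fun Γ => (slice C Γ).ncard)
    (Finset.mem_univ (relevantVars f)))
  exact (Set.ncard_pos (Set.toFinite _)).2 ⟨f, hf, rfl⟩

/-- The machine knows only the rounded value E = ⌈1/ε⌉, and 1/E ≤ ε. -/
theorem IsFarFrom.le_mass {D : PMF (Fin n → Bool)} {ε : ℝ} {f : BoolFn n} {C : Set (BoolFn n)}
    (h : IsFarFrom D ε f C) (hε : 0 < ε) :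
    ∀ g ∈ C, ((⌈1 / ε⌉₊ : ℕ) : ℝ≥0∞)⁻¹ ≤ mass D fun x => f x ^^ g x := fun g hg => by
  have h1 := h g hg
  have h2 : {x | f x ≠ g x} = {x | (f x ^^ g x) = true} := by
    ext x
    simp
  rw [h2, prob_eq_toReal_mass] at h1
  have hfin : mass D (fun x => f x ^^ g x) ≠ ⊤ :=
    ne_top_of_le_ne_top ENNReal.one_ne_top ((mass_add_mass_not (D := D) fun x => f x ^^ g x) ▸
      le_self_add)
  have hE : 1 / ε ≤ (⌈1 / ε⌉₊ : ℝ) := Nat.le_ceil _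
  have hE0 : 0 < (⌈1 / ε⌉₊ : ℝ) := lt_of_lt_of_le (by positivity) hE
  rw [← ENNReal.ofReal_natCast, ← ENNReal.ofReal_inv_of_pos hE0]
  refine ENNReal.ofReal_le_of_le_toReal (le_trans ?_ h1)
  rw [inv_le_comm₀ hE0 hε, ← one_div]
  exact hE

/-- The same cost estimate is used with cost 1 on the wrong verdict: rejection for members of the
class, acceptance for far functions. -/
theorem isTester_accept {s : Stmt} {k T q : ℕ} {ε : ℝ} {C : Set (BoolFn n)}
    {L : Finset (Fin n) → List (BoolFn n)} {D : PMF (Fin n → Bool)} {time queries : ℝ}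
    {p : BoolFn n → Run Unit}
    (hs : ∀ f, Impl ⟨f, D, L⟩ s (startMemory n k ⌈1 / ε⌉₊) T q (p f) fun _ _ => True)
    (hT : ((T + 2 : ℕ) : ℝ) ≤ time) (hq : (q : ℝ) ≤ queries)
    (hmem : ∀ f ∈ C, (p f).cost 1 (fun _ => 0) ≤ 1 / 3)
    (hfar : ∀ f, IsFarFrom D ε f C → (p f).cost 0 (fun _ => 1) ≤ 1 / 3) :
    IsTester (.accept s) k ε C L D time queries := by
  intro f
  obtain ⟨h1, h2⟩ := (hs f).accept
  refine ⟨T + 2, hT, fun c hc => ⟨(h1 c hc).1, le_trans (by exact_mod_cast (h1 c hc).2) hq⟩,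
    fun hf => prob_verdict_ge (fun c hc => (h1 c hc).1) ?_,
    fun hf => prob_verdict_ge (fun c hc => (h1 c hc).1) ?_⟩
  · exact (h2 _).trans (by simpa using hmem f hf)
  · exact (h2 _).trans (by simpa using hfar f hf)

theorem time_le {n N : ℕ} {ε : ℝ} (hε : 0 < ε) (hε1 : ε ≤ 1) {T : ℕ}
    (hT : T ≤ 100000 * (N + n + ⌈1 / ε⌉₊) ^ 5) :
    (T : ℝ) ≤ (10000000 : ℕ) * ((N : ℝ) + n + 1 / ε) ^ 5 := by
  have h1 : 1 ≤ 1 / ε := by rwa [le_div_iff₀ hε, one_mul]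
  have hE := (Nat.ceil_lt_add_one (by positivity : 0 ≤ 1 / ε)).le
  have hN : (0 : ℝ) ≤ N := N.cast_nonneg
  have hn : (0 : ℝ) ≤ n := n.cast_nonneg
  calc (T : ℝ) ≤ 100000 * ((N : ℝ) + n + ⌈1 / ε⌉₊) ^ 5 := by exact_mod_cast hT
    _ ≤ 100000 * (2 * ((N : ℝ) + n + 1 / ε)) ^ 5 := by
      gcongr
      linarith
    _ = 3200000 * ((N : ℝ) + n + 1 / ε) ^ 5 := by ring
    _ ≤ _ := by
      push_cast
      gcongr
      norm_num

theorem le_softO {q : ℕ} {t : ℝ} (ht : 1 ≤ t) (h : (q : ℝ) ≤ 10000 * (t * Real.log (t + 2))) :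
    (q : ℝ) ≤ softO 10000000 5 t := by
  have hl : 1 ≤ Real.log (t + 2) := by
    rw [Real.le_log_iff_exp_le (by linarith)]
    have := Real.exp_one_lt_d9
    linarith
  refine h.trans ?_
  rw [softO]
  push_cast
  gcongr
  · norm_num
  -- One logarithm suffices; its exponent is raised because `d` is shared with the time bound.
  · exact le_self_pow₀ hl (by norm_num)

end Main

theorem mainTheorem1 :
    (∃ (P : Stmt) (A d : ℕ), ∀ (n k : ℕ) (ε : ℝ) (C : Set (BoolFn n))
      (L : Finset (Fin n) → List (BoolFn n)),
      1 ≤ k → 0 < ε → ε ≤ 1 → C.Nonempty → (∀ f ∈ C, IsJunta k f) →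
      ClosedUnderZeroProjection C → ClosedUnderVariableProjection C → IsListing C L →
      IsTester P k ε C L (PMF.uniformOfFintype (Fin n → Bool))
        (A * ((maxSliceCard C : ℝ) + n + 1 / ε) ^ d)
        (softO A d ((k + Real.logb 2 (maxSliceCard C)) / ε))) ∧
    (∃ (P : Stmt) (A d : ℕ), ∀ (n k : ℕ) (ε : ℝ) (C : Set (BoolFn n))
      (L : Finset (Fin n) → List (BoolFn n)) (D : PMF (Fin n → Bool)),
      1 ≤ k → 0 < ε → ε ≤ 1 → C.Nonempty → (∀ f ∈ C, IsJunta k f) →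
      ClosedUnderZeroProjection C → ClosedUnderVariableProjection C → IsListing C L →
      IsTester P k ε C L D
        (A * ((maxSliceCard C : ℝ) + n + 1 / ε) ^ d)
        (softO A d (k / ε * Real.logb 2 (2 * maxSliceCard C)))) := by
  have quarter : (1 / 4 : ℝ≥0∞) ≤ 1 / 3 := by
    gcongr
    norm_num
  -- The difference k - (k - n) is min(k, n), computed by truncated subtraction. Capping at n lets
  -- block numbers serve as variable indices and keeps k out of the running time.
  have cardK : ∀ {n k : ℕ} {f : BoolFn n}, IsJunta k f → (relevantVars f).card ≤ k - (k - n) :=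
    fun {n k f} hf => by
      have h1 : (relevantVars f).card ≤ k := hf
      have h2 : (relevantVars f).card ≤ n := by simpa using Finset.card_le_univ (relevantVars f)
      omega
  have one_le_div : ∀ {k : ℕ} {ε : ℝ}, 1 ≤ k → 0 < ε → ε ≤ 1 → (1 : ℝ) ≤ k / ε :=
    fun {k ε} hk hε hε1 => by
      rw [le_div_iff₀ hε, one_mul]
      exact hε1.trans (by exact_mod_cast hk)
  refine ⟨⟨.accept .uniformTester, 10000000, 5, ?_⟩,
    ⟨.accept .distributionFreeTester, 10000000, 5, ?_⟩⟩
  · intro n k ε C L hk hε hε1 hC hjunta h0 hv hL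
    have hE : ⌈1 / ε⌉₊ ≠ 0 := (Nat.ceil_pos.2 (by positivity)).ne'
    have hN := one_le_maxSliceCard hC
    have hlog : 0 ≤ Real.logb 2 (maxSliceCard C) :=
      Real.logb_nonneg (by norm_num) (by exact_mod_cast hN)
    have ht : (1 : ℝ) ≤ (k + Real.logb 2 (maxSliceCard C)) / ε := by
      refine (one_le_div hk hε hε1).trans ?_
      gcongr
      linarith
    exact isTester_accept (fun f => Impl.uniformTester rfl fun j => length_candidates_le hL j)
      (time_le hε hε1 (uniformTester_time_le (by omega) (by omega) (by omega) (by omega)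
        (by omega)))
      (le_softO ht (uniformTester_queries_le hk hε hε1 (by omega) hN rfl))
      (fun f hf => (cost_uniformTester_of_mem (cardK (hjunta f hf)) h0 hv hL hf).trans quarter)
      fun f hf => cost_uniformTester_of_far hE (by omega) hL hv (hf.le_mass hε)
  · intro n k ε C L D hk hε hε1 hC hjunta h0 hv hL
    have hE : ⌈1 / ε⌉₊ ≠ 0 := (Nat.ceil_pos.2 (by positivity)).ne'
    have hN := one_le_maxSliceCard hC
    have hlog : 1 ≤ Real.logb 2 (2 * maxSliceCard C) := by
      rw [Real.le_logb_iff_rpow_le (by norm_num) (by positivity), Real.rpow_one]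
      have : (1 : ℝ) ≤ maxSliceCard C := by exact_mod_cast hN
      linarith
    have ht : (1 : ℝ) ≤ k / ε * Real.logb 2 (2 * maxSliceCard C) :=
      one_le_mul_of_one_le_of_one_le (one_le_div hk hε hε1) hlog
    exact isTester_accept
      (fun f => Impl.distributionFreeTester rfl fun j => length_candidates_le hL j)
      (time_le hε hε1 (distributionFreeTester_time_le (by omega) (by omega) (by omega) (by omega)
        (by omega)))
      (le_softO ht (distributionFreeTester_queries_le hk hε hε1 (by omega) hN rfl))
      (fun f hf => (cost_distributionFreeTester_of_mem (cardK (hjunta f hf)) h0 hv hL hf).trans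
        quarter)
      fun f hf => cost_distributionFreeTester_of_far hE (by omega) hL hv (hf.le_mass hε)
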